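/- Call a cubic graph $H$ on $14$ vertices \emph{good} if any two distinct non-adjacent vertices of $H$ have at most one common neighbour. Let $yz$ be an (ordered) edge of a good graph $H$ that is not contained in a $3$-clique. The \emph{segment} of $(H,yz)$ is the subgraph $S$ of $H$ induced on $H\setminus\{y,z\}$, together with its \emph{first handle} (the two neighbours of $y$ other than $z$) and its \emph{second handle} (the two neighbours of $z$ other than $y$). The \emph{core} of $S$ with respect to one of its handles is the set of vertices of $S$ that lie in neither handle and are not adjacent to any vertex of that handle. The segment has \emph{type} $(c_1,c_2)$, where $c_i$ is the size of the core with respect to the $i$th handle. (Always $c_i\in\{4,6\}$: $c_i=6$ if the $i$th handle is an edge, and $c_i=4$ if it is a non-edge.) A \emph{segment pair} consists of two segments $A$ and $B$, neither of them of type $(4,6)$, glued along their first handles: it is given by an isomorphism between the subgraphs of $A$ and $B$ induced on the first handles, and the glued graph is obtained from the disjoint union of $A$ and $B$ by identifying the vertices that correspond under this isomorphism. Two segment pairs are \emph{isomorphic} if there is an isomorphism between the glued graphs that maps the two segments of one pair (in either order) onto the two segments of the other, with first handles going to first handles and second handles to second handles. Proposition. Up to isomorphism there are exactly $86333$ segment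 pairs. Among them, there are exactly $281$ made of two segments of type $(6,6)$, $2249$ made of a segment of type $(6,6)$ and a segment of type $(6,4)$, $4851$ made of two segments of type $(6,4)$, and $78952$ made of two segments of type $(4,4)$. -/

import Mathlib

/-- A good cubic graph: a cubic graph in which any two distinct non-adjacent vertices have at most
one common neighbour. (It is used below for graphs on the 14-element vertex set `Fin 14`.) -/
structure IsGoodCubic {V : Type} (H : SimpleGraph V) : Prop where
  cubic : ∀ v, (H.neighborSet v).ncard = 3
  common : ∀ u v, u ≠ v → ¬ H.Adj u v → (H.commonNeighbors u v).ncard ≤ 1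

/-- A segment, given by a good cubic graph `H` on 14 vertices and an ordered edge `yz` of `H` that
is not contained in a 3-clique. The underlying graph and the two handles are defined below. -/
structure Segment where
  H : SimpleGraph (Fin 14)
  good : IsGoodCubic H
  y : Fin 14
  z : Fin 14
  adj : H.Adj y z
  no_triangle : ∀ w, ¬ (H.Adj y w ∧ H.Adj z w)

namespace Segment

/-- The 12-element set `H \ {y, z}`. -/
def carrier (S : Segment) : Set (Fin 14) := {v | v ≠ S.y ∧ v ≠ S.z}

/-- The vertex type of the segment. -/
abbrev Vertex (S : Segment) : Type := S.carrier

/-- The graph of the segment: the subgraph of `H` induced on `H \ {y, z}`. -/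
def graph (S : Segment) : SimpleGraph S.Vertex := S.H.induce S.carrier

/-- The first handle: the neighbours of `y` other than `z`. -/
def handle₁ (S : Segment) : Set S.Vertex := {v | S.H.Adj S.y v}

/-- The second handle: the neighbours of `z` other than `y`. -/
def handle₂ (S : Segment) : Set S.Vertex := {v | S.H.Adj S.z v}

/-- The core with respect to a handle `Y`: the vertices outside both handles that are not adjacent
to any vertex of `Y`. -/
def core (S : Segment) (Y : Set S.Vertex) : Set S.Vertex :=
  {v | v ∉ S.handle₁ ∧ v ∉ S.handle₂ ∧ ∀ u ∈ Y, ¬ S.graph.Adj u v}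

/-- The type of the segment: the sizes of its cores with respect to the first and the second
handle. -/
noncomputable def type (S : Segment) : ℕ × ℕ :=
  ((S.core S.handle₁).ncard, (S.core S.handle₂).ncard)

end Segment

/-- A segment pair: two segments, neither of type `(4, 6)`, with a gluing along their first
handles, that is, an isomorphism between the subgraphs induced on the first handles. -/
structure SegmentPair where
  A : Segment
  B : Segment
  hA : A.type ≠ (4, 6)
  hB : B.type ≠ (4, 6)
  glue : A.graph.induce A.handle₁ ≃g B.graph.induce B.handle₁

namespace SegmentPair

/-- The identification made by the gluing on the disjoint union of the two vertex sets. -/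
inductive Rel (P : SegmentPair) : P.A.Vertex ⊕ P.B.Vertex → P.A.Vertex ⊕ P.B.Vertex → Prop
  | glue (h : P.A.handle₁) : Rel P (Sum.inl h) (Sum.inr (P.glue h))

/-- The vertices of the glued graph. -/
def Vertex (P : SegmentPair) : Type := Quot P.Rel

/-- The map of the first segment into the glued graph. -/
def inA (P : SegmentPair) (a : P.A.Vertex) : P.Vertex := Quot.mk _ (Sum.inl a)

/-- The map of the second segment into the glued graph. -/
def inB (P : SegmentPair) (b : P.B.Vertex) : P.Vertex := Quot.mk _ (Sum.inr b)

/-- The glued graph: its edges are the edges coming from the two segments. -/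
def graph (P : SegmentPair) : SimpleGraph P.Vertex :=
  SimpleGraph.map P.inA P.A.graph ⊔ SimpleGraph.map P.inB P.B.graph

/-- The first segment inside the glued graph: its vertex set and its two handles. -/
def partA (P : SegmentPair) : Set P.Vertex × Set P.Vertex × Set P.Vertex :=
  (Set.range P.inA, P.inA '' P.A.handle₁, P.inA '' P.A.handle₂)

/-- The second segment inside the glued graph: its vertex set and its two handles. -/
def partB (P : SegmentPair) : Set P.Vertex × Set P.Vertex × Set P.Vertex :=
  (Set.range P.inB, P.inB '' P.B.handle₁, P.inB '' P.B.handle₂)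

/-- The image of a triple of sets under a map. -/
def mapTriple {V W : Type} (f : V → W) (t : Set V × Set V × Set V) : Set W × Set W × Set W :=
  (f '' t.1, f '' t.2.1, f '' t.2.2)

theorem mapTriple_id {V : Type} (t : Set V × Set V × Set V) : mapTriple id t = t := by
  simp [mapTriple]

theorem mapTriple_comp {U V W : Type} (g : V → W) (f : U → V) (t : Set U × Set U × Set U) :
    mapTriple (g ∘ f) t = mapTriple g (mapTriple f t) := by
  simp only [mapTriple, Set.image_comp]

/-- Isomorphism of segment pairs: an isomorphism of the glued graphs that carries the two segments
with their first and second handles to the two segments with their first and second handles.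
A pair is unordered, so the two segments may be matched in either order. -/
def Isomorphic (P Q : SegmentPair) : Prop :=
  ∃ f : P.graph ≃g Q.graph,
    (mapTriple f P.partA = Q.partA ∧ mapTriple f P.partB = Q.partB) ∨
    (mapTriple f P.partA = Q.partB ∧ mapTriple f P.partB = Q.partA)

theorem Isomorphic.refl (P : SegmentPair) : Isomorphic P P :=
  ⟨SimpleGraph.Iso.refl, Or.inl ⟨mapTriple_id _, mapTriple_id _⟩⟩

theorem mapTriple_symm {P Q : SegmentPair} (f : P.graph ≃g Q.graph)
    {s : Set P.Vertex × Set P.Vertex × Set P.Vertex}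
    {t : Set Q.Vertex × Set Q.Vertex × Set Q.Vertex} (h : mapTriple f s = t) :
    mapTriple f.symm t = s := by
  have hf : (f.symm ∘ f : P.Vertex → P.Vertex) = id := by
    funext x
    exact f.symm_apply_apply x
  rw [← h, ← mapTriple_comp, hf, mapTriple_id]

theorem Isomorphic.symm {P Q : SegmentPair} : Isomorphic P Q → Isomorphic Q P := by
  rintro ⟨f, ⟨h₁, h₂⟩ | ⟨h₁, h₂⟩⟩
  · exact ⟨f.symm, Or.inl ⟨mapTriple_symm f h₁, mapTriple_symm f h₂⟩⟩
  · exact ⟨f.symm, Or.inr ⟨mapTriple_symm f h₂, mapTriple_symm f h₁⟩⟩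

theorem Isomorphic.trans {P Q R : SegmentPair} :
    Isomorphic P Q → Isomorphic Q R → Isomorphic P R := by
  rintro ⟨f, hf⟩ ⟨g, hg⟩
  have key : ∀ s, mapTriple (f.trans g) s = mapTriple g (mapTriple f s) :=
    fun s => mapTriple_comp g f s
  refine ⟨f.trans g, ?_⟩
  rw [key, key]
  rcases hf with ⟨h₁, h₂⟩ | ⟨h₁, h₂⟩ <;> rcases hg with ⟨k₁, k₂⟩ | ⟨k₁, k₂⟩ <;>
    rw [h₁, h₂, k₁, k₂] <;> simp

instance setoid : Setoid SegmentPair where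
  r := Isomorphic
  iseqv := ⟨Isomorphic.refl, Isomorphic.symm, Isomorphic.trans⟩

/-- The pair is made of a segment of type `s` and a segment of type `t`. -/
def IsOfTypes (P : SegmentPair) (s t : ℕ × ℕ) : Prop :=
  (P.A.type = s ∧ P.B.type = t) ∨ (P.A.type = t ∧ P.B.type = s)

end SegmentPair

/-- Isomorphism classes of segment pairs. -/
def SegmentPairClass : Type := Quotient SegmentPair.setoid

/-- The set of isomorphism classes of segment pairs that are made of a segment of type `s` and a
segment of type `t`. -/
def SegmentPairClass.ofTypes (s t : ℕ × ℕ) : Set SegmentPairClass :=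
  {c | ∃ P : SegmentPair, P.IsOfTypes s t ∧ Quotient.mk SegmentPair.setoid P = c}

/-! Distinguish a vertex of the first handle of a segment. The graph `H` then has three marked
vertices: `y`, `z` and a neighbour of `y`. Number them `0`, `1`, `2`, and number the rest so that
the sequence of columns of the adjacency matrix above the diagonal is lexicographically largest. The
resulting graph, a `CanonGraph`, is a complete invariant of the segment with its distinguished
vertex (`canonGraph_eq_iff`).

A first handle has exactly two vertices, so a gluing is determined by the image of one of them. A
segment pair with a distinguished glued vertex is therefore described by an ordered pair of
canonical graphs (`canonPair`). Such a pair of graphs occurs exactly when neither type is (4,6) and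
the first handles are both edges or both non-edges. Choosing the other glued vertex applies an
involution `turn` to both entries, and exchanging the segments swaps the entries. Classes of segment
pairs are thus the orbits of a group of order 4 (`isomorphic_iff_canonPair`), and Burnside's lemma
counts them. If a type has `n` canonical graphs, `s` of them fixed by `turn`, then the classes with
both segments of this type number (n² + s² + 2n)/4; two different types with compatible handles give
(nn' + ss')/2. The type only depends on whether `y` and `z` lie in triangles (`type_eq`): a handle
is an edge or not, and inclusion-exclusion gives a core of 6 or 4 vertices.

It remains to find (n, s) = (32, 6), (137, 19), (559, 47) for the types (6,6), (6,4), (4,4). A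
search adds the vertices in numerical order. In a canonical numbering the next vertex must be joined
to the first vertex of degree less than 3 (`Canon.first_adj`), which leaves few choices; counts of
free edge ends, the condition on common neighbours and one early comparison of codes cut the tree
further. These cuts only have to spare canonical graphs (`output_mem_search`), since each leaf tests
everything again (`exists_of_mem_search`). The outputs determine their graphs and are checked to be
distinct, so counting outputs counts graphs. The evaluation is done by the kernel on graphs packed
into natural numbers; most of the file shows that the packed arithmetic means what it should. -/

namespace SegmentCount

/-! ### Programs meant to be run by the kernel

A vertex `t` is represented by the number `B ^ t`; a function `f` on the vertices by the number
`∑ f t * B ^ t`. The base is odd so that the low bits of such numbers are well mixed. -/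

/-- Apply `f` to the value of `n`; the recursor makes the kernel evaluate `n` first. -/
noncomputable def force {α : Type} (n : ℕ) (f : ℕ → α) : α :=
  Nat.rec (f 0) (fun k _ => f (Nat.succ k)) n

/-- Apply `f` to the value of the list `l`, evaluated first. -/
noncomputable def forceList {α : Type} (l : List ℕ) (f : List ℕ → α) : α :=
  List.rec (motive := fun _ => (List ℕ → α) → α) (fun f => f [])
    (fun h _ ih f => force h fun h' => ih fun t' => f (List.cons h' t')) l f

/-- If-then-else on a Boolean. -/
noncomputable def cnd {α : Type} (b : Bool) (x y : α) : α := Bool.rec y x b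

/-- Some element of the list satisfies `p`. -/
noncomputable def anyList (p : ℕ → Bool) (l : List ℕ) : Bool :=
  List.rec false (fun h _ ih => cnd (p h) true ih) l

/-- The elements of the list that satisfy `p`. -/
noncomputable def filterList (p : ℕ → Bool) (l : List ℕ) : List ℕ :=
  List.rec [] (fun h _ ih => cnd (p h) (List.cons h ih) ih) l

/-- The concatenation of the lists `f h`. -/
noncomputable def flatList {β : Type} (f : ℕ → List β) (l : List ℕ) : List β :=
  List.rec [] (fun h _ ih => List.append (f h) ih) l

/-- The concatenation of the lists `f h t`, over the elements `h` and the rests `t` after them. -/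
noncomputable def flatTails {β : Type} (f : ℕ → List ℕ → List β) (l : List ℕ) : List β :=
  List.rec [] (fun h t ih => List.append (f h t) ih) l

/-- The base of the packed numbers. -/
def B : ℕ := 32771

/-- The base of the packed matrices. -/
def BB : ℕ := B ^ 14

/-- The row of the packed matrix `G` at the vertex `P`. -/
def row (G P : ℕ) : ℕ := Nat.mod (Nat.div G (Nat.pow P 14)) BB

/-- The value of the packed function `D` at the vertex `P`. -/
def field (D P : ℕ) : ℕ := Nat.mod (Nat.div D P) B

/-- The bit `2 ^ t` of the vertex `B ^ t`. -/
def bit (u : ℕ) : ℕ := Nat.pow 2 (Nat.div (Nat.log2 u) 15)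

/-- Search for a numbering of the vertices `vs` whose code agrees with the code `C` until it
exceeds it (counted if `lt`), or agrees with `C` everywhere (counted if `eq`). -/
noncomputable def compareCodes (vs : List ℕ) (G C : ℕ) (lt eq : Bool) (k : ℕ) :
    ℕ → ℕ → ℕ → Bool :=
  Nat.rec (fun _ _ _ => eq) (fun _ ih p w D =>
    force (field C p) fun c => anyList (fun t =>
      cnd (Nat.ble c (field D t))
        (cnd (Nat.beq (field D t) c)
          (force (Nat.add D (Nat.add (Nat.mul (row G t) w) (Nat.mul t 16384)))
            (ih (Nat.mul p B) (Nat.div w 2)))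
          (cnd (Nat.ble (field D t) 16383) lt false)) false) vs) k

/-- The packed columns after the vertices `0, 1, a` have been numbered. -/
def start (G a : ℕ) : ℕ :=
  Nat.add (Nat.add (Nat.add (Nat.mul (row G 1) 8192) (Nat.mul (row G B) 4096))
    (Nat.mul (row G a) 2048)) (Nat.mul 16384 (Nat.add (Nat.add 1 B) a))

/-- Some numbering of the vertices `vs` has a larger code. -/
noncomputable def improvable (vs : List ℕ) (k G C : ℕ) : Bool :=
  force (start G (B ^ 2)) (compareCodes vs G C true false k (B ^ 3) 1024)

/-- Some numbering of the vertices `vs` that moves the vertex `2` to `3` has the same code. -/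
noncomputable def symmetric (vs : List ℕ) (k G C : ℕ) : Bool :=
  force (start G (B ^ 3)) (compareCodes vs G C false true k (B ^ 3) 1024)

/-- All common neighbours of two vertices in `l` belong to the bit set `s`. -/
noncomputable def commonIn (H s : ℕ) (l : List ℕ) : Bool :=
  List.rec true (fun x xs ih =>
    cnd (anyList (fun y => force (Nat.land (field H x) (field H y)) fun a =>
      cnd (Nat.beq (Nat.land a s) a) false true) xs) false ih) l

/-- The bit set of a list of vertices. -/
noncomputable def bits (l : List ℕ) : ℕ := List.rec 0 (fun u _ ih => Nat.add ih (bit u)) l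

/-- Join the new vertex `m` to the vertices in `l`, in a packed matrix. -/
noncomputable def addMatrix (G m : ℕ) (l : List ℕ) : ℕ :=
  List.rec G (fun u _ ih =>
    Nat.add ih (Nat.add (Nat.mul (Nat.pow u 14) m) (Nat.mul (Nat.pow m 14) u))) l

/-- Join the new vertex `m` to the vertices in `l`, in a packed list of bit sets. -/
noncomputable def addBits (H m s : ℕ) (l : List ℕ) : ℕ :=
  List.rec (Nat.add H (Nat.mul m s)) (fun u _ ih => Nat.add ih (Nat.mul u (bit m))) l

/-- Join the new vertex `m` to the vertices in `l`, in a packed code. -/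
noncomputable def addCode (C m : ℕ) (l : List ℕ) : ℕ :=
  List.rec C (fun u _ ih => Nat.add ih (Nat.mul m (Nat.div 8192 (bit u)))) l

/-- At most one bit is set. -/
def atMostOne (x : ℕ) : Bool := Nat.ble x (Nat.pow 2 (Nat.log2 x))

/-- Each vertex in the list has degree 3 and has at most one common neighbour with any later
non-adjacent vertex of the list. -/
noncomputable def goodList (G H : ℕ) (l : List ℕ) : Bool :=
  List.rec true (fun x xs ih =>
    cnd (Nat.beq (Nat.mod (row G x) (Nat.sub B 1)) 3)
      (cnd (anyList (fun y =>
          cnd (atMostOne (Nat.land (field H x) (field H y))) false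
            (Nat.beq (Nat.land (field H x) (bit y)) 0)) xs) false ih) false) l

/-- The vertex `x` lies in a triangle. -/
noncomputable def inTriangle (H : ℕ) (vs : List ℕ) (x : ℕ) : Bool :=
  anyList (fun y => cnd (Nat.beq (Nat.land (field H x) (bit y)) 0) false
    (cnd (Nat.beq (Nat.land (field H x) (field H y)) 0) false true)) vs

/-- The kind of a graph: whether `0` and `1` lie in triangles, and whether `2` can be moved to
`3`. -/
noncomputable def kindOf (vs : List ℕ) (G H C : ℕ) : ℕ :=
  Nat.add (cnd (inTriangle H vs 1) 0 4)
    (Nat.add (cnd (inTriangle H vs B) 0 2) (cnd (symmetric vs 11 G C) 1 0))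

/-- The output for a graph on all 14 vertices: its code with its kind, if it is canonical and
good. -/
noncomputable def leaf (vs : List ℕ) (G H C : ℕ) : List ℕ :=
  cnd (improvable vs 11 G C) []
    (cnd (Nat.beq (Nat.land (field H 1) (field H B)) 0)
      (cnd (goodList G H vs) [Nat.add (Nat.mul C 8) (kindOf vs G H C)] []) [])

/-- The tests for joining the new vertex `m` to the vertices in `l`; `r` is the number of vertices
still to come after `m`. -/
noncomputable def extend (r m G H C : ℕ) (vs l : List ℕ) (K : ℕ → ℕ → ℕ → List ℕ) : List ℕ :=
  force (bits l) fun s => cnd (commonIn H s l)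
    (force (addBits H m s l) fun H' => cnd (Nat.beq (Nat.land (field H' 1) (field H' B)) 0)
      (force (addMatrix G m l) fun G' => force (addCode C m l) fun C' =>
        cnd (cnd (Nat.beq r 4) (improvable vs 7 G' C') false) [] (K G' H' C')) []) []

/-- It is possible that `e` edges lead to `r` further vertices. -/
noncomputable def feasible (r e : ℕ) : Bool :=
  cnd (Nat.ble e (Nat.mul 3 r)) (Nat.ble (Nat.mul 3 r) (Nat.add e (Nat.mul r (Nat.sub r 1)))) false

/-- Choose the neighbours of the new vertex among the list `d` of vertices of degree less than 3:
the first of them and at most two others. -/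
noncomputable def branch (r e : ℕ) (d : List ℕ) (f : ℕ → List ℕ → List ℕ) : List ℕ :=
  List.rec (cnd (feasible r (Nat.add e 3)) (f (Nat.add e 3) []) [])
    (fun u us _ => List.append (cnd (feasible r (Nat.add e 1)) (f (Nat.add e 1) [u]) [])
      (List.append
        (cnd (feasible r (Nat.sub e 1))
          (force (Nat.sub e 1) fun e' => flatList (fun x => f e' [u, x]) us) [])
        (cnd (feasible r (Nat.sub e 3))
          (force (Nat.sub e 3) fun e' =>
            flatTails (fun x t => flatList (fun y => f e' [u, x, y]) t) us) []))) d

/-- The outputs for all extensions by `k` vertices. -/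
noncomputable def search (k : ℕ) : List ℕ → ℕ → ℕ → ℕ → ℕ → ℕ → List ℕ :=
  Nat.rec (fun vs _ _ G H C => leaf vs G H C)
    (fun k ih vs m e G H C =>
      forceList (filterList (fun u => Nat.ble (Nat.mod (row G u) (Nat.sub B 1)) 2) vs) fun d =>
      forceList (List.append vs [m]) fun vs' =>
      branch k e d fun e' l => extend k m G H C vs' l (ih vs' (Nat.mul m B) e')) k

/-- The outputs for all graphs. -/
noncomputable def outputs : List ℕ :=
  search 11 [1, B, B ^ 2] (B ^ 3) 5 (B + B ^ 2 + BB + BB ^ 2) (6 + B + B ^ 2)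
    (B * 8192 + B ^ 2 * 8192)

/-- The list has no repetitions. -/
noncomputable def distinctList (l : List ℕ) : Bool :=
  List.rec true (fun x xs ih => cnd (anyList (fun y => Nat.beq x y) xs) false ih) l

/-- The number of outputs of kind `k` in the list. -/
noncomputable def countKind (k : ℕ) (l : List ℕ) : ℕ :=
  List.rec 0 (fun x _ ih => cnd (Nat.beq (Nat.mod x 8) k) (Nat.succ ih) ih) l

/-- The list has no repetitions and the expected numbers of outputs of each kind. -/
noncomputable def checkList (l : List ℕ) : Bool :=
  cnd (distinctList l)
    (cnd (Nat.beq (countKind 0 l) 26)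
      (cnd (Nat.beq (countKind 1 l) 6)
        (cnd (Nat.beq (countKind 2 l) 118)
          (cnd (Nat.beq (countKind 3 l) 19)
            (cnd (Nat.beq (countKind 6 l) 512) (Nat.beq (countKind 7 l) 47) false)
            false) false) false) false) false

end SegmentCount

namespace SegmentCount

open Finset

/-! ### What the basic programs compute -/

@[simp] theorem force_eq {α : Type} (n : ℕ) (f : ℕ → α) : force n f = f n := by
  cases n <;> rfl

@[simp] theorem forceList_eq {α : Type} (l : List ℕ) (f : List ℕ → α) : forceList l f = f l := by
  induction l generalizing f with
  | nil => rfl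
  | cons h t ih =>
    change force h (fun h' => forceList t fun t' => f (List.cons h' t')) = _
    rw [force_eq, ih]

@[simp] theorem cnd_eq {α : Type} (b : Bool) (x y : α) : cnd b x y = if b then x else y := by
  cases b <;> rfl

theorem anyList_eq (p : ℕ → Bool) (l : List ℕ) : anyList p l = l.any p := by
  induction l with
  | nil => rfl
  | cons h t ih =>
    change cnd (p h) true (anyList p t) = _
    rw [cnd_eq, ih, List.any_cons]
    cases p h <;> rfl

theorem anyList_iff (p : ℕ → Bool) (l : List ℕ) : anyList p l = true ↔ ∃ x ∈ l, p x = true := by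
  rw [anyList_eq, List.any_eq_true]

theorem filterList_eq (p : ℕ → Bool) (l : List ℕ) : filterList p l = l.filter p := by
  induction l with
  | nil => rfl
  | cons h t ih =>
    change cnd (p h) (List.cons h (filterList p t)) (filterList p t) = _
    rw [cnd_eq, ih, List.filter_cons]

theorem mem_flatList {β : Type} {f : ℕ → List β} {l : List ℕ} {x : β} :
    x ∈ flatList f l ↔ ∃ h ∈ l, x ∈ f h := by
  induction l with
  | nil => simp [flatList]
  | cons h t ih =>
    change x ∈ f h ++ flatList f t ↔ _
    simp [ih]

theorem mem_flatTails {β : Type} {f : ℕ → List ℕ → List β} {l : List ℕ} {x : β} :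
    x ∈ flatTails f l ↔ ∃ h t, (h :: t) <:+ l ∧ x ∈ f h t := by
  induction l with
  | nil => simp [flatTails]
  | cons a s ih =>
    change x ∈ f a s ++ flatTails f s ↔ _
    rw [List.mem_append, ih]
    constructor
    · rintro (h | ⟨h, t, hs, hx⟩)
      · exact ⟨a, s, List.suffix_rfl, h⟩
      · exact ⟨h, t, hs.trans (List.suffix_cons a s), hx⟩
    · rintro ⟨h, t, hs, hx⟩
      rcases List.suffix_cons_iff.1 hs with h1 | h1
      · obtain ⟨rfl, rfl⟩ := List.cons.inj h1
        exact Or.inl hx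
      · exact Or.inr ⟨h, t, h1, hx⟩

/-! ### Packed functions -/

/-- The number with digits `f 0, …, f (n - 1)` in base `b`. -/
def pack (b n : ℕ) (f : ℕ → ℕ) : ℕ := ∑ x ∈ range n, f x * b ^ x

theorem pack_succ (b n : ℕ) (f : ℕ → ℕ) : pack b (n + 1) f = pack b n f + f n * b ^ n :=
  sum_range_succ _ _

theorem pack_congr {b n : ℕ} {f g : ℕ → ℕ} (h : ∀ x < n, f x = g x) : pack b n f = pack b n g :=
  sum_congr rfl fun x hx => by rw [h x (mem_range.1 hx)]

theorem pack_add (b n : ℕ) (f g : ℕ → ℕ) : pack b n (fun x => f x + g x) = pack b n f + pack b n g := by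
  simp only [pack, add_mul, sum_add_distrib]

theorem pack_mul (b n c : ℕ) (f : ℕ → ℕ) : pack b n (fun x => f x * c) = pack b n f * c := by
  simp only [pack, sum_mul]
  exact sum_congr rfl fun x _ => by ring

theorem pack_single {b n t : ℕ} (ht : t < n) (c : ℕ) :
    pack b n (fun x => if x = t then c else 0) = b ^ t * c := by
  rw [pack, sum_eq_single_of_mem t (mem_range.2 ht)]
  · simp [mul_comm]
  · intro x _ hx
    simp [hx]

theorem pack_lt {b n : ℕ} {f : ℕ → ℕ} (h : ∀ x < n, f x < b) : pack b n f < b ^ n := by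
  induction n with
  | zero => simp [pack]
  | succ n ih =>
    rw [pack_succ, pow_succ]
    have h1 := ih fun x hx => h x (by omega)
    have h2 : (f n + 1) * b ^ n ≤ b * b ^ n := Nat.mul_le_mul_right _ (h n (by omega))
    nlinarith

theorem pack_digit {b n k : ℕ} {f : ℕ → ℕ} (h : ∀ x < n, f x < b) (hk : k < n) :
    pack b n f / b ^ k % b = f k := by
  have hb : 0 < b := (Nat.zero_le _).trans_lt (h k hk)
  induction n with
  | zero => omega
  | succ n ih =>
    rw [pack_succ]
    rcases Nat.lt_succ_iff_lt_or_eq.1 hk with hk | rfl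
    · have : f n * b ^ n = b ^ k * (b * (b ^ (n - k - 1) * f n)) := by
        rw [show n = k + 1 + (n - k - 1) by omega]
        simp only [pow_add, show k + 1 + (n - k - 1) - k - 1 = n - k - 1 by omega]
        ring
      rw [this, Nat.add_mul_div_left _ _ (pow_pos hb k), Nat.add_mul_mod_self_left]
      exact ih (fun x hx => h x (by omega)) hk
    · rw [Nat.add_mul_div_right _ _ (pow_pos hb k),
        Nat.div_eq_of_lt (pack_lt fun x hx => h x (by omega)), zero_add,
        Nat.mod_eq_of_lt (h k (by omega))]

/-- Casting out `b - 1`: since `b ≡ 1`, a number is congruent to its digit sum. This turns a packed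
row of an adjacency matrix into a degree with a single division. -/
theorem pack_mod {b n : ℕ} (hb : 0 < b) {f : ℕ → ℕ} (h : ∑ x ∈ range n, f x < b - 1) :
    pack b n f % (b - 1) = ∑ x ∈ range n, f x := by
  have h1 : pack b n f ≡ ∑ x ∈ range n, f x [MOD b - 1] := by
    clear h
    induction n with
    | zero => rfl
    | succ n ih =>
      rw [pack_succ, sum_range_succ]
      refine ih.add ?_
      have h2 : b ≡ 1 [MOD b - 1] := by
        have := Nat.ModEq.symm (Nat.modEq_of_dvd (n := b - 1) (a := 1) (b := b) (by
          rw [Nat.cast_sub hb]))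
        exact this
      simpa using (Nat.ModEq.refl (f n)).mul (h2.pow n)
  rw [h1, Nat.mod_eq_of_lt h]

theorem testBit_pack {n k : ℕ} {f : ℕ → ℕ} (h : ∀ x, f x ≤ 1) :
    (pack 2 n f).testBit k = true ↔ k < n ∧ f k = 1 := by
  have h2 : ∀ x < n, f x < 2 := fun x _ => by have := h x; omega
  rcases lt_or_ge k n with hk | hk
  · rw [Nat.testBit_eq_decide_div_mod_eq, pack_digit h2 hk]
    simp [hk]
  · rw [Nat.testBit_lt_two_pow ((pack_lt h2).trans_le (Nat.pow_le_pow_right (by norm_num) hk))]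
    simp; omega

/-- `2 ^ x.log2` is the leading bit of `x`, so `x` exceeds it exactly when a lower bit is set. For
`x = 0` the bound is `2 ^ 0`, and the test succeeds as it should. -/
theorem atMostOne_iff (x : ℕ) :
    atMostOne x = true ↔ ∀ i j, x.testBit i = true → x.testBit j = true → i = j := by
  have h0 : atMostOne x = true ↔ x ≤ 2 ^ x.log2 := by
    change Nat.ble _ _ = true ↔ _
    rw [Nat.ble_eq]; rfl
  rw [h0]
  rcases Nat.eq_zero_or_pos x with rfl | hx
  · simp
  have h1 : 2 ^ x.log2 ≤ x := Nat.log2_self_le hx.ne'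
  constructor
  · intro h i j hi hj
    rw [le_antisymm h h1, Nat.testBit_two_pow] at hi hj
    simp only [decide_eq_true_eq] at hi hj
    omega
  · intro h
    by_contra hlt
    have hne : x ≠ 2 ^ x.log2 := by omega
    obtain ⟨i, hi⟩ := Nat.exists_testBit_ne_of_ne hne
    have hl : x.testBit x.log2 = true := by
      rw [Nat.testBit_log2 hx.ne']
    rcases eq_or_ne x.log2 i with hi' | hi'
    · subst hi'
      rw [hl, Nat.testBit_two_pow_self] at hi
      exact hi rfl
    · rw [Nat.testBit_two_pow_of_ne hi'] at hi
      exact hi' (h _ _ hl (by simpa using hi))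

/-- `B = 2 ^ 15 + 3` is so close to `2 ^ 15` that `B ^ j` still lies between `2 ^ (15 j)` and its
double for these `j`. -/
theorem bit_pow {j : ℕ} (hj : j < 14) : bit (B ^ j) = 2 ^ j := by
  revert j
  decide +kernel

theorem row_eq (G t : ℕ) : row G (B ^ t) = G / BB ^ t % BB := by
  change G / (B ^ t) ^ 14 % BB = _
  rw [← pow_mul, mul_comm, pow_mul]
  rfl

theorem field_pack {n k : ℕ} {f : ℕ → ℕ} (h : ∀ x < n, f x < B) (hk : k < n) :
    field (pack B n f) (B ^ k) = f k := pack_digit h hk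

end SegmentCount

namespace SegmentCount

open Finset

/-! ### Canonical numberings -/

open Classical in
/-- The adjacency matrix of a graph on `Fin 14`, extended by zeros. -/
noncomputable def adjNum (G : SimpleGraph (Fin 14)) (i j : ℕ) : ℕ :=
  if ∃ (hi : i < 14) (hj : j < 14), G.Adj ⟨i, hi⟩ ⟨j, hj⟩ then 1 else 0

/-! ### Adjacency matrices with entries 0 and 1 -/

section adjNum

variable (G : SimpleGraph (Fin 14))

theorem adjNum_le (i j : ℕ) : adjNum G i j ≤ 1 := by
  unfold adjNum
  split_ifs <;> simp

theorem adjNum_eq_one {i j : ℕ} :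
    adjNum G i j = 1 ↔ ∃ (hi : i < 14) (hj : j < 14), G.Adj ⟨i, hi⟩ ⟨j, hj⟩ := by
  unfold adjNum
  split_ifs with h <;> simp [h]

theorem adjNum_fin {i j : Fin 14} : adjNum G i j = 1 ↔ G.Adj i j := by
  simp [adjNum_eq_one]

theorem adjNum_comm (i j : ℕ) : adjNum G i j = adjNum G j i := by
  have h : adjNum G i j = 1 ↔ adjNum G j i = 1 := by
    simp only [adjNum_eq_one]
    exact ⟨fun ⟨a, b, c⟩ => ⟨b, a, c.symm⟩, fun ⟨a, b, c⟩ => ⟨b, a, c.symm⟩⟩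
  have := adjNum_le G i j
  have := adjNum_le G j i
  omega

@[simp] theorem adjNum_self (i : ℕ) : adjNum G i i = 0 := by
  have h : ¬ adjNum G i i = 1 := by simp [adjNum_eq_one]
  have := adjNum_le G i i
  omega

theorem sum_adjNum (i : Fin 14) : ∑ j ∈ range 14, adjNum G i j = (G.neighborSet i).ncard := by
  classical
  rw [Finset.sum_range fun j => adjNum G i j, ← Nat.card_coe_set_eq, Nat.card_eq_fintype_card,
    SimpleGraph.card_neighborSet_eq_degree, ← SimpleGraph.card_neighborFinset_eq_degree,
    SimpleGraph.neighborFinset_eq_filter, card_filter]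
  refine sum_congr rfl fun j _ => ?_
  have := adjNum_le G i j
  have := adjNum_fin G (i := i) (j := j)
  split_ifs with h
  · exact this.2 h
  · have : ¬ adjNum G i j = 1 := fun h1 => h (this.1 h1)
    omega

end adjNum

/-- The column of the vertex `p`: its adjacencies with the earlier vertices. -/
def codeCol (A : ℕ → ℕ → ℕ) (p : ℕ) : ℕ := ∑ u ∈ range p, A u p * 2 ^ (13 - u)

/-- The remaining weights `2 ^ (13 - k), …, 2 ^ (14 - m)` form a geometric series with sum `2 ^ (14
- k) - 2 ^ (14 - m)`. Hence an earlier adjacency outweighs all later ones together. -/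
theorem sum_bits_lt {a : ℕ → ℕ} (ha : ∀ u, a u ≤ 1) {k : ℕ} (h0 : ∀ u < k, a u = 0) {m : ℕ}
    (hkm : k ≤ m) (hm : m ≤ 14) :
    ∑ u ∈ range m, a u * 2 ^ (13 - u) + 2 ^ (14 - m) ≤ 2 ^ (14 - k) := by
  induction m, hkm using Nat.le_induction with
  | base => simp +contextual [sum_eq_zero, h0]
  | succ m hkm ih =>
    rw [sum_range_succ]
    have h1 := ih (by omega)
    have h2 : a m * 2 ^ (13 - m) ≤ 1 * 2 ^ (13 - m) := Nat.mul_le_mul_right _ (ha m)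
    have h3 : (2 : ℕ) ^ (14 - m) = 2 * 2 ^ (13 - m) := by
      rw [show 14 - m = (13 - m) + 1 by omega, pow_succ]; ring
    rw [show 14 - (m + 1) = 13 - m by omega]
    omega

theorem sum_bits_inj {a b : ℕ → ℕ} (ha : ∀ u, a u ≤ 1) (hb : ∀ u, b u ≤ 1) {m : ℕ} (hm : m ≤ 14)
    (h : ∑ u ∈ range m, a u * 2 ^ (13 - u) = ∑ u ∈ range m, b u * 2 ^ (13 - u)) :
    ∀ u < m, a u = b u := by
  have key : ∀ c : ℕ → ℕ, (∀ u, c u ≤ 1) → ∀ u < m,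
      (∑ u ∈ range m, c u * 2 ^ (13 - u)) / 2 ^ (13 - u) % 2 = c u := by
    intro c hc u hu
    -- Read backwards, the sum is a binary expansion with 14 digits, and `pack_digit` applies.
    have h1 : ∑ u ∈ range m, c u * 2 ^ (13 - u) =
        pack 2 14 fun x => if 13 - x < m then c (13 - x) else 0 := by
      rw [pack, ← sum_range_reflect (fun x => (if 13 - x < m then c (13 - x) else 0) * 2 ^ x) 14]
      rw [← sum_subset (range_subset_range.2 hm)]
      · refine sum_congr rfl fun x hx => ?_
        have hx := mem_range.1 hx
        rw [show 13 - (14 - 1 - x) = x by omega, if_pos hx, show 14 - 1 - x = 13 - x by omega]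
      · intro x hx hx'
        have hx := mem_range.1 hx
        rw [show 13 - (14 - 1 - x) = x by omega, if_neg (by simpa using hx'), zero_mul]
    rw [h1, pack_digit _ (by omega)]
    · rw [if_pos (by omega), show 13 - (13 - u) = u by omega]
    · intro x _
      have := hc (13 - x)
      split_ifs <;> omega
  intro u hu
  rw [← key a ha u hu, h, key b hb u hu]

/-- The graph with the vertices renumbered. -/
def relabel (G : SimpleGraph (Fin 14)) (σ : Equiv.Perm (Fin 14)) : SimpleGraph (Fin 14) :=
  G.comap σ

theorem relabel_adj {G : SimpleGraph (Fin 14)} {σ : Equiv.Perm (Fin 14)} {i j : Fin 14} :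
    (relabel G σ).Adj i j ↔ G.Adj (σ i) (σ j) := Iff.rfl

theorem relabel_relabel (G : SimpleGraph (Fin 14)) (σ τ : Equiv.Perm (Fin 14)) :
    relabel (relabel G σ) τ = relabel G (σ * τ) := rfl

theorem relabel_one (G : SimpleGraph (Fin 14)) : relabel G 1 = G := rfl

theorem adjNum_relabel (G : SimpleGraph (Fin 14)) (σ : Equiv.Perm (Fin 14)) (i j : Fin 14) :
    adjNum (relabel G σ) i j = adjNum G (σ i) (σ j) := by
  have h : adjNum (relabel G σ) i j = 1 ↔ adjNum G (σ i) (σ j) = 1 := by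
    simp only [adjNum_fin, relabel_adj]
  have := adjNum_le (relabel G σ) i j
  have := adjNum_le G (σ i) (σ j)
  omega

/-- The columns contain all entries above the diagonal, and the matrix is symmetric with zero
diagonal. -/
theorem eq_of_code_eq {G G' : SimpleGraph (Fin 14)}
    (h : ∀ p < 14, codeCol (adjNum G) p = codeCol (adjNum G') p) : G = G' := by
  have key : ∀ u p : Fin 14, u < p → (G.Adj u p ↔ G'.Adj u p) := by
    intro u p hup
    rw [← adjNum_fin, ← adjNum_fin, sum_bits_inj (fun u => adjNum_le G u p)
      (fun u => adjNum_le G' u p) p.2.le (h p p.2) u hup]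
  ext u p
  rcases lt_trichotomy u p with hup | rfl | hup
  · exact key u p hup
  · simp
  · rw [G.adj_comm, G'.adj_comm]
    exact key p u hup

/-- The lexicographic order of codes. -/
def LexLt (f g : ℕ → ℕ) : Prop := ∃ q < 14, (∀ j < q, f j = g j) ∧ f q < g q

theorem lexLt_trichotomy (f g : ℕ → ℕ) : LexLt f g ∨ (∀ j < 14, f j = g j) ∨ LexLt g f := by
  by_cases h : ∀ j < 14, f j = g j
  · exact Or.inr (Or.inl h)
  push Not at h
  classical
  obtain ⟨h1, h2⟩ := Nat.find_spec h
  have h3 : ∀ j < Nat.find h, f j = g j := by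
    intro j hj
    by_contra hne
    exact Nat.find_min h hj ⟨hj.trans h1, hne⟩
  rcases lt_or_gt_of_ne h2 with h4 | h4
  · exact Or.inl ⟨_, h1, h3, h4⟩
  · exact Or.inr (Or.inr ⟨_, h1, fun j hj => (h3 j hj).symm, h4⟩)

/-- The numbering has the largest code among those with the same first three vertices. -/
def Canon (G : SimpleGraph (Fin 14)) : Prop :=
  ∀ σ : Equiv.Perm (Fin 14), σ 0 = 0 → σ 1 = 1 → σ 2 = 2 →
    ¬ LexLt (codeCol (adjNum G)) (codeCol (adjNum (relabel G σ)))

theorem exists_canon (G : SimpleGraph (Fin 14)) :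
    ∃ σ : Equiv.Perm (Fin 14), σ 0 = 0 ∧ σ 1 = 1 ∧ σ 2 = 2 ∧ Canon (relabel G σ) := by
  classical
  let S : Finset (Equiv.Perm (Fin 14)) := Finset.univ.filter fun σ => σ 0 = 0 ∧ σ 1 = 1 ∧ σ 2 = 2
  have hS : S.Nonempty := ⟨1, by simp [S]⟩
  obtain ⟨σ, hσ, hmax⟩ := S.exists_max_image
    (fun σ => toLex fun p : Fin 14 => codeCol (adjNum (relabel G σ)) p) hS
  obtain ⟨h0, h1, h2⟩ := (mem_filter.1 hσ).2
  refine ⟨σ, h0, h1, h2, ?_⟩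
  rintro τ t0 t1 t2 ⟨q, hq, heq, hlt⟩
  refine (hmax (σ * τ) (by simp [S, t0, t1, t2, h0, h1, h2])).not_gt ?_
  exact ⟨⟨q, hq⟩, fun j hj => heq j hj, hlt⟩

/-- Neither of two lexicographically largest codes can be smaller than the other, so they coincide,
and a code determines its graph. The permutation itself need not be trivial. -/
theorem Canon.eq {G : SimpleGraph (Fin 14)} (hG : Canon G) {σ : Equiv.Perm (Fin 14)}
    (h0 : σ 0 = 0) (h1 : σ 1 = 1) (h2 : σ 2 = 2) (hσ : Canon (relabel G σ)) :
    relabel G σ = G := by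
  rcases lexLt_trichotomy (codeCol (adjNum (relabel G σ))) (codeCol (adjNum G)) with h | h | h
  · refine (hσ σ⁻¹ ?_ ?_ ?_ ?_).elim
    · rw [Equiv.Perm.inv_eq_iff_eq, h0]
    · rw [Equiv.Perm.inv_eq_iff_eq, h1]
    · rw [Equiv.Perm.inv_eq_iff_eq, h2]
    · rwa [relabel_relabel, mul_inv_cancel, relabel_one]
  · exact eq_of_code_eq h
  · exact (hG σ h0 h1 h2 h).elim

/-- Exchanging `m` and `t` leaves the columns before `m` unchanged and puts the adjacencies of `t`
with the vertices before `m` into column `m`. -/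
theorem Canon.col_le {G : SimpleGraph (Fin 14)} (hG : Canon G) {m t : ℕ} (hm : 3 ≤ m) (hmt : m ≤ t)
    (ht : t < 14) :
    ∑ u ∈ range m, adjNum G u t * 2 ^ (13 - u) ≤ codeCol (adjNum G) m := by
  by_contra hlt
  push Not at hlt
  let m' : Fin 14 := ⟨m, by omega⟩
  let t' : Fin 14 := ⟨t, ht⟩
  have hfix : ∀ u : Fin 14, (u : ℕ) < m → Equiv.swap m' t' u = u := fun u hu =>
    Equiv.swap_apply_of_ne_of_ne (Fin.ne_of_val_ne (by simp [m']; omega))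
      (Fin.ne_of_val_ne (by simp [t']; omega))
  have hcol : ∀ j : Fin 14, (j : ℕ) ≤ m → codeCol (adjNum (relabel G (Equiv.swap m' t'))) j =
      ∑ u ∈ range j, adjNum G u (Equiv.swap m' t' j) * 2 ^ (13 - u) := by
    intro j hj
    refine sum_congr rfl fun u hu => ?_
    have hu := mem_range.1 hu
    have := adjNum_relabel G (Equiv.swap m' t') ⟨u, by omega⟩ j
    rw [hfix ⟨u, _⟩ (by simp; omega)] at this
    rw [← this]
  refine hG (Equiv.swap m' t') (hfix 0 (by simp; omega)) (hfix 1 (by simp; omega))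
    (hfix 2 (by simp; omega)) ⟨m, by omega, ?_, ?_⟩
  · intro j hj
    rw [hcol ⟨j, by omega⟩ hj.le, hfix _ hj]
    rfl
  · rw [hcol m' le_rfl, Equiv.swap_apply_left]
    exact hlt

theorem exists_later_of_sum_lt {A : ℕ → ℕ} {m : ℕ} (hm : m ≤ 14)
    (h : ∑ j ∈ range m, A j < ∑ j ∈ range 14, A j) : ∃ t, m ≤ t ∧ t < 14 ∧ A t ≠ 0 := by
  by_contra hne
  push Not at hne
  refine h.ne (sum_subset (range_subset_range.2 hm) fun t ht ht' => ?_)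
  exact hne t (by simpa using ht') (mem_range.1 ht)

/-- In a canonical numbering, the first vertex with neighbours from `m` on is adjacent to `m`. -/
theorem Canon.first_adj {G : SimpleGraph (Fin 14)} (hG : Canon G)
    (hcub : ∀ i < 14, ∑ j ∈ range 14, adjNum G i j = 3) {m u : ℕ} (hm : 3 ≤ m) (hm' : m < 14)
    (hum : u < m) (hu : ∑ j ∈ range m, adjNum G u j < 3)
    (hmin : ∀ v < u, adjNum G v m = 0) : adjNum G u m = 1 := by
  obtain ⟨t, hmt, ht, hne⟩ := exists_later_of_sum_lt (A := adjNum G u) hm'.le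
    (by rwa [hcub u (by omega)])
  by_contra hum1
  have h0 : adjNum G u m = 0 := by have := adjNum_le G u m; omega
  -- If neither `u` nor any earlier vertex is adjacent to `m`, then column `m` is less than `2 ^ (13
  -- - u)`; but `u` has a neighbour `t` beyond `m`, whose column is at least this large. That
  -- contradicts `Canon.col_le`.
  have h1 := sum_bits_lt (a := fun v => adjNum G v m) (k := u + 1) (fun v => adjNum_le G v m)
    (fun v hv => by
      rcases Nat.lt_succ_iff_lt_or_eq.1 hv with hv | rfl
      · exact hmin v hv
      · exact h0) hum hm'.le
  have h2 := hG.col_le hm hmt ht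
  have h3 : adjNum G u t * 2 ^ (13 - u) ≤ ∑ v ∈ range m, adjNum G v t * 2 ^ (13 - v) :=
    single_le_sum (f := fun v => adjNum G v t * 2 ^ (13 - v)) (fun _ _ => Nat.zero_le _)
      (mem_range.2 hum)
  have h4 : 1 * 2 ^ (13 - u) ≤ adjNum G u t * 2 ^ (13 - u) :=
    Nat.mul_le_mul_right _ (Nat.one_le_iff_ne_zero.2 hne)
  have h5 : 0 < 2 ^ (14 - m) := by positivity
  rw [show 14 - (u + 1) = 13 - u by omega] at h1
  change codeCol (adjNum G) m + _ ≤ _ at h1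
  omega

theorem saturated_of_adj {G : SimpleGraph (Fin 14)}
    (hcub : ∀ i < 14, ∑ j ∈ range 14, adjNum G i j = 3) {m u : ℕ} (hm : m < 14) (hum : u < m)
    (h : adjNum G u m = 1) : ∑ j ∈ range m, adjNum G u j < 3 := by
  have h1 : ∑ j ∈ range (m + 1), adjNum G u j ≤ ∑ j ∈ range 14, adjNum G u j :=
    sum_le_sum_of_subset (range_subset_range.2 hm)
  rw [sum_range_succ, h, hcub u (by omega)] at h1
  omega

end SegmentCount

namespace SegmentCount

open Finset

/-! ### The comparison of codes -/

/-- The packed adjacency matrix of the vertices before `m`. -/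
def mat (A : ℕ → ℕ → ℕ) (m : ℕ) : ℕ := pack BB m fun i => pack B m (A i)

/-- The packed code of the vertices before `m`. -/
def codeNum (A : ℕ → ℕ → ℕ) (m : ℕ) : ℕ := pack B m (codeCol A)

/-- The list of the vertices before `m`. -/
def verts (m : ℕ) : List ℕ := (List.range m).map (B ^ ·)

theorem mem_verts {m x : ℕ} : x ∈ verts m ↔ ∃ t < m, B ^ t = x := by
  simp [verts]

theorem row_mat {A : ℕ → ℕ → ℕ} (hA : ∀ i j, A i j ≤ 1) {m t : ℕ} (hm : m ≤ 14) (ht : t < m) :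
    row (mat A m) (B ^ t) = pack B m (A t) := by
  rw [row_eq, mat, pack_digit _ ht]
  intro x _
  exact (pack_lt fun y _ => (hA x y).trans_lt (by decide)).trans_le
    (Nat.pow_le_pow_right (by decide) hm)

theorem codeCol_lt {A : ℕ → ℕ → ℕ} (hA : ∀ i j, A i j ≤ 1) {p : ℕ} (hp : p ≤ 14) :
    codeCol A p < 2 ^ 14 := by
  have := sum_bits_lt (a := fun u => A u p) (k := 0) (fun u => hA u p) (by simp) (Nat.zero_le p) hp
  have : 0 < 2 ^ (14 - p) := by positivity
  simp only [codeCol]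
  omega

theorem field_codeNum {A : ℕ → ℕ → ℕ} (hA : ∀ i j, A i j ≤ 1) {m p : ℕ} (hm : m ≤ 14)
    (hp : p < m) : field (codeNum A m) (B ^ p) = codeCol A p :=
  field_pack (fun _ hx => (codeCol_lt hA (by omega)).trans (by decide)) hp

/-- The column of the vertex `t` after the positions before `p` have been filled by `σ`. -/
def colOf (A : ℕ → ℕ → ℕ) (σ : ℕ → ℕ) (p t : ℕ) : ℕ := ∑ j ∈ range p, A (σ j) t * 2 ^ (13 - j)

theorem colOf_congr {A : ℕ → ℕ → ℕ} {σ τ : ℕ → ℕ} {p : ℕ} (h : ∀ j < p, σ j = τ j) (t : ℕ) :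
    colOf A σ p t = colOf A τ p t :=
  sum_congr rfl fun j hj => by rw [h j (mem_range.1 hj)]

theorem colOf_lt {A : ℕ → ℕ → ℕ} (hA : ∀ i j, A i j ≤ 1) (σ : ℕ → ℕ) {p : ℕ} (hp : p ≤ 14)
    (t : ℕ) : colOf A σ p t < 2 ^ 14 := by
  have := sum_bits_lt (a := fun j => A (σ j) t) (k := 0) (fun j => hA _ t) (by simp)
    (Nat.zero_le p) hp
  have : 0 < 2 ^ (14 - p) := by positivity
  simp only [colOf]
  omega

open Classical in
/-- The column of the vertex `x`, with a mark if `x` has a position before `p`. -/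
noncomputable def marked (A : ℕ → ℕ → ℕ) (σ : ℕ → ℕ) (p x : ℕ) : ℕ :=
  colOf A σ p x + if ∃ j < p, σ j = x then 2 ^ 14 else 0

theorem marked_lt {A : ℕ → ℕ → ℕ} (hA : ∀ i j, A i j ≤ 1) (σ : ℕ → ℕ) {p : ℕ} (hp : p ≤ 14)
    (x : ℕ) : marked A σ p x < B := by
  have := colOf_lt hA σ hp x
  have : 2 ^ 15 < B := by decide
  unfold marked
  split_ifs <;> omega

theorem marked_update {A : ℕ → ℕ → ℕ} {σ : ℕ → ℕ} {p t : ℕ} (ht : ∀ j < p, σ j ≠ t) (x : ℕ) :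
    marked A (Function.update σ p t) (p + 1) x =
      marked A σ p x + (A t x * 2 ^ (13 - p) + if x = t then 16384 else 0) := by
  have h1 : colOf A (Function.update σ p t) (p + 1) x = colOf A σ p x + A t x * 2 ^ (13 - p) := by
    rw [colOf, sum_range_succ, Function.update_self]
    congr 1
    exact colOf_congr (fun j hj => Function.update_of_ne (by omega) _ _) x
  have h2 : (∃ j < p + 1, Function.update σ p t j = x) ↔ (∃ j < p, σ j = x) ∨ x = t := by
    constructor
    · rintro ⟨j, hj, rfl⟩
      rcases Nat.lt_succ_iff_lt_or_eq.1 hj with hj | rfl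
      · exact Or.inl ⟨j, hj, by rw [Function.update_of_ne (by omega)]⟩
      · exact Or.inr (by rw [Function.update_self])
    · rintro (⟨j, hj, rfl⟩ | rfl)
      · exact ⟨j, by omega, by rw [Function.update_of_ne (by omega)]⟩
      · exact ⟨p, by omega, by rw [Function.update_self]⟩
  simp only [marked, h1, h2]
  by_cases hx : x = t
  · subst hx
    rw [if_pos (Or.inr rfl), if_neg (by simpa using ht), if_pos rfl]
    norm_num
    ring
  · simp only [hx, or_false, if_false]
    ring

/-- What `compareCodes` decides. -/
def Compare (A : ℕ → ℕ → ℕ) (m : ℕ) (c : ℕ → ℕ) (lt eq : Bool) : ℕ → ℕ → (ℕ → ℕ) → Prop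
  | 0, _, _ => eq = true
  | k + 1, p, σ => ∃ t < m, (∀ j < p, σ j ≠ t) ∧
      ((colOf A σ p t = c p ∧ Compare A m c lt eq k (p + 1) (Function.update σ p t)) ∨
        (c p < colOf A σ p t ∧ lt = true))

/-- The invariant of the recursion: the position is held as `B ^ p`, the weight as `2 ^ (13 - p)`,
and the columns of all vertices with the marks of the used ones in a single packed number. The
weight is only prescribed for `p ≤ 13`: after the last position halving gives 0, whereas truncated
subtraction would give `2 ^ 0`. -/
theorem compareCodes_iff {A : ℕ → ℕ → ℕ} (hA : ∀ i j, A i j ≤ 1) {m C : ℕ} (hm : m ≤ 14)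
    {c : ℕ → ℕ} (hc : ∀ p < m, field C (B ^ p) = c p) (hc' : ∀ p < m, c p < 2 ^ 14)
    (lt eq : Bool) (k p w : ℕ) (σ : ℕ → ℕ) (hpk : p + k = m) (hw : p ≤ 13 → w = 2 ^ (13 - p)) :
    compareCodes (verts m) (mat A m) C lt eq k (B ^ p) w (pack B m (marked A σ p)) = true ↔
      Compare A m c lt eq k p σ := by
  induction k generalizing p w σ with
  | zero => rfl
  | succ k ih =>
    change force (field C (B ^ p)) (fun c => anyList (fun t =>
      cnd (Nat.ble c (field (pack B m (marked A σ p)) t))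
        (cnd (Nat.beq (field (pack B m (marked A σ p)) t) c)
          (force (pack B m (marked A σ p) + (row (mat A m) t * w + t * 16384))
            (compareCodes (verts m) (mat A m) C lt eq k (B ^ p * B) (w / 2)))
          (cnd (Nat.ble (field (pack B m (marked A σ p)) t) 16383) lt false)) false) (verts m))
      = true ↔ _
    have hw := hw (by omega)
    rw [force_eq, anyList_iff, hc p (by omega)]
    simp only [mem_verts, exists_exists_and_eq_and, Compare]
    refine exists_congr fun t => and_congr_right fun ht => ?_
    rw [field_pack (fun x _ => marked_lt hA σ (by omega) x) ht, row_mat hA hm ht]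
    simp only [cnd_eq, force_eq]
    have hcp := hc' p (by omega)
    by_cases hσ : ∀ j < p, σ j ≠ t
    · have hmk : marked A σ p t = colOf A σ p t := by
        rw [marked, if_neg (by simpa using hσ), add_zero]
      have hcol := colOf_lt hA σ (show p ≤ 14 by omega) t
      have hnew : pack B m (marked A σ p) + (pack B m (A t) * w + B ^ t * 16384) =
          pack B m (marked A (Function.update σ p t) (p + 1)) := by
        rw [pack_congr fun x _ => marked_update hσ x, pack_add, pack_add, pack_mul,
          pack_single ht, hw]
      have hih := ih (p + 1) (w / 2) (Function.update σ p t) (by omega) fun hp => by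
        rw [hw, show 13 - p = 13 - (p + 1) + 1 by omega, pow_succ, Nat.mul_div_cancel _ two_pos]
      rw [hmk, hnew, ← pow_succ]
      rcases lt_trichotomy (colOf A σ p t) (c p) with h | h | h
      · have h1 : Nat.ble (c p) (colOf A σ p t) = false := by
          rw [← Bool.not_eq_true, Nat.ble_eq]; omega
        simp only [h1]
        simp
        omega
      · have h1 : Nat.ble (c p) (c p) = true := by rw [Nat.ble_eq]
        have h2 : Nat.beq (c p) (c p) = true := by rw [Nat.beq_eq]
        simp only [h, h1, h2, if_true, hih]
        simp only [true_and, lt_irrefl, false_and, or_false]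
        exact ⟨fun h => ⟨hσ, h⟩, fun h => h.2⟩
      · have h1 : Nat.ble (c p) (colOf A σ p t) = true := by rw [Nat.ble_eq]; omega
        have h2 : Nat.beq (colOf A σ p t) (c p) = false := by
          rw [← Bool.not_eq_true, Nat.beq_eq]; omega
        have h3 : Nat.ble (colOf A σ p t) 16383 = true := by rw [Nat.ble_eq]; omega
        simp only [h1, h2, h3]
        simp only [h.ne', h, false_and, true_and, false_or, if_true, Bool.false_eq_true, if_false]
        exact ⟨fun h => ⟨hσ, h⟩, fun h => h.2⟩
    -- The mark lifts a used vertex above all codes and above 16383, so it neither ties nor counts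
    -- as larger.
    · have hmk : 2 ^ 14 ≤ marked A σ p t := by
        rw [marked, if_pos (by push Not at hσ; exact hσ)]
        omega
      have h2 : Nat.beq (marked A σ p t) (c p) = false := by
        rw [← Bool.not_eq_true, Nat.beq_eq]; omega
      have h3 : Nat.ble (marked A σ p t) 16383 = false := by
        rw [← Bool.not_eq_true, Nat.ble_eq]; omega
      simp only [h2, h3]
      simp [hσ]

/-- The recursion unrolled: `τ` is the numbering being tried and `q` the position where the
comparison ends, by a strictly larger column or by running out of positions. -/
theorem compare_iff {A : ℕ → ℕ → ℕ} {m : ℕ} {c : ℕ → ℕ} {lt eq : Bool} {k p : ℕ} {σ : ℕ → ℕ} :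
    Compare A m c lt eq k p σ ↔ ∃ τ : ℕ → ℕ, ∃ q, p ≤ q ∧ (∀ j < p, τ j = σ j) ∧
      (∀ j, p ≤ j → j ≤ q → j < p + k → τ j < m ∧ ∀ i < j, τ i ≠ τ j) ∧
      (∀ j, p ≤ j → j < q → colOf A τ j (τ j) = c j) ∧
      ((q < p + k ∧ c q < colOf A τ q (τ q) ∧ lt = true) ∨ (q = p + k ∧ eq = true)) := by
  induction k generalizing p σ with
  | zero =>
    constructor
    · intro h
      exact ⟨σ, p, le_rfl, fun _ _ => rfl, fun j h1 h2 h3 => by omega, fun j h1 h2 => by omega,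
        Or.inr ⟨rfl, h⟩⟩
    · rintro ⟨τ, q, h1, -, -, -, h | h⟩
      · omega
      · exact h.2
  | succ k ih =>
    constructor
    · rintro ⟨t, ht, hσ, ⟨h1, h2⟩ | ⟨h1, h2⟩⟩
      · obtain ⟨τ, q, hq, hτ, hinj, hcol, hend⟩ := ih.1 h2
        have hp : τ p = t := by rw [hτ p (by omega), Function.update_self]
        have hlt : ∀ j < p, τ j = σ j := fun j hj => by
          rw [hτ j (by omega), Function.update_of_ne (by omega)]
        refine ⟨τ, q, by omega, hlt, fun j h3 h4 h5 => ?_, fun j h3 h4 => ?_, ?_⟩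
        · rcases h3.eq_or_lt with rfl | h3
          · rw [hp]
            exact ⟨ht, fun i hi => by rw [hlt i hi]; exact hσ i hi⟩
          · exact hinj j h3 h4 (by omega)
        · rcases h3.eq_or_lt with rfl | h3
          · rw [hp, ← h1]
            exact colOf_congr hlt t
          · exact hcol j h3 h4
        · rwa [show p + (k + 1) = p + 1 + k by omega]
      · have hlt : ∀ j < p, Function.update σ p t j = σ j := fun j hj =>
          Function.update_of_ne (by omega) _ _
        refine ⟨Function.update σ p t, p, le_rfl, hlt, fun j h3 h4 h5 => ?_,
          fun j h3 h4 => by omega, Or.inl ⟨by omega, ?_, h2⟩⟩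
        · obtain rfl : p = j := by omega
          rw [Function.update_self]
          exact ⟨ht, fun i hi => by rw [hlt i hi]; exact hσ i hi⟩
        · rw [Function.update_self, colOf_congr hlt]
          exact h1
    · rintro ⟨τ, q, hq, hτ, hinj, hcol, hend⟩
      obtain ⟨h1, h2⟩ := hinj p le_rfl hq (by omega)
      refine ⟨τ p, h1, fun j hj => by rw [← hτ j hj]; exact h2 j hj, ?_⟩
      rw [← colOf_congr hτ]
      rcases hq.eq_or_lt with rfl | hq
      · rcases hend with h | h
        · exact Or.inr h.2
        · omega
      · refine Or.inl ⟨hcol p le_rfl hq, ih.2 ⟨τ, q, hq, fun j hj => ?_,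
          fun j h3 h4 h5 => hinj j (by omega) h4 (by omega), fun j h3 h4 => hcol j (by omega) h4, ?_⟩⟩
        · rcases Nat.lt_succ_iff_lt_or_eq.1 hj with hj | rfl
          · rw [hτ j hj, Function.update_of_ne (by omega)]
          · rw [Function.update_self]
        · rwa [show p + 1 + k = p + (k + 1) by omega]

/-- The first three positions. -/
def initial (a j : ℕ) : ℕ := if j = 0 then 0 else if j = 1 then 1 else a

/-- The constants 8192, 4096, 2048 are the weights of the positions 0, 1, 2, and 16384 is the mark
of a used vertex. -/
theorem start_eq {A : ℕ → ℕ → ℕ} (hA : ∀ i j, A i j ≤ 1) {m a : ℕ} (hm : m ≤ 14) (ha : 2 ≤ a)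
    (ham : a < m) : start (mat A m) (B ^ a) = pack B m (marked A (initial a) 3) := by
  have h0 := row_mat hA hm (show 0 < m by omega)
  have h1 := row_mat hA hm (show 1 < m by omega)
  rw [pow_zero] at h0
  rw [pow_one] at h1
  change row (mat A m) 1 * 8192 + row (mat A m) B * 4096 + row (mat A m) (B ^ a) * 2048
    + 16384 * (1 + B + B ^ a) = _
  rw [h0, h1, row_mat hA hm ham]
  have h2 : ∀ x, marked A (initial a) 3 x = A 0 x * 8192 + A 1 x * 4096 + A a x * 2048 +
      ((if x = 0 then 16384 else 0) + (if x = 1 then 16384 else 0) + (if x = a then 16384 else 0)) := by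
    intro x
    have h3 : (∃ j < 3, initial a j = x) ↔ x = 0 ∨ x = 1 ∨ x = a := by
      constructor
      · rintro ⟨j, hj, rfl⟩
        interval_cases j <;> simp [initial]
      · rintro (rfl | rfl | rfl)
        · exact ⟨0, by simp [initial]⟩
        · exact ⟨1, by simp [initial]⟩
        · exact ⟨2, by simp [initial]⟩
    rw [marked, colOf]
    simp only [sum_range_succ, range_zero, sum_empty, zero_add, h3]
    have : (if x = 0 ∨ x = 1 ∨ x = a then 2 ^ 14 else 0) =
        (if x = 0 then 16384 else 0) + (if x = 1 then 16384 else 0) + (if x = a then 16384 else 0) := by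
      split_ifs <;> omega
    rw [this]
    simp [initial]
  rw [pack_congr fun x _ => h2 x]
  simp only [pack_add, pack_mul]
  rw [pack_single (show 0 < m by omega), pack_single (show 1 < m by omega), pack_single ham]
  ring

/-- An injective numbering of some first positions extends to a permutation. -/
theorem exists_perm_extending {τ : ℕ → ℕ} {q : ℕ} (h : ∀ j < q, τ j < 14)
    (hinj : ∀ j < q, ∀ i < j, τ i ≠ τ j) :
    ∃ π : Equiv.Perm (Fin 14), ∀ j : Fin 14, (j : ℕ) < q → (π j : ℕ) = τ j := by
  classical
  let f : Fin 14 → Fin 14 := fun j => if h : τ j < 14 then ⟨τ j, h⟩ else 0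
  have hf : ∀ j : Fin 14, (j : ℕ) < q → (f j : ℕ) = τ j := fun j hj => by
    simp [f, h j hj]
  obtain ⟨g, hg⟩ := Finset.exists_equiv_extend_of_card_eq (α := Fin 14) (t := Finset.univ) (by simp)
    (s := Finset.univ.filter fun j : Fin 14 => (j : ℕ) < q) (f := f) (by simp) (by
      intro i hi j hj hij
      have hi : (i : ℕ) < q := by simpa using hi
      have hj : (j : ℕ) < q := by simpa using hj
      have hij : τ i = τ j := by rw [← hf i hi, ← hf j hj, hij]
      rcases lt_trichotomy i j with hlt | heq | hlt
      · exact (hinj j hj i hlt hij).elim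
      · exact heq
      · exact (hinj i hi j hlt hij.symm).elim)
  refine ⟨g.trans (Equiv.subtypeUnivEquiv (by simp)), fun j hj => ?_⟩
  rw [← hf j hj, ← hg j (by simpa using hj)]
  rfl

/-! ### The tests for canonicity and for a symmetry -/

section graph

variable (G : SimpleGraph (Fin 14))

theorem codeCol_relabel (π : Equiv.Perm (Fin 14)) {τ : ℕ → ℕ} {j : Fin 14}
    (h : ∀ i : Fin 14, i ≤ j → (π i : ℕ) = τ i) :
    codeCol (adjNum (relabel G π)) j = colOf (adjNum G) τ j (τ j) := by
  refine sum_congr rfl fun u hu => ?_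
  have hu := mem_range.1 hu
  have h1 := adjNum_relabel G π ⟨u, by omega⟩ j
  rw [h j le_rfl, h ⟨u, _⟩ (Fin.mk_le_of_le_val hu.le)] at h1
  rw [h1]

theorem improvable_iff {m : ℕ} (hm : 3 ≤ m) (hm' : m ≤ 14) :
    improvable (verts m) (m - 3) (mat (adjNum G) m) (codeNum (adjNum G) m) = true ↔
      Compare (adjNum G) m (codeCol (adjNum G)) true false (m - 3) 3 (initial 2) := by
  have hA := adjNum_le G
  rw [improvable, force_eq, start_eq hA hm' le_rfl (by omega)]
  exact compareCodes_iff hA hm' (fun p hp => field_codeNum hA hm' hp)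
    (fun p hp => codeCol_lt hA (by omega)) true false (m - 3) 3 1024 _ (by omega) (fun _ => rfl)

/-- A column only depends on the vertices up to its position. A numbering of some of the first `m`
vertices that beats the code therefore still beats it after being extended to a permutation of all
14, which a canonical graph forbids. This justifies pruning before the graph is complete. -/
theorem Canon.not_improvable {G} (hG : Canon G) {m : ℕ} (hm : 3 ≤ m) (hm' : m ≤ 14) :
    improvable (verts m) (m - 3) (mat (adjNum G) m) (codeNum (adjNum G) m) = false := by
  rw [← Bool.not_eq_true, improvable_iff G hm hm', compare_iff]
  rintro ⟨τ, q, hq, hτ, hinj, hcol, ⟨hqm, hlt, -⟩ | ⟨-, h⟩⟩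
  · have h0 : τ 0 = 0 := hτ 0 (by omega)
    have h1 : τ 1 = 1 := hτ 1 (by omega)
    have h2 : τ 2 = 2 := hτ 2 (by omega)
    obtain ⟨π, hπ⟩ := exists_perm_extending (τ := τ) (q := q + 1) (fun j hj => by
      rcases lt_or_ge j 3 with h3 | h3
      · interval_cases j <;> omega
      · exact (hinj j h3 (by omega) (by omega)).1.trans_le hm') (fun j hj i hi => by
      rcases lt_or_ge j 3 with h3 | h3
      · interval_cases j <;> interval_cases i <;> omega
      · exact (hinj j h3 (by omega) (by omega)).2 i hi)
    have hfix : ∀ j : Fin 14, (j : ℕ) < 3 → π j = j := by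
      intro j hj
      apply Fin.ext
      rw [hπ j (by omega), hτ j hj]
      rcases j with ⟨j, hj'⟩
      simp only at hj ⊢
      interval_cases j <;> rfl
    refine hG π (hfix 0 (by simp)) (hfix 1 (by simp)) (hfix 2 (by simp)) ⟨q, by omega, ?_, ?_⟩
    · intro j hj
      rw [codeCol_relabel G π (j := ⟨j, by omega⟩) (τ := τ)
        fun i hi => hπ i (by have : (i : ℕ) ≤ j := hi; omega)]
      rcases lt_or_ge j 3 with h3 | h3
      · have : ∀ i ≤ j, τ i = i := by
          intro i hi
          rw [hτ i (by omega)]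
          have : i < 3 := by omega
          interval_cases i <;> rfl
        rw [this j le_rfl]
        exact colOf_congr (fun i hi => (this i (by omega)).symm) j
      · exact (hcol j h3 hj).symm
    · rw [codeCol_relabel G π (j := ⟨q, by omega⟩) (τ := τ)
        fun i hi => hπ i (by have : (i : ℕ) ≤ q := hi; omega)]
      exact hlt
  · cases h

theorem canon_iff :
    Canon G ↔ improvable (verts 14) 11 (mat (adjNum G) 14) (codeNum (adjNum G) 14) = false := by
  refine ⟨fun h => h.not_improvable (by norm_num) le_rfl, fun h σ h0 h1 h2 ⟨q, hq, heq, hlt⟩ => ?_⟩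
  rw [← Bool.not_eq_true] at h
  refine h ((improvable_iff G (by norm_num) le_rfl).2 (compare_iff.2 ?_))
  let τ : ℕ → ℕ := fun j => if h : j < 14 then σ ⟨j, h⟩ else 0
  have hτ : ∀ j : Fin 14, (σ j : ℕ) = τ j := fun j => by simp [τ]
  have hcol : ∀ j : Fin 14, codeCol (adjNum (relabel G σ)) j = colOf (adjNum G) τ j (τ j) :=
    fun j => codeCol_relabel G σ fun i _ => hτ i
  have hfix : ∀ j < 3, τ j = j := by
    intro j hj
    interval_cases j
    · simpa [h0] using (hτ 0).symm
    · simpa [h1] using (hτ 1).symm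
    · simpa [h2] using (hτ 2).symm
  -- The permutation fixes 0, 1, 2, so the first three columns cannot differ.
  have hq3 : 3 ≤ q := by
    by_contra hq3
    refine hlt.ne ?_
    rw [hcol ⟨q, hq⟩, hfix _ (by simp; omega)]
    exact colOf_congr (fun i hi => (hfix i (by have : i < q := hi; omega)).symm) q
  refine ⟨τ, q, hq3, ?_, ?_, ?_, Or.inl ⟨by omega, ?_, rfl⟩⟩
  · intro j hj
    rw [hfix j hj]
    interval_cases j <;> rfl
  · intro j h3 h4 h5
    have hj : j < 14 := by omega
    refine ⟨by rw [← hτ ⟨j, hj⟩]; exact (σ _).2, fun i hi hij => ?_⟩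
    rw [← hτ ⟨j, hj⟩, ← hτ ⟨i, by omega⟩] at hij
    have := σ.injective (Fin.ext hij)
    simp at this
    omega
  · intro j h3 h4
    rw [← hcol ⟨j, by omega⟩]
    exact (heq j h4).symm
  · rw [← hcol ⟨q, hq⟩]
    exact hlt

/-- The program compares columns from position 3 on. The adjacencies assumed here make the first
three columns agree when 3 takes the place of 2, so that equal codes amount to an automorphism. -/
theorem symmetric_iff (h01 : adjNum G 0 1 = 1) (h02 : adjNum G 0 2 = 1) (h03 : adjNum G 0 3 = 1)
    (h12 : adjNum G 1 2 = 0) (h13 : adjNum G 1 3 = 0) :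
    symmetric (verts 14) 11 (mat (adjNum G) 14) (codeNum (adjNum G) 14) = true ↔
      ∃ π : Equiv.Perm (Fin 14), π 0 = 0 ∧ π 1 = 1 ∧ π 2 = 3 ∧ relabel G π = G := by
  have hA := adjNum_le G
  have h : symmetric (verts 14) 11 (mat (adjNum G) 14) (codeNum (adjNum G) 14) = true ↔
      Compare (adjNum G) 14 (codeCol (adjNum G)) false true 11 3 (initial 3) := by
    rw [symmetric, force_eq, start_eq hA le_rfl (by norm_num) (by omega)]
    exact compareCodes_iff hA le_rfl (fun p hp => field_codeNum hA le_rfl hp)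
      (fun p hp => codeCol_lt hA (by omega)) false true 11 3 1024 _ (by omega) (fun _ => rfl)
  rw [h, compare_iff]
  constructor
  · rintro ⟨τ, q, hq, hτ, hinj, hcol, ⟨-, -, h⟩ | ⟨rfl, -⟩⟩
    · cases h
    have t0 : τ 0 = 0 := hτ 0 (by omega)
    have t1 : τ 1 = 1 := hτ 1 (by omega)
    have t2 : τ 2 = 3 := hτ 2 (by omega)
    obtain ⟨π, hπ⟩ := exists_perm_extending (τ := τ) (q := 14) (fun j hj => by
      rcases lt_or_ge j 3 with h3 | h3
      · interval_cases j <;> omega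
      · exact (hinj j h3 (by omega) (by omega)).1) (fun j hj i hi => by
      rcases lt_or_ge j 3 with h3 | h3
      · interval_cases j <;> interval_cases i <;> omega
      · exact (hinj j h3 (by omega) (by omega)).2 i hi)
    refine ⟨π, Fin.ext ((hπ 0 (by simp)).trans t0), Fin.ext ((hπ 1 (by simp)).trans t1),
      Fin.ext ((hπ 2 (by simp)).trans t2), eq_of_code_eq fun p hp => ?_⟩
    rw [codeCol_relabel G π (j := ⟨p, hp⟩) (τ := τ) fun i _ => hπ i i.2]
    rcases lt_or_ge p 3 with h3 | h3
    · interval_cases p <;>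
        simp [colOf, codeCol, sum_range_succ, t0, t1, t2, h01, h02, h03, h12, h13]
    · exact hcol p h3 hp
  · rintro ⟨π, p0, p1, p2, hπ⟩
    let τ : ℕ → ℕ := fun j => if h : j < 14 then π ⟨j, h⟩ else 0
    have hτ : ∀ j : Fin 14, (π j : ℕ) = τ j := fun j => by simp [τ]
    refine ⟨τ, 14, by norm_num, ?_, ?_, ?_, Or.inr ⟨rfl, rfl⟩⟩
    · intro j hj
      interval_cases j
      · simpa [p0, initial] using (hτ 0).symm
      · simpa [p1, initial] using (hτ 1).symm
      · simpa [p2, initial] using (hτ 2).symm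
    · intro j h3 h4 h5
      refine ⟨by rw [← hτ ⟨j, h5⟩]; exact (π _).2, fun i hi hij => ?_⟩
      rw [← hτ ⟨j, h5⟩, ← hτ ⟨i, by omega⟩] at hij
      have := π.injective (Fin.ext hij)
      simp at this
      omega
    · intro j h3 h4
      rw [← codeCol_relabel G π (j := ⟨j, h4⟩) fun i _ => hτ i, hπ]

end graph

end SegmentCount

namespace SegmentCount

open Finset

/-! ### Joining one more vertex -/

/-- The packed list of the bit sets of neighbours of the vertices before `m`. -/
def bitMat (A : ℕ → ℕ → ℕ) (m : ℕ) : ℕ := pack B m fun i => pack 2 m (A i)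

/-- The list of the neighbours of `m` before `m`. -/
def earlier (A : ℕ → ℕ → ℕ) (m : ℕ) : List ℕ :=
  ((List.range m).filter fun u => A u m = 1).map (B ^ ·)

/-- The number of edges between the vertices before `m` and the others. -/
def boundary (A : ℕ → ℕ → ℕ) (m : ℕ) : ℕ := ∑ u ∈ range m, ∑ t ∈ Ico m 14, A u t

theorem field_bitMat {A : ℕ → ℕ → ℕ} (hA : ∀ i j, A i j ≤ 1) {m t : ℕ} (hm : m ≤ 14) (ht : t < m) :
    field (bitMat A m) (B ^ t) = pack 2 m (A t) := by
  rw [bitMat, field_pack _ ht]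
  intro x _
  calc pack 2 m (A x) < 2 ^ m := pack_lt fun y _ => (hA x y).trans_lt one_lt_two
    _ ≤ 2 ^ 14 := Nat.pow_le_pow_right (by norm_num) hm
    _ < B := by decide

theorem rec_add_eq (X : ℕ) (g : ℕ → ℕ) (l : List ℕ) :
    (List.rec X (fun u _ ih => Nat.add ih (g u)) l : ℕ) = X + (l.map g).sum := by
  induction l with
  | nil => simp
  | cons a t ih =>
    change (List.rec X (fun u _ ih => Nat.add ih (g u)) t : ℕ) + g a = _
    rw [ih, List.map_cons, List.sum_cons]
    ring

theorem sum_map_earlier {A : ℕ → ℕ → ℕ} (hA : ∀ i j, A i j ≤ 1) (m : ℕ) (g : ℕ → ℕ) :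
    ((earlier A m).map g).sum = ∑ u ∈ range m, A u m * g (B ^ u) := by
  have h : ∀ l : List ℕ, (((l.filter fun u => A u m = 1).map (B ^ ·)).map g).sum =
      (l.map fun u => A u m * g (B ^ u)).sum := by
    intro l
    induction l with
    | nil => rfl
    | cons a t ih =>
      rw [List.filter_cons]
      by_cases h1 : A a m = 1
      · simp only [h1, decide_true, if_true, List.map_cons, List.sum_cons, one_mul, ih]
      · have h0 : A a m = 0 := by have := hA a m; omega
        simp only [h0, List.map_cons, List.sum_cons, zero_mul, zero_add]
        simpa using ih
  rw [earlier, h]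
  rfl

theorem length_earlier {A : ℕ → ℕ → ℕ} (hA : ∀ i j, A i j ≤ 1) (m : ℕ) :
    (earlier A m).length = ∑ u ∈ range m, A u m := by
  have := sum_map_earlier hA m fun _ => 1
  simpa using this

section step

variable {A : ℕ → ℕ → ℕ} (hA : ∀ i j, A i j ≤ 1) (hs : ∀ i j, A i j = A j i) (hz : ∀ i, A i i = 0)
  {m : ℕ} (hm : m < 14)

theorem pow_B_sum_bit (A : ℕ → ℕ → ℕ) (g : ℕ → ℕ) (hm : m < 14) :
    ∑ u ∈ range m, A u m * g (bit (B ^ u)) = ∑ u ∈ range m, A u m * g (2 ^ u) :=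
  sum_congr rfl fun u hu => by rw [bit_pow (by have := mem_range.1 hu; omega)]

include hA hs hm in
theorem bits_earlier : bits (earlier A m) = pack 2 m (A m) := by
  rw [bits, rec_add_eq, zero_add, sum_map_earlier hA, pow_B_sum_bit A (fun x => x) hm]
  exact sum_congr rfl fun u _ => by rw [hs]

-- The new matrix differs by a row and a column at `m`. Each neighbour `u` contributes `BB ^ u * B ^
-- m` and `BB ^ m * B ^ u`; the diagonal entry is zero.
include hA hs hz in
theorem addMatrix_earlier : addMatrix (mat A m) (B ^ m) (earlier A m) = mat A (m + 1) := by
  rw [addMatrix, rec_add_eq, sum_map_earlier hA]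
  have h1 : ∀ i, pack B (m + 1) (A i) = pack B m (A i) + A i m * B ^ m := fun i => pack_succ _ _ _
  rw [mat, mat, pack_succ, pack_congr fun x _ => h1 x, pack_add, h1 m, hz, zero_mul, add_zero,
    add_assoc]
  congr 1
  rw [pack, pack, sum_mul, ← sum_add_distrib]
  refine sum_congr rfl fun u _ => ?_
  change A u m * ((B ^ u) ^ 14 * B ^ m + (B ^ m) ^ 14 * B ^ u) = _
  rw [hs m u, ← pow_mul, ← pow_mul, mul_comm u, mul_comm m, pow_mul, pow_mul]
  change A u m * (BB ^ u * B ^ m + BB ^ m * B ^ u) = _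
  ring

include hA hs hz hm in
theorem addBits_earlier :
    addBits (bitMat A m) (B ^ m) (bits (earlier A m)) (earlier A m) = bitMat A (m + 1) := by
  rw [addBits, rec_add_eq, sum_map_earlier hA, bits_earlier hA hs hm]
  have h1 : ∀ i, pack 2 (m + 1) (A i) = pack 2 m (A i) + A i m * 2 ^ m := fun i => pack_succ _ _ _
  rw [bitMat, bitMat, pack_succ, pack_congr fun x _ => h1 x, pack_add, h1 m, hz, zero_mul, add_zero,
    bit_pow hm]
  change _ + B ^ m * _ + _ = _
  have h2 : ∑ u ∈ range m, A u m * Nat.mul (B ^ u) (2 ^ m) = pack B m fun x => A x m * 2 ^ m :=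
    sum_congr rfl fun u _ => by
      change A u m * (B ^ u * 2 ^ m) = _
      ring
  rw [h2]
  ring

include hA hm in
theorem addCode_earlier : addCode (codeNum A m) (B ^ m) (earlier A m) = codeNum A (m + 1) := by
  rw [addCode, rec_add_eq, sum_map_earlier hA, pow_B_sum_bit A
    (fun x => Nat.mul (B ^ m) (Nat.div 8192 x)) hm, codeNum, codeNum, pack_succ, codeCol, sum_mul]
  congr 1
  refine sum_congr rfl fun u hu => ?_
  have hu : u < 14 := by have := mem_range.1 hu; omega
  change A u m * (B ^ m * (2 ^ 13 / 2 ^ u)) = _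
  rw [Nat.pow_div (by omega) two_pos]
  ring

end step

/-- The digit sum of a row is the degree among the vertices before `m`; it is at most 14, hence not
changed by reduction modulo `B - 1`. -/
theorem deficient_eq {A : ℕ → ℕ → ℕ} (hA : ∀ i j, A i j ≤ 1) {m : ℕ} (hm : m ≤ 14) :
    filterList (fun u => Nat.ble (Nat.mod (row (mat A m) u) (Nat.sub B 1)) 2) (verts m) =
      ((List.range m).filter fun u => ∑ j ∈ range m, A u j < 3).map (B ^ ·) := by
  rw [filterList_eq, verts, List.filter_map]
  congr 1
  refine List.filter_congr fun u hu => ?_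
  have hu := List.mem_range.1 hu
  change Nat.ble (row (mat A m) (B ^ u) % (B - 1)) 2 = _
  have h1 : ∑ j ∈ range m, A u j ≤ ∑ j ∈ range m, 1 := sum_le_sum fun j _ => hA u j
  have h2 : 14 < B - 1 := by decide
  rw [row_mat hA hm hu, pack_mod (by decide) (by simp at h1; omega)]
  rw [Bool.eq_iff_iff, Nat.ble_eq, decide_eq_true_iff]
  omega

theorem verts_succ (m : ℕ) : List.append (verts m) [B ^ m] = verts (m + 1) := by
  simp [verts, List.range_succ]

/-! ### The choices of neighbours -/

theorem pair_sublist_iff {x y : ℕ} {l : List ℕ} :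
    List.Sublist [x, y] l ↔ ∃ t, (x :: t) <:+ l ∧ y ∈ t := by
  induction l with
  | nil => simp
  | cons b s ih =>
    constructor
    · intro h
      cases h with
      | cons _ h =>
        obtain ⟨t, h1, h2⟩ := ih.1 h
        exact ⟨t, h1.trans (List.suffix_cons b s), h2⟩
      | cons_cons _ h => exact ⟨s, List.suffix_rfl, List.singleton_sublist.1 h⟩
    · rintro ⟨t, h1, h2⟩
      exact ((List.singleton_sublist.2 h2).cons_cons x).trans h1.sublist

/-- Completeness of the choices. The new number of free edge ends is forced by the length of `l`:
joining `m` to `l` uses up `l.length` ends and leaves `3 - l.length` new ones. The truncated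
subtractions in the program are exact in the cases used. -/
theorem mem_branch {r e : ℕ} {d : List ℕ} {f : ℕ → List ℕ → List ℕ} {x e' : ℕ} {l : List ℕ}
    (hl : l = [] ∧ d = [] ∨ ∃ u us l', l = u :: l' ∧ d = u :: us ∧ l'.Sublist us)
    (hl3 : l.length ≤ 3) (he : e' + 2 * l.length = e + 3) (hr : feasible r e' = true)
    (hx : x ∈ f e' l) : x ∈ branch r e d f := by
  rcases hl with ⟨rfl, rfl⟩ | ⟨u, us, l', rfl, rfl, hl'⟩
  · change x ∈ cnd (feasible r (e + 3)) (f (e + 3) []) []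
    obtain rfl : e' = e + 3 := by simpa using he
    simpa [hr] using hx
  · change x ∈ cnd (feasible r (e + 1)) (f (e + 1) [u]) [] ++
      (cnd (feasible r (e - 1))
          (force (e - 1) fun e' => flatList (fun x => f e' [u, x]) us) [] ++
        cnd (feasible r (e - 3))
          (force (e - 3) fun e' => flatTails (fun x t => flatList (fun y => f e' [u, x, y]) t) us) [])
    rw [List.mem_append, List.mem_append]
    match l', hl', hl3, he, hx with
    | [], _, _, he, hx =>
      obtain rfl : e' = e + 1 := by simp at he; omega
      left
      simpa [hr] using hx
    | [y], hl', _, he, hx =>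
      obtain rfl : e' = e - 1 := by simp at he; omega
      right; left
      rw [cnd_eq, if_pos hr, force_eq, mem_flatList]
      exact ⟨y, List.singleton_sublist.1 hl', hx⟩
    | [y, z], hl', _, he, hx =>
      obtain rfl : e' = e - 3 := by simp at he; omega
      right; right
      rw [cnd_eq, if_pos hr, force_eq, mem_flatTails]
      obtain ⟨t, h1, h2⟩ := pair_sublist_iff.1 hl'
      exact ⟨y, t, h1, mem_flatList.2 ⟨z, h2, hx⟩⟩
    | _ :: _ :: _ :: _, _, hl3, _, _ => simp only [List.length_cons] at hl3; omega

/-- For soundness the number `e'` is irrelevant, as it only serves for pruning. -/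
theorem exists_of_mem_branch {r e : ℕ} {d : List ℕ} {f : ℕ → List ℕ → List ℕ} {x : ℕ}
    (hx : x ∈ branch r e d f) : ∃ e' l, l.Sublist d ∧ x ∈ f e' l := by
  cases d with
  | nil =>
    change x ∈ cnd (feasible r (e + 3)) (f (e + 3) []) [] at hx
    rw [cnd_eq] at hx
    split_ifs at hx
    · exact ⟨_, _, List.Sublist.refl _, hx⟩
    · simp at hx
  | cons u us =>
    change x ∈ cnd (feasible r (e + 1)) (f (e + 1) [u]) [] ++
      (cnd (feasible r (e - 1))
          (force (e - 1) fun e' => flatList (fun x => f e' [u, x]) us) [] ++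
        cnd (feasible r (e - 3))
          (force (e - 3) fun e' =>
            flatTails (fun x t => flatList (fun y => f e' [u, x, y]) t) us) []) at hx
    simp only [List.mem_append, cnd_eq, force_eq] at hx
    rcases hx with hx | hx | hx <;> split_ifs at hx <;> try simp at hx
    · exact ⟨_, _, (List.nil_sublist us).cons_cons u, hx⟩
    · obtain ⟨y, hy, hx⟩ := mem_flatList.1 hx
      exact ⟨_, _, (List.singleton_sublist.2 hy).cons_cons u, hx⟩
    · obtain ⟨y, t, hy, hx⟩ := mem_flatTails.1 hx
      obtain ⟨z, hz, hx⟩ := mem_flatList.1 hx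
      exact ⟨_, _, (pair_sublist_iff.2 ⟨t, hy, hz⟩).cons_cons u, hx⟩

/-! ### The tests -/

theorem land_pack_eq_zero_iff {n : ℕ} {f g : ℕ → ℕ} (hf : ∀ x, f x ≤ 1) (hg : ∀ x, g x ≤ 1) :
    Nat.land (pack 2 n f) (pack 2 n g) = 0 ↔ ∀ k < n, ¬ (f k = 1 ∧ g k = 1) := by
  change pack 2 n f &&& pack 2 n g = 0 ↔ _
  constructor
  · rintro h k hk ⟨h1, h2⟩
    have h3 : (pack 2 n f &&& pack 2 n g).testBit k = true := by
      rw [Nat.testBit_land, (testBit_pack hf).2 ⟨hk, h1⟩, (testBit_pack hg).2 ⟨hk, h2⟩]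
      rfl
    rw [h] at h3
    simp at h3
  · intro h
    refine Nat.eq_of_testBit_eq fun k => ?_
    rw [Nat.zero_testBit, ← Bool.not_eq_true, Nat.testBit_land, Bool.and_eq_true,
      testBit_pack hf, testBit_pack hg]
    rintro ⟨⟨hk, h1⟩, -, h2⟩
    exact h k hk ⟨h1, h2⟩

theorem testBit_eq_false_iff {n i : ℕ} : n.testBit i = false ↔ n &&& 2 ^ i = 0 := by
  rw [Nat.and_two_pow]
  cases n.testBit i <;> simp

theorem cnd_cnd_iff (a b c : Bool) :
    cnd a (cnd b false c) false = true ↔ a = true ∧ ¬ b = true ∧ c = true := by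
  cases a <;> cases b <;> simp

theorem cnd_false_cnd_iff (a b : Bool) :
    cnd a false (cnd b false true) = true ↔ ¬ a = true ∧ ¬ b = true := by
  cases a <;> cases b <;> simp

theorem commonIn_iff (H s : ℕ) (l : List ℕ) : commonIn H s l = true ↔
    l.Pairwise fun x y => (field H x &&& field H y) &&& s = field H x &&& field H y := by
  induction l with
  | nil => simp [commonIn]
  | cons a t ih =>
    change cnd (anyList (fun y => force (field H a &&& field H y) fun b =>
      cnd (Nat.beq (b &&& s) b) false true) t) false (commonIn H s t) = true ↔ _
    rw [List.pairwise_cons, ← ih, cnd_eq]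
    have h1 : anyList (fun y => force (field H a &&& field H y) fun b =>
        cnd (Nat.beq (b &&& s) b) false true) t = true ↔
        ¬ ∀ y ∈ t, (field H a &&& field H y) &&& s = field H a &&& field H y := by
      rw [anyList_iff]
      push Not
      refine exists_congr fun y => and_congr_right fun _ => ?_
      rw [force_eq, cnd_eq]
      simp [Nat.beq_eq]
    split_ifs with h
    · simp [h1.1 h]
    · rw [h1, not_not] at h
      exact ⟨fun h' => ⟨h, h'⟩, fun h' => h'.2⟩

/-- A good graph with the edges `01`, `02`, where `01` lies in no triangle. -/
structure Rooted (G : SimpleGraph (Fin 14)) : Prop where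
  good : IsGoodCubic G
  adj01 : G.Adj 0 1
  adj02 : G.Adj 0 2
  no_triangle : ∀ w, ¬ (G.Adj 0 w ∧ G.Adj 1 w)

/-! ### Good graphs: consequences for a new vertex, and the tests -/

section good

variable {G : SimpleGraph (Fin 14)}

theorem sum_adjNum_eq_three (hG : IsGoodCubic G) : ∀ i < 14, ∑ j ∈ range 14, adjNum G i j = 3 := by
  intro i hi
  have := sum_adjNum G ⟨i, hi⟩
  rwa [hG.cubic] at this

theorem eq_of_common (hG : IsGoodCubic G) {u v a b : ℕ} (huv : u ≠ v) (hu : u < 14) (hv : v < 14)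
    (hn : adjNum G u v ≠ 1) (h1 : adjNum G u a = 1) (h2 : adjNum G v a = 1)
    (h3 : adjNum G u b = 1) (h4 : adjNum G v b = 1) : a = b := by
  obtain ⟨_, ha, k1⟩ := (adjNum_eq_one G).1 h1
  obtain ⟨_, _, k2⟩ := (adjNum_eq_one G).1 h2
  obtain ⟨_, hb, k3⟩ := (adjNum_eq_one G).1 h3
  obtain ⟨_, _, k4⟩ := (adjNum_eq_one G).1 h4
  have h5 := hG.common ⟨u, hu⟩ ⟨v, hv⟩ (by simpa using huv)
    fun h => hn ((adjNum_eq_one G).2 ⟨hu, hv, h⟩)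
  rw [Set.ncard_le_one_iff] at h5
  simpa using h5 (a := ⟨a, ha⟩) (b := ⟨b, hb⟩) ⟨k1, k2⟩ ⟨k3, k4⟩

/-- If two neighbours of `m` had a common neighbour `k` not adjacent to `m`, with `k` before `m`,
then the non-adjacent vertices `m` and `k` would have two common neighbours. -/
theorem commonIn_earlier (hG : IsGoodCubic G) {m : ℕ} (hm : m < 14) :
    commonIn (bitMat (adjNum G) m) (pack 2 m (adjNum G m)) (earlier (adjNum G) m) = true := by
  have hA := adjNum_le G
  rw [commonIn_iff, earlier, List.pairwise_map, List.pairwise_filter]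
  refine List.nodup_range.imp_of_mem fun {i j} hi hj hij him hjm => ?_
  have hi := List.mem_range.1 hi
  have hj := List.mem_range.1 hj
  simp only [decide_eq_true_eq] at him hjm
  rw [field_bitMat hA hm.le hi, field_bitMat hA hm.le hj]
  refine Nat.eq_of_testBit_eq fun k => ?_
  rw [Bool.eq_iff_iff]
  simp only [Nat.testBit_land, Bool.and_eq_true, testBit_pack (hA _)]
  refine ⟨fun h => h.1, fun h => ⟨h, h.1.1, ?_⟩⟩
  obtain ⟨⟨hk, h1⟩, -, h2⟩ := h
  by_contra hn
  refine hij (eq_of_common hG (u := m) (v := k) (by omega) hm (by omega) hn ?_ ?_ ?_ ?_)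
  · rwa [adjNum_comm]
  · rwa [adjNum_comm]
  · rwa [adjNum_comm]
  · rwa [adjNum_comm]

theorem boundary_succ (hG : IsGoodCubic G) {m : ℕ} (hm : m < 14) :
    boundary (adjNum G) (m + 1) + 2 * (earlier (adjNum G) m).length =
      boundary (adjNum G) m + 3 := by
  have hA := adjNum_le G
  have h1 : ∀ u, ∑ t ∈ Ico m 14, adjNum G u t = adjNum G u m + ∑ t ∈ Ico (m + 1) 14, adjNum G u t :=
    fun u => (sum_eq_sum_Ico_succ_bot hm _)
  have h2 := sum_adjNum_eq_three hG m hm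
  rw [range_eq_Ico, ← sum_Ico_consecutive _ (Nat.zero_le m) hm.le, h1, adjNum_self,
    ← range_eq_Ico, sum_congr rfl fun t _ => adjNum_comm G m t] at h2
  simp only [boundary, h1, sum_add_distrib, sum_range_succ, length_earlier hA]
  omega

/-- The degrees of the `r` remaining vertices sum to `3 * r`. This is the number of edges from the
earlier vertices plus the sum of the degrees inside the remaining set, and each of the latter is at
most `r - 1`. -/
theorem feasible_boundary (hG : IsGoodCubic G) {m r : ℕ} (hmr : m + r = 14) :
    feasible r (boundary (adjNum G) m) = true := by
  have hA := adjNum_le G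
  have h1 : ∀ t ∈ Ico m 14, ∑ u ∈ range m, adjNum G u t + ∑ u ∈ Ico m 14, adjNum G u t = 3 := by
    intro t ht
    rw [range_eq_Ico, sum_Ico_consecutive _ (Nat.zero_le m) (by omega),
      sum_congr rfl fun u _ => adjNum_comm G u t, ← range_eq_Ico]
    exact sum_adjNum_eq_three hG t (mem_Ico.1 ht).2
  have h2 : ∀ t ∈ Ico m 14, ∑ u ∈ Ico m 14, adjNum G u t ≤ r - 1 := by
    intro t ht
    rw [← sum_erase (f := fun u => adjNum G u t) (a := t) _ (adjNum_self G t)]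
    refine (sum_le_card_nsmul _ _ 1 fun u _ => hA u t).trans ?_
    rw [card_erase_of_mem ht, Nat.card_Ico]
    simp; omega
  have h3 : boundary (adjNum G) m + ∑ t ∈ Ico m 14, ∑ u ∈ Ico m 14, adjNum G u t = 3 * r := by
    rw [boundary, sum_comm, ← sum_add_distrib, sum_congr rfl h1, sum_const, Nat.card_Ico]
    simp; omega
  have h4 : ∑ t ∈ Ico m 14, ∑ u ∈ Ico m 14, adjNum G u t ≤ r * (r - 1) := by
    refine (sum_le_card_nsmul _ _ _ h2).trans ?_
    rw [Nat.card_Ico, smul_eq_mul, show 14 - m = r by omega]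
  rw [feasible, cnd_eq, if_pos]
  · rw [Nat.ble_eq]
    change 3 * r ≤ _ + r * (r - 1)
    omega
  · rw [Nat.ble_eq]
    change _ ≤ 3 * r
    omega

/-- The neighbours of `m` are found among the deficient vertices, and by canonicity the first
deficient vertex is one of them. This is the shape of choice that `branch` runs through. -/
theorem earlier_choice (hG : IsGoodCubic G) (hC : Canon G) {m : ℕ} (hm3 : 3 ≤ m) (hm : m < 14) :
    let d := ((List.range m).filter fun u => ∑ j ∈ range m, adjNum G u j < 3).map (B ^ ·)
    earlier (adjNum G) m = [] ∧ d = [] ∨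
      ∃ u us l', earlier (adjNum G) m = u :: l' ∧ d = u :: us ∧ l'.Sublist us := by
  intro d
  have hcub := sum_adjNum_eq_three hG
  have hsub : List.Sublist ((List.range m).filter fun u => adjNum G u m = 1)
      ((List.range m).filter fun u => ∑ j ∈ range m, adjNum G u j < 3) := by
    have h : (List.range m).filter (fun u => adjNum G u m = 1) =
        ((List.range m).filter fun u => ∑ j ∈ range m, adjNum G u j < 3).filter
          fun u => adjNum G u m = 1 := by
      rw [List.filter_filter]
      refine List.filter_congr fun u hu => ?_
      have := saturated_of_adj hcub hm (List.mem_range.1 hu)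
      simpa using this
    rw [h]
    exact List.filter_sublist
  have hsort : ((List.range m).filter fun u => ∑ j ∈ range m, adjNum G u j < 3).Pairwise (· < ·) :=
    List.pairwise_lt_range.filter _
  have hmemD : ∀ u, u ∈ ((List.range m).filter fun u => ∑ j ∈ range m, adjNum G u j < 3) ↔
      u < m ∧ ∑ j ∈ range m, adjNum G u j < 3 := by simp
  have hmemE : ∀ u, u ∈ ((List.range m).filter fun u => adjNum G u m = 1) ↔
      u < m ∧ adjNum G u m = 1 := by simp
  have hd : d = ((List.range m).filter fun u => ∑ j ∈ range m, adjNum G u j < 3).map (B ^ ·) := rfl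
  rw [hd, earlier]
  revert hsub hsort hmemD hmemE
  generalize ((List.range m).filter fun u => adjNum G u m = 1) = E
  generalize ((List.range m).filter fun u => ∑ j ∈ range m, adjNum G u j < 3) = D
  intro hsub hsort hmemD hmemE
  cases D with
  | nil => exact Or.inl ⟨by rw [List.sublist_nil.1 hsub]; rfl, rfl⟩
  | cons u us =>
    obtain ⟨hum, hu⟩ := (hmemD u).1 List.mem_cons_self
    -- `Canon.first_adj` needs that nothing before `u` is adjacent to `m`; such a vertex would be
    -- deficient, but `u` is the first deficient one.
    have huE : u ∈ E := by
      refine (hmemE u).2 ⟨hum, hC.first_adj hcub hm3 hm hum hu fun v hv => ?_⟩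
      by_contra hne
      have h1 : adjNum G v m = 1 := by have := adjNum_le G v m; omega
      rcases List.mem_cons.1 (hsub.subset ((hmemE v).2 ⟨by omega, h1⟩)) with rfl | h2
      · exact lt_irrefl _ hv
      · exact lt_asymm hv ((List.pairwise_cons.1 hsort).1 v h2)
    cases hsub with
    | cons _ h => exact (lt_irrefl _ ((List.pairwise_cons.1 hsort).1 u (h.subset huE))).elim
    | cons_cons _ h =>
      exact Or.inr ⟨B ^ u, us.map (B ^ ·), _, rfl, rfl, h.map _⟩

theorem goodList_iff :
    goodList (mat (adjNum G) 14) (bitMat (adjNum G) 14) (verts 14) = true ↔ IsGoodCubic G := by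
  have hA := adjNum_le G
  let R : ℕ → ℕ → Prop := fun i j => adjNum G i j = 1 ∨ ∀ a b, adjNum G i a = 1 → adjNum G j a = 1 →
    adjNum G i b = 1 → adjNum G j b = 1 → a = b
  have hlt : ∀ {i j}, adjNum G i j = 1 → j < 14 := fun h => ((adjNum_eq_one G).1 h).2.1
  have key : ∀ l : List ℕ, (∀ i ∈ l, i < 14) →
      (goodList (mat (adjNum G) 14) (bitMat (adjNum G) 14) (l.map (B ^ ·)) = true ↔
        (∀ i ∈ l, ∑ j ∈ range 14, adjNum G i j = 3) ∧ l.Pairwise R) := by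
    intro l hl
    induction l with
    | nil => simp [goodList]
    | cons i t ih =>
      have hi := hl i List.mem_cons_self
      have ih := ih fun j hj => hl j (List.mem_cons_of_mem _ hj)
      change cnd (Nat.beq (row (mat (adjNum G) 14) (B ^ i) % (B - 1)) 3)
        (cnd (anyList (fun y =>
          cnd (atMostOne (field (bitMat (adjNum G) 14) (B ^ i) &&& field (bitMat (adjNum G) 14) y))
            false (Nat.beq (field (bitMat (adjNum G) 14) (B ^ i) &&& bit y) 0))
            (t.map (B ^ ·)))
          false (goodList (mat (adjNum G) 14) (bitMat (adjNum G) 14) (t.map (B ^ ·)))) false = true ↔ _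
      have h1 : ∑ j ∈ range 14, adjNum G i j ≤ ∑ j ∈ range 14, 1 := sum_le_sum fun j _ => hA i j
      have h2 : 14 < B - 1 := by decide
      rw [row_mat hA le_rfl hi, pack_mod (by decide) (by simp at h1; omega),
        field_bitMat hA le_rfl hi]
      have h3 : anyList (fun y =>
          cnd (atMostOne (pack 2 14 (adjNum G i) &&& field (bitMat (adjNum G) 14) y))
            false (Nat.beq (pack 2 14 (adjNum G i) &&& bit y) 0)) (t.map (B ^ ·)) = true ↔
          ¬ ∀ j ∈ t, R i j := by
        rw [anyList_iff]
        push Not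
        simp only [List.mem_map, exists_exists_and_eq_and]
        refine exists_congr fun j => and_congr_right fun hj => ?_
        have hj := hl j (List.mem_cons_of_mem _ hj)
        rw [field_bitMat hA le_rfl hj, bit_pow hj]
        have h4 : atMostOne (pack 2 14 (adjNum G i) &&& pack 2 14 (adjNum G j)) = true ↔
            ∀ a b, adjNum G i a = 1 → adjNum G j a = 1 →
              adjNum G i b = 1 → adjNum G j b = 1 → a = b := by
          rw [atMostOne_iff]
          simp only [Nat.testBit_land, Bool.and_eq_true, testBit_pack (hA _)]
          exact ⟨fun h a b h1 h2 h3 h4 => h a b ⟨⟨hlt h1, h1⟩, hlt h1, h2⟩ ⟨⟨hlt h3, h3⟩, hlt h3, h4⟩,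
            fun h a b h1 h2 => h a b h1.1.2 h1.2.2 h2.1.2 h2.2.2⟩
        have h5 : Nat.beq (pack 2 14 (adjNum G i) &&& 2 ^ j) 0 = true ↔ adjNum G i j ≠ 1 := by
          rw [Nat.beq_eq, ← testBit_eq_false_iff, ← Bool.not_eq_true,
            testBit_pack (hA i)]
          simp [hj]
        rw [cnd_eq]
        simp only [R, not_or, ← h4]
        split_ifs with h6
        · simp [h6]
        · simp [h6, h5]
      rw [cnd_cnd_iff, Nat.beq_eq, h3, ih, not_not, List.forall_mem_cons, List.pairwise_cons]
      exact ⟨fun ⟨h4, h5, h6, h7⟩ => ⟨⟨h4, h6⟩, h5, h7⟩, fun ⟨⟨h4, h6⟩, h5, h7⟩ => ⟨h4, h5, h6, h7⟩⟩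
  rw [verts, key _ fun i hi => List.mem_range.1 hi]
  simp only [List.mem_range]
  constructor
  · rintro ⟨h1, h2⟩
    -- The list only compares a vertex with later ones; symmetry gives all pairs.
    have : Std.Symm R := by
      refine ⟨?_⟩
      rintro i j (h | h)
      · exact Or.inl (by rwa [adjNum_comm])
      · exact Or.inr fun a b h1 h2 h3 h4 => h a b h2 h1 h4 h3
    refine ⟨fun v => by rw [← sum_adjNum, h1 v v.2], fun u v huv hn => ?_⟩
    rw [Set.ncard_le_one_iff]
    intro a b ha hb
    rcases h2.forall (List.mem_range.2 u.2) (List.mem_range.2 v.2) (by simpa [Fin.ext_iff] using huv)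
      with h | h
    · exact (hn ((adjNum_fin G).1 h)).elim
    · exact Fin.ext (h a b ((adjNum_fin G).2 ha.1) ((adjNum_fin G).2 ha.2) ((adjNum_fin G).2 hb.1)
        ((adjNum_fin G).2 hb.2))
  · intro hG
    refine ⟨sum_adjNum_eq_three hG, List.nodup_range.imp_of_mem fun {i j} hi hj hij => ?_⟩
    by_cases h : adjNum G i j = 1
    · exact Or.inl h
    · exact Or.inr fun a b h1 h2 h3 h4 => eq_of_common hG hij (List.mem_range.1 hi)
        (List.mem_range.1 hj) h h1 h2 h3 h4

/-- The vertex lies in a triangle. -/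
def InTriangle (G : SimpleGraph (Fin 14)) (x : Fin 14) : Prop :=
  ∃ u v, G.Adj x u ∧ G.Adj x v ∧ G.Adj u v

theorem inTriangle_iff (x : Fin 14) :
    inTriangle (bitMat (adjNum G) 14) (verts 14) (B ^ (x : ℕ)) = true ↔ InTriangle G x := by
  have hA := adjNum_le G
  rw [inTriangle, anyList_iff]
  simp only [mem_verts, exists_exists_and_eq_and]
  have key : ∀ u : Fin 14, (cnd (Nat.beq (Nat.land (field (bitMat (adjNum G) 14) (B ^ (x : ℕ)))
      (bit (B ^ (u : ℕ)))) 0) false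
      (cnd (Nat.beq (Nat.land (field (bitMat (adjNum G) 14) (B ^ (x : ℕ)))
        (field (bitMat (adjNum G) 14) (B ^ (u : ℕ)))) 0) false true) = true) ↔
      G.Adj x u ∧ ∃ v, G.Adj x v ∧ G.Adj u v := by
    intro u
    rw [field_bitMat hA le_rfl x.2, field_bitMat hA le_rfl u.2, bit_pow u.2]
    have h1 : Nat.beq (Nat.land (pack 2 14 (adjNum G x)) (2 ^ (u : ℕ))) 0 = true ↔ ¬ G.Adj x u := by
      change Nat.beq (pack 2 14 (adjNum G x) &&& 2 ^ (u : ℕ)) 0 = true ↔ _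
      rw [Nat.beq_eq, ← testBit_eq_false_iff, ← Bool.not_eq_true,
        testBit_pack (hA x), adjNum_fin]
      simp
    have h2 : Nat.beq (Nat.land (pack 2 14 (adjNum G x)) (pack 2 14 (adjNum G u))) 0 = true ↔
        ¬ ∃ v, G.Adj x v ∧ G.Adj u v := by
      rw [Nat.beq_eq, land_pack_eq_zero_iff (hA _) (hA _)]
      constructor
      · rintro h ⟨v, h1, h2⟩
        exact h v v.2 ⟨(adjNum_fin G).2 h1, (adjNum_fin G).2 h2⟩
      · rintro h k hk ⟨h1, h2⟩
        exact h ⟨⟨k, hk⟩, (adjNum_fin G (j := ⟨k, hk⟩)).1 h1, (adjNum_fin G (j := ⟨k, hk⟩)).1 h2⟩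
    rw [cnd_false_cnd_iff, h1, h2, not_not, not_not]
  constructor
  · rintro ⟨t, ht, h⟩
    obtain ⟨h1, v, h2, h3⟩ := (key ⟨t, ht⟩).1 h
    exact ⟨_, v, h1, h2, h3⟩
  · rintro ⟨u, v, h1, h2, h3⟩
    exact ⟨u, u.2, (key u).2 ⟨h1, v, h2, h3⟩⟩

end good

end SegmentCount

namespace SegmentCount

open Finset

/-! ### The outputs of the search -/

/-- The graph has an automorphism that fixes `0`, `1` and moves `2` to `3`. -/
def MovesTwo (G : SimpleGraph (Fin 14)) : Prop :=
  ∃ π : Equiv.Perm (Fin 14), π 0 = 0 ∧ π 1 = 1 ∧ π 2 = 3 ∧ relabel G π = G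

open Classical in
/-- The kind of a graph. -/
noncomputable def kind (G : SimpleGraph (Fin 14)) : ℕ :=
  (if InTriangle G 0 then 0 else 4) +
    ((if InTriangle G 1 then 0 else 2) + if MovesTwo G then 1 else 0)

theorem kind_lt (G : SimpleGraph (Fin 14)) : kind G < 8 := by
  unfold kind
  split_ifs <;> norm_num

/-- The output for a canonical graph. -/
noncomputable def output (G : SimpleGraph (Fin 14)) : ℕ := codeNum (adjNum G) 14 * 8 + kind G

theorem output_mod (G : SimpleGraph (Fin 14)) : output G % 8 = kind G := by
  have := kind_lt G
  unfold output
  omega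

theorem output_injective {G G' : SimpleGraph (Fin 14)} (h : output G = output G') : G = G' := by
  have h1 := kind_lt G
  have h2 := kind_lt G'
  have h3 : codeNum (adjNum G) 14 = codeNum (adjNum G') 14 := by
    unfold output at h
    omega
  refine eq_of_code_eq fun p hp => ?_
  rw [← field_codeNum (adjNum_le G) le_rfl hp, h3, field_codeNum (adjNum_le G') le_rfl hp]

/-- The vertex 0 has degree 2 among the first three vertices, so it is the first deficient one when
3 is numbered. Hence 2 and 3 are the two vertices of the first handle in every canonical numbering.
-/
theorem Rooted.adj03 {G : SimpleGraph (Fin 14)} (hG : Rooted G) (hC : Canon G) : G.Adj 0 3 := by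
  have h01 : adjNum G 0 1 = 1 := (adjNum_fin G (i := 0) (j := 1)).2 hG.adj01
  have h02 : adjNum G 0 2 = 1 := (adjNum_fin G (i := 0) (j := 2)).2 hG.adj02
  refine (adjNum_fin G (i := 0) (j := 3)).1 (hC.first_adj (sum_adjNum_eq_three hG.good) le_rfl
    (by norm_num) (by norm_num) ?_ (by simp))
  simp [sum_range_succ, h01, h02]

theorem adjNum_eq_zero {G : SimpleGraph (Fin 14)} {i j : Fin 14} (h : ¬ G.Adj i j) :
    adjNum G i j = 0 := by
  have := adjNum_le G i j
  have : ¬ adjNum G i j = 1 := fun h1 => h ((adjNum_fin G).1 h1)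
  omega

theorem kindOf_eq {G : SimpleGraph (Fin 14)} (hG : Rooted G) (hC : Canon G) :
    kindOf (verts 14) (mat (adjNum G) 14) (bitMat (adjNum G) 14) (codeNum (adjNum G) 14) =
      kind G := by
  have h03 := hG.adj03 hC
  have h0 := inTriangle_iff (G := G) 0
  have h1 := inTriangle_iff (G := G) 1
  have h2 := symmetric_iff G ((adjNum_fin G (i := 0) (j := 1)).2 hG.adj01)
    ((adjNum_fin G (i := 0) (j := 2)).2 hG.adj02) ((adjNum_fin G (i := 0) (j := 3)).2 h03)
    (adjNum_eq_zero (i := 1) (j := 2) fun h => hG.no_triangle 2 ⟨hG.adj02, h⟩)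
    (adjNum_eq_zero (i := 1) (j := 3) fun h => hG.no_triangle 3 ⟨h03, h⟩)
  rw [show B ^ ((0 : Fin 14) : ℕ) = 1 from rfl] at h0
  rw [show B ^ ((1 : Fin 14) : ℕ) = B from rfl] at h1
  change cnd _ 0 4 + (cnd _ 0 2 + cnd _ 1 0) = _
  rw [cnd_eq, cnd_eq, cnd_eq]
  classical
  exact congrArg₂ (· + ·) (if_congr h0 rfl rfl)
    (congrArg₂ (· + ·) (if_congr h1 rfl rfl) (if_congr h2 rfl rfl))

theorem no_common_iff {G : SimpleGraph (Fin 14)} {m : ℕ} (hm : m ≤ 14) (hm2 : 2 ≤ m) :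
    Nat.beq (Nat.land (field (bitMat (adjNum G) m) 1) (field (bitMat (adjNum G) m) B)) 0 = true ↔
      ∀ k < m, ¬ (adjNum G 0 k = 1 ∧ adjNum G 1 k = 1) := by
  have hA := adjNum_le G
  have h0 := field_bitMat hA hm (show 0 < m by omega)
  have h1 := field_bitMat hA hm (show 1 < m by omega)
  rw [pow_zero] at h0
  rw [pow_one] at h1
  rw [h0, h1, Nat.beq_eq, land_pack_eq_zero_iff (hA _) (hA _)]

/-- A leaf repeats all conditions except the edges `01` and `02`, which the search starts from and
never changes; they are therefore assumed. -/
theorem mem_leaf_iff {G : SimpleGraph (Fin 14)} (h01 : G.Adj 0 1) (h02 : G.Adj 0 2) {x : ℕ} :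
    x ∈ leaf (verts 14) (mat (adjNum G) 14) (bitMat (adjNum G) 14) (codeNum (adjNum G) 14) ↔
      Rooted G ∧ Canon G ∧ x = output G := by
  have hcan := canon_iff G
  have hgood := goodList_iff (G := G)
  have htri : Nat.beq (Nat.land (field (bitMat (adjNum G) 14) 1)
      (field (bitMat (adjNum G) 14) B)) 0 = true ↔ ∀ w, ¬ (G.Adj 0 w ∧ G.Adj 1 w) := by
    rw [no_common_iff le_rfl (by norm_num)]
    constructor
    · rintro h w ⟨h1, h2⟩
      exact h w w.2 ⟨(adjNum_fin G (i := 0)).2 h1, (adjNum_fin G (i := 1)).2 h2⟩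
    · rintro h k hk ⟨h1, h2⟩
      exact h ⟨k, hk⟩ ⟨(adjNum_fin G (i := 0) (j := ⟨k, hk⟩)).1 h1,
        (adjNum_fin G (i := 1) (j := ⟨k, hk⟩)).1 h2⟩
  rw [leaf]
  constructor
  · intro hx
    simp only [cnd_eq] at hx
    split_ifs at hx with h1 h2 h3
    · simp at hx
    · have hR : Rooted G := ⟨hgood.1 h3, h01, h02, htri.1 h2⟩
      have hC := hcan.2 (by simpa using h1)
      rw [kindOf_eq hR hC, List.mem_singleton] at hx
      exact ⟨hR, hC, hx⟩
    · simp at hx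
    · simp at hx
  · rintro ⟨hR, hC, rfl⟩
    rw [kindOf_eq hR hC, hcan.1 hC, htri.2 hR.no_triangle, hgood.2 hR.good]
    exact List.mem_singleton.2 rfl

theorem search_zero (vs : List ℕ) (m e G H C : ℕ) : search 0 vs m e G H C = leaf vs G H C := rfl

theorem search_succ (k : ℕ) (vs : List ℕ) (m e G H C : ℕ) :
    search (k + 1) vs m e G H C =
      branch k e (filterList (fun u => Nat.ble (Nat.mod (row G u) (Nat.sub B 1)) 2) vs) fun e' l =>
        extend k m G H C (List.append vs [m]) l (search k (List.append vs [m]) (m * B) e') := by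
  change (forceList _ fun d => forceList _ fun vs' =>
    branch k e d fun e' l => extend k m G H C vs' l (search k vs' (m * B) e')) = _
  rw [forceList_eq, forceList_eq]

/-- Completeness: along the path that always chooses the true earlier neighbours of the new vertex,
the state is the packed initial part of `G`, and no test rejects it. -/
theorem output_mem_search {G : SimpleGraph (Fin 14)} (hR : Rooted G) (hC : Canon G) (k m : ℕ)
    (hm : 3 ≤ m) (hkm : m + k = 14) :
    output G ∈ search k (verts m) (B ^ m) (boundary (adjNum G) m) (mat (adjNum G) m)
      (bitMat (adjNum G) m) (codeNum (adjNum G) m) := by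
  have hA := adjNum_le G
  have hs := adjNum_comm G
  have hz := adjNum_self G
  induction k generalizing m with
  | zero =>
    obtain rfl : m = 14 := by omega
    rw [search_zero, mem_leaf_iff hR.adj01 hR.adj02]
    exact ⟨hR, hC, rfl⟩
  | succ k ih =>
    have hm' : m < 14 := by omega
    have hb := boundary_succ hR.good hm'
    have hlen : (earlier (adjNum G) m).length ≤ 3 := by
      rw [length_earlier hA, ← sum_adjNum_eq_three hR.good m hm', sum_congr rfl fun u _ => hs u m]
      exact sum_le_sum_of_subset (range_subset_range.2 hm'.le)
    rw [search_succ, deficient_eq hA hm'.le, verts_succ]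
    refine mem_branch (earlier_choice hR.good hC hm hm') hlen hb
      (feasible_boundary hR.good (by omega)) ?_
    rw [extend]
    simp only [force_eq]
    rw [bits_earlier hA hs hm', commonIn_earlier hR.good hm', ← bits_earlier hA hs hm',
      addBits_earlier hA hs hz hm', addMatrix_earlier hA hs hz, addCode_earlier hA hm',
      (no_common_iff (by omega) (by omega)).2, ← pow_succ]
    · have h1 : cnd (Nat.beq k 4) (improvable (verts (m + 1)) 7 (mat (adjNum G) (m + 1))
          (codeNum (adjNum G) (m + 1))) false = false := by
        rw [cnd_eq]
        split_ifs with h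
        · rw [Nat.beq_eq] at h
          -- Four vertices remain after `m`, so ten are numbered; 7 is the number of positions from
          -- 3 to 9.
          obtain rfl : m = 9 := by omega
          exact hC.not_improvable (m := 10) (by norm_num) (by norm_num)
        · rfl
      rw [h1]
      exact ih (m + 1) (by omega) (by omega)
    · rintro w hw ⟨h1, h2⟩
      exact hR.no_triangle ⟨w, by omega⟩ ⟨(adjNum_fin G (i := 0) (j := ⟨w, _⟩)).1 h1,
        (adjNum_fin G (i := 1) (j := ⟨w, _⟩)).1 h2⟩

/-- The graphs agree on the vertices before `m`. -/
def AgreeOn (m : ℕ) (A A' : ℕ → ℕ → ℕ) : Prop := ∀ i < m, ∀ j < m, A i j = A' i j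

theorem AgreeOn.mat_eq {m : ℕ} {A A' : ℕ → ℕ → ℕ} (h : AgreeOn m A A') : mat A m = mat A' m :=
  pack_congr fun i hi => pack_congr fun j hj => h i hi j hj

theorem AgreeOn.bitMat_eq {m : ℕ} {A A' : ℕ → ℕ → ℕ} (h : AgreeOn m A A') :
    bitMat A m = bitMat A' m :=
  pack_congr fun i hi => pack_congr fun j hj => h i hi j hj

theorem AgreeOn.codeNum_eq {m : ℕ} {A A' : ℕ → ℕ → ℕ} (h : AgreeOn m A A') :
    codeNum A m = codeNum A' m :=
  pack_congr fun p hp => sum_congr rfl fun u hu => by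
    rw [h u (by have := mem_range.1 hu; omega) p hp]

/-- Every state reached by the search is the initial part of some graph, not necessarily cubic, so
the lemmas on packed matrices apply to it. -/
theorem exists_graph_with_earlier (G : SimpleGraph (Fin 14)) {m : ℕ} (hm : m < 14) {l : List ℕ}
    (hl : l.Sublist (verts m)) : ∃ G' : SimpleGraph (Fin 14),
      AgreeOn m (adjNum G) (adjNum G') ∧ earlier (adjNum G') m = l := by
  obtain ⟨us, hus, rfl⟩ := List.sublist_map_iff.1 hl
  let G' : SimpleGraph (Fin 14) := SimpleGraph.fromRel fun i j =>
    ((i : ℕ) < m ∧ (j : ℕ) < m ∧ G.Adj i j) ∨ ((i : ℕ) ∈ us ∧ (j : ℕ) = m)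
  have hum : ∀ u ∈ us, u < m := fun u hu => List.mem_range.1 (hus.subset hu)
  refine ⟨G', fun i hi j hj => ?_, ?_⟩
  · have h : adjNum G i j = 1 ↔ adjNum G' i j = 1 := by
      have h1 := adjNum_fin G (i := ⟨i, by omega⟩) (j := ⟨j, by omega⟩)
      have h2 := adjNum_fin G' (i := ⟨i, by omega⟩) (j := ⟨j, by omega⟩)
      simp only at h1 h2
      rw [h1, h2, SimpleGraph.fromRel_adj]
      simp only [hi, hj, true_and, hi.ne, hj.ne, and_false, or_false]
      rw [G.adj_comm ⟨j, _⟩, or_self]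
      exact ⟨fun h => ⟨h.ne, h⟩, fun h => h.2⟩
    have := adjNum_le G i j
    have := adjNum_le G' i j
    omega
  · rw [earlier]
    congr 1
    have h : (List.range m).filter (fun u => adjNum G' u m = 1) = (List.range m).filter (· ∈ us) := by
      refine List.filter_congr fun u hu => ?_
      have hu := List.mem_range.1 hu
      have h2 := adjNum_fin G' (i := ⟨u, by omega⟩) (j := ⟨m, hm⟩)
      simp only at h2
      rw [decide_eq_decide, h2, SimpleGraph.fromRel_adj]
      simp only [lt_irrefl, false_and, and_false, false_or, and_true, hu.ne, or_false]
      exact ⟨fun h => h.2, fun h => ⟨by simpa using hu.ne, h⟩⟩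
    rw [h]
    have hnd : us.Nodup := List.nodup_range.sublist hus
    -- Both lists are strictly increasing, so having the same elements makes them equal.
    refine List.Perm.eq_of_pairwise (le := (· < ·)) (fun a b _ _ h1 h2 => (lt_asymm h1 h2).elim)
      (List.pairwise_lt_range.filter _) (List.pairwise_lt_range.sublist hus) ?_
    rw [List.perm_ext_iff_of_nodup (List.nodup_range.filter _) hnd]
    intro a
    simpa using fun h => hum a h

/-- Soundness rests on the leaf alone; the pruning tests and the number `e` play no role. -/
theorem exists_of_mem_search (k m e x : ℕ) (hm : 3 ≤ m) (hkm : m + k = 14)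
    (G : SimpleGraph (Fin 14)) (h01 : G.Adj 0 1) (h02 : G.Adj 0 2)
    (hx : x ∈ search k (verts m) (B ^ m) e (mat (adjNum G) m) (bitMat (adjNum G) m)
      (codeNum (adjNum G) m)) :
    ∃ G' : SimpleGraph (Fin 14), Rooted G' ∧ Canon G' ∧ x = output G' := by
  induction k generalizing m e G with
  | zero =>
    obtain rfl : m = 14 := by omega
    rw [search_zero, mem_leaf_iff h01 h02] at hx
    exact ⟨G, hx⟩
  | succ k ih =>
    have hm' : m < 14 := by omega
    rw [search_succ, deficient_eq (adjNum_le G) hm'.le, verts_succ] at hx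
    obtain ⟨e', l, hl, hx⟩ := exists_of_mem_branch hx
    obtain ⟨G', hagree, rfl⟩ := exists_graph_with_earlier G hm'
      (hl.trans (List.filter_sublist.map _))
    rw [hagree.mat_eq, hagree.bitMat_eq, hagree.codeNum_eq] at hx
    have hA := adjNum_le G'
    have hs := adjNum_comm G'
    have hz := adjNum_self G'
    rw [extend] at hx
    simp only [force_eq] at hx
    rw [addBits_earlier hA hs hz hm', addMatrix_earlier hA hs hz, addCode_earlier hA hm',
      ← pow_succ] at hx
    simp only [cnd_eq] at hx
    refine ih (m + 1) e' (by omega) (by omega) G' ?_ ?_ ?_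
    · rw [← adjNum_fin, ← hagree _ (by simp; omega) _ (by simp; omega), adjNum_fin]
      exact h01
    · rw [← adjNum_fin, ← hagree _ (by simp; omega) _ (by simp; omega), adjNum_fin]
      exact h02
    · split_ifs at hx <;> first | exact hx | simp at hx

/-- The path with the edges `01`, `02`. -/
def cherry : SimpleGraph (Fin 14) := SimpleGraph.fromRel fun i j => i = 0 ∧ (j = 1 ∨ j = 2)

/-- The starting state is the same for every graph with these three adjacencies. It serves soundness
with `cherry` and completeness with the graph to be found. -/
theorem outputs_eq {G : SimpleGraph (Fin 14)} (h01 : G.Adj 0 1) (h02 : G.Adj 0 2)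
    (h12 : ¬ G.Adj 1 2) : outputs = search 11 (verts 3) (B ^ 3) 5 (mat (adjNum G) 3)
      (bitMat (adjNum G) 3) (codeNum (adjNum G) 3) := by
  have a01 : adjNum G 0 1 = 1 := (adjNum_fin G (i := 0) (j := 1)).2 h01
  have a02 : adjNum G 0 2 = 1 := (adjNum_fin G (i := 0) (j := 2)).2 h02
  have a12 : adjNum G 1 2 = 0 := adjNum_eq_zero (i := 1) (j := 2) h12
  have a10 : adjNum G 1 0 = 1 := by rw [adjNum_comm, a01]
  have a20 : adjNum G 2 0 = 1 := by rw [adjNum_comm, a02]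
  have a21 : adjNum G 2 1 = 0 := by rw [adjNum_comm, a12]
  have hm : mat (adjNum G) 3 = B + B ^ 2 + BB + BB ^ 2 := by
    simp [mat, pack, sum_range_succ, a01, a02, a12, a10, a20, a21]
  have hb : bitMat (adjNum G) 3 = 6 + B + B ^ 2 := by
    simp [bitMat, pack, sum_range_succ, a01, a02, a12, a10, a20, a21]
  have hc : codeNum (adjNum G) 3 = B * 8192 + B ^ 2 * 8192 := by
    simp only [codeNum, codeCol, pack, sum_range_succ, sum_range_zero, a01, a02, a12,
      show 2 ^ (13 - 0) = 8192 from rfl]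
    ring
  rw [hm, hb, hc, outputs]
  rfl

theorem mem_outputs_iff {x : ℕ} : x ∈ outputs ↔ ∃ G, Rooted G ∧ Canon G ∧ x = output G := by
  constructor
  · intro hx
    have h01 : cherry.Adj 0 1 := by simp [cherry]
    have h02 : cherry.Adj 0 2 := by simp [cherry]
    rw [outputs_eq h01 h02 (by simp [cherry])] at hx
    exact exists_of_mem_search 11 3 5 x le_rfl rfl cherry h01 h02 hx
  · rintro ⟨G, hR, hC, rfl⟩
    have h12 : ¬ G.Adj 1 2 := fun h => hR.no_triangle 2 ⟨hR.adj02, h⟩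
    rw [outputs_eq hR.adj01 hR.adj02 h12]
    -- The free edge ends are one at 0 and two each at 1 and 2.
    have h5 : boundary (adjNum G) 3 = 5 := by
      have h := sum_adjNum_eq_three hR.good
      have a01 : adjNum G 0 1 = 1 := (adjNum_fin G (i := 0) (j := 1)).2 hR.adj01
      have a02 : adjNum G 0 2 = 1 := (adjNum_fin G (i := 0) (j := 2)).2 hR.adj02
      have a12 : adjNum G 1 2 = 0 := adjNum_eq_zero (i := 1) (j := 2) h12
      have key : ∀ u < 14, ∑ j ∈ range 3, adjNum G u j + ∑ j ∈ Ico 3 14, adjNum G u j = 3 := by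
        intro u hu
        rw [sum_range_add_sum_Ico _ (by norm_num), h u hu]
      have k0 := key 0 (by norm_num)
      have k1 := key 1 (by norm_num)
      have k2 := key 2 (by norm_num)
      have a10 : adjNum G 1 0 = 1 := by rw [adjNum_comm, a01]
      have a20 : adjNum G 2 0 = 1 := by rw [adjNum_comm, a02]
      have a21 : adjNum G 2 1 = 0 := by rw [adjNum_comm, a12]
      rw [sum_range_succ, sum_range_succ, sum_range_succ, sum_range_zero] at k0 k1 k2
      rw [adjNum_self] at k0 k1 k2
      rw [boundary, sum_range_succ, sum_range_succ, sum_range_succ, sum_range_zero]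
      omega
    rw [← h5]
    exact output_mem_search hR hC 11 3 le_rfl rfl

end SegmentCount

namespace SegmentCount

/-! ### The evaluation of the search -/

/-- The whole enumeration, with the list of outputs evaluated before it is checked. The kinds 4 and
5 are not counted: there 1 lies in a triangle and 0 does not, which is the excluded type (4,6). -/
theorem checkList_outputs : forceList outputs checkList = true := by decide +kernel

theorem distinctList_iff (l : List ℕ) : distinctList l = true ↔ l.Nodup := by
  induction l with
  | nil => simp [distinctList]
  | cons a t ih =>
    change cnd (anyList (fun y => Nat.beq a y) t) false (distinctList t) = true ↔ _
    have h1 : anyList (fun y => Nat.beq a y) t = true ↔ a ∈ t := by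
      simp [anyList_iff, Nat.beq_eq]
    rw [List.nodup_cons, ← ih, ← h1, cnd_eq]
    split_ifs with h
    · simp [h]
    · simp [h]

theorem countKind_eq (k : ℕ) (l : List ℕ) : countKind k l = (l.filter fun x => x % 8 = k).length := by
  induction l with
  | nil => rfl
  | cons a t ih =>
    change cnd (Nat.beq (a % 8) k) (countKind k t).succ (countKind k t) = _
    rw [cnd_eq, ih, List.filter_cons]
    by_cases h : a % 8 = k
    · rw [if_pos (by rwa [Nat.beq_eq]), if_pos (by simpa using h)]
      rfl
    · rw [if_neg (by rwa [Nat.beq_eq]), if_neg (by simpa using h)]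

theorem nodup_outputs : outputs.Nodup := by
  have h := checkList_outputs
  rw [forceList_eq, checkList, cnd_eq] at h
  split_ifs at h with h1
  · exact (distinctList_iff _).1 h1

theorem countKind_outputs : countKind 0 outputs = 26 ∧ countKind 1 outputs = 6 ∧
    countKind 2 outputs = 118 ∧ countKind 3 outputs = 19 ∧ countKind 6 outputs = 512 ∧
    countKind 7 outputs = 47 := by
  have h := checkList_outputs
  rw [forceList_eq, checkList] at h
  simp only [cnd_eq] at h
  split_ifs at h with h1 h2 h3 h4 h5 h6
  simp only [Nat.beq_eq] at h2 h3 h4 h5 h6 h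
  exact ⟨h2, h3, h4, h5, h6, h⟩

/-- The canonical rooted graphs. -/
abbrev CanonGraph : Type := {G : SimpleGraph (Fin 14) // Rooted G ∧ Canon G}

/-- `output` is a bijection from canonical graphs onto the list of outputs, the last three bits of
an output are the kind, and the list has no repetitions. -/
theorem card_kind (k : ℕ) : Nat.card {x : CanonGraph // kind x.1 = k} = countKind k outputs := by
  classical
  let S : Finset ℕ := (outputs.filter fun x => x % 8 = k).toFinset
  have hS : S.card = countKind k outputs := by
    rw [countKind_eq, List.toFinset_card_of_nodup (nodup_outputs.filter _)]
  have hmem : ∀ y, y ∈ S ↔ y ∈ outputs ∧ y % 8 = k := by simp [S]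
  let f : {x : CanonGraph // kind x.1 = k} → S := fun x => ⟨output x.1.1, (hmem _).2
    ⟨mem_outputs_iff.2 ⟨x.1.1, x.1.2.1, x.1.2.2, rfl⟩, by rw [output_mod, x.2]⟩⟩
  have hf : Function.Bijective f := by
    constructor
    · intro x y h
      exact Subtype.ext (Subtype.ext (output_injective (Subtype.ext_iff.1 h)))
    · rintro ⟨y, hy⟩
      obtain ⟨h1, h2⟩ := (hmem y).1 hy
      obtain ⟨G, hR, hC, rfl⟩ := mem_outputs_iff.1 h1
      exact ⟨⟨⟨G, hR, hC⟩, by rw [← output_mod, h2]⟩, rfl⟩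
  rw [Nat.card_congr (Equiv.ofBijective f hf), Nat.card_eq_fintype_card, Fintype.card_coe, hS]

/-! ### Counting orbits -/

section orbits

variable {α : Type} {f g : α → α}

/-- The action of the group of order 4 by two commuting involutions. -/
abbrev involutionAction (hf : Function.Involutive f) (hg : Function.Involutive g)
    (hfg : ∀ a, f (g a) = g (f a)) : MulAction (ℤˣ × ℤˣ) α where
  smul u a := if u.1 = 1 then (if u.2 = 1 then a else g a) else f (if u.2 = 1 then a else g a)
  one_smul _ := rfl
  mul_smul u v a := by
    change (if (u * v).1 = 1 then (if (u * v).2 = 1 then a else g a)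
      else f (if (u * v).2 = 1 then a else g a)) = if u.1 = 1 then (if u.2 = 1 then
      (if v.1 = 1 then (if v.2 = 1 then a else g a) else f (if v.2 = 1 then a else g a))
      else g (if v.1 = 1 then (if v.2 = 1 then a else g a) else f (if v.2 = 1 then a else g a)))
      else f (if u.2 = 1 then
      (if v.1 = 1 then (if v.2 = 1 then a else g a) else f (if v.2 = 1 then a else g a))
      else g (if v.1 = 1 then (if v.2 = 1 then a else g a) else f (if v.2 = 1 then a else g a)))
    have h1 : (-1 : ℤˣ) ≠ 1 := by decide
    obtain ⟨u1, u2⟩ := u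
    obtain ⟨v1, v2⟩ := v
    rcases Int.units_eq_one_or u1 with rfl | rfl <;> rcases Int.units_eq_one_or u2 with rfl | rfl <;>
      rcases Int.units_eq_one_or v1 with rfl | rfl <;>
      rcases Int.units_eq_one_or v2 with rfl | rfl <;>
      simp [h1, hf _, hg _, hfg]

/-- Burnside's lemma for the group of order 4 that is generated by the two involutions; the four
terms are the fixed points of its elements. -/
theorem four_mul_card_classes [Finite α] (hf : Function.Involutive f) (hg : Function.Involutive g)
    (hfg : ∀ a, f (g a) = g (f a)) {C : Type} (c : α → C) (hc : Function.Surjective c)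
    (h : ∀ a b, c a = c b ↔ b = a ∨ b = f a ∨ b = g a ∨ b = f (g a)) :
    4 * Nat.card C = Nat.card α + Nat.card {a // f a = a} + Nat.card {a // g a = a} +
      Nat.card {a // f (g a) = a} := by
  classical
  have := Fintype.ofFinite α
  let _ := involutionAction hf hg hfg
  have h1 : (-1 : ℤˣ) ≠ 1 := by decide
  have hsmul : ∀ (u : ℤˣ × ℤˣ) (a : α), u • a = if u.1 = 1 then (if u.2 = 1 then a else g a)
      else f (if u.2 = 1 then a else g a) := fun _ _ => rfl
  have key := MulAction.sum_card_fixedBy_eq_card_orbits_mul_card_group (ℤˣ × ℤˣ) α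
  have horb : ∀ a b, (MulAction.orbitRel (ℤˣ × ℤˣ) α) a b ↔ c a = c b := by
    intro a b
    rw [MulAction.orbitRel_apply, eq_comm, h, MulAction.mem_orbit_iff]
    constructor
    · rintro ⟨⟨u, v⟩, rfl⟩
      rw [hsmul]
      rcases Int.units_eq_one_or u with rfl | rfl <;> rcases Int.units_eq_one_or v with rfl | rfl <;>
        simp [h1]
    · rintro (rfl | rfl | rfl | rfl)
      · exact ⟨(1, 1), by simp [hsmul]⟩
      · exact ⟨(-1, 1), by simp [hsmul, h1]⟩
      · exact ⟨(1, -1), by simp [hsmul, h1]⟩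
      · exact ⟨(-1, -1), by simp [hsmul, h1]⟩
  have hC : Nat.card (Quotient (MulAction.orbitRel (ℤˣ × ℤˣ) α)) = Nat.card C := by
    refine Nat.card_congr (Equiv.ofBijective
      (Quotient.lift c fun a b hab => (horb a b).1 hab) ⟨?_, ?_⟩)
    · intro x y
      induction x using Quotient.inductionOn
      induction y using Quotient.inductionOn
      exact fun h => Quotient.sound ((horb _ _).2 h)
    · intro x
      obtain ⟨a, rfl⟩ := hc x
      exact ⟨Quotient.mk _ a, rfl⟩
  rw [← hC, Nat.card_eq_fintype_card, Nat.card_eq_fintype_card, mul_comm]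
  have hcard : Fintype.card (ℤˣ × ℤˣ) = 4 := rfl
  rw [hcard] at key
  rw [← key, Fintype.sum_prod_type]
  have hu : ∀ F : ℤˣ → ℕ, ∑ u, F u = F 1 + F (-1) := by
    intro F
    rw [show (Finset.univ : Finset ℤˣ) = {1, -1} from rfl, Finset.sum_pair (by decide)]
  rw [hu, hu, hu]
  simp only [← Nat.card_eq_fintype_card]
  have e11 : Nat.card (MulAction.fixedBy α ((1, 1) : ℤˣ × ℤˣ)) = Nat.card α :=
    (Nat.card_congr (Equiv.subtypeUnivEquiv fun a => by
      rw [MulAction.mem_fixedBy]; simp [hsmul]))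
  have e12 : Nat.card (MulAction.fixedBy α ((1, -1) : ℤˣ × ℤˣ)) = Nat.card {a // g a = a} :=
    (Nat.card_congr (Equiv.subtypeEquivRight fun a => by
      rw [MulAction.mem_fixedBy]; simp [hsmul, h1]))
  have e21 : Nat.card (MulAction.fixedBy α ((-1, 1) : ℤˣ × ℤˣ)) = Nat.card {a // f a = a} :=
    (Nat.card_congr (Equiv.subtypeEquivRight fun a => by
      rw [MulAction.mem_fixedBy]; simp [hsmul, h1]))
  have e22 : Nat.card (MulAction.fixedBy α ((-1, -1) : ℤˣ × ℤˣ)) = Nat.card {a // f (g a) = a} :=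
    (Nat.card_congr (Equiv.subtypeEquivRight fun a => by
      rw [MulAction.mem_fixedBy]; simp [hsmul, h1]))
  rw [e11, e12, e21, e22]
  ring

theorem card_pairs {X : Type} [Finite X] (K : X → ℕ) (hK : ∀ x, K x < 4) (q : ℕ → ℕ → Bool) :
    Nat.card {p : X × X // q (K p.1) (K p.2) = true} =
      ∑ i ∈ Finset.range 4, ∑ j ∈ Finset.range 4,
        if q i j then Nat.card {x // K x = i} * Nat.card {x // K x = j} else 0 := by
  classical
  have := Fintype.ofFinite X
  rw [← Finset.sum_product', Nat.card_eq_fintype_card, Fintype.card_subtype]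
  rw [Finset.card_eq_sum_card_fiberwise (f := fun p : X × X => (K p.1, K p.2))
    (t := Finset.range 4 ×ˢ Finset.range 4)
    (fun p _ => by simpa using ⟨hK p.1, hK p.2⟩)]
  refine Finset.sum_congr rfl fun ij _ => ?_
  obtain ⟨i, j⟩ := ij
  rw [Nat.card_eq_fintype_card, Nat.card_eq_fintype_card, Fintype.card_subtype,
    Fintype.card_subtype, ← Finset.card_product]
  split_ifs with h
  · congr 1
    ext ⟨x, y⟩
    simp only [Finset.mem_filter, Finset.mem_univ, true_and, Finset.mem_product, Prod.mk.injEq]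
    constructor
    · exact fun h => h.2
    · rintro ⟨rfl, rfl⟩
      exact ⟨h, rfl, rfl⟩
  · rw [Finset.card_eq_zero, Finset.filter_eq_empty_iff]
    rintro ⟨x, y⟩ hxy heq
    simp only [Finset.mem_filter, Finset.mem_univ, true_and, Prod.mk.injEq] at hxy heq
    rw [heq.1, heq.2] at hxy
    exact h hxy

theorem card_diagonal {X : Type} [Finite X] (K : X → ℕ) (hK : ∀ x, K x < 4) (q : ℕ → Bool) :
    Nat.card {x : X // q (K x) = true} =
      ∑ i ∈ Finset.range 4, if q i then Nat.card {x // K x = i} else 0 := by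
  classical
  have := Fintype.ofFinite X
  rw [Nat.card_eq_fintype_card, Fintype.card_subtype]
  rw [Finset.card_eq_sum_card_fiberwise (f := K) (t := Finset.range 4)
    (fun x _ => by simpa using hK x)]
  refine Finset.sum_congr rfl fun i _ => ?_
  rw [Nat.card_eq_fintype_card, Fintype.card_subtype]
  split_ifs with h
  · congr 1
    ext x
    simp only [Finset.mem_filter, Finset.mem_univ, true_and]
    exact ⟨fun h => h.2, fun hx => ⟨by rw [hx, h], hx⟩⟩
  · rw [Finset.card_eq_zero, Finset.filter_eq_empty_iff]
    intro x hx heq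
    simp only [Finset.mem_filter, Finset.mem_univ, true_and] at hx
    rw [heq] at hx
    exact h hx

/-- The number of classes of pairs up to exchanging the entries and applying an involution to both
entries. -/
theorem four_mul_card_pair_classes {X : Type} [Finite X] {τ : X → X} (hτ : Function.Involutive τ)
    (K : X → ℕ) (hK : ∀ x, K x < 4) (hKτ : ∀ x, K (τ x) = K x) (q : ℕ → ℕ → Bool)
    (hq : ∀ i j, q i j = q j i) {C : Type}
    (c : {p : X × X // q (K p.1) (K p.2) = true} → C) (hc : Function.Surjective c)
    (h : ∀ a b, c a = c b ↔ b.1 = a.1 ∨ b.1 = (τ a.1.1, τ a.1.2) ∨ b.1 = a.1.swap ∨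
      b.1 = (τ a.1.2, τ a.1.1)) :
    4 * Nat.card C =
      (∑ i ∈ Finset.range 4, ∑ j ∈ Finset.range 4,
        if q i j then Nat.card {x // K x = i} * Nat.card {x // K x = j} else 0) +
      (∑ i ∈ Finset.range 4, ∑ j ∈ Finset.range 4,
        if q i j then Nat.card {x // τ x = x ∧ K x = i} * Nat.card {x // τ x = x ∧ K x = j} else 0) +
      2 * ∑ i ∈ Finset.range 4, if q i i then Nat.card {x // K x = i} else 0 := by
  let f : {p : X × X // q (K p.1) (K p.2) = true} → {p : X × X // q (K p.1) (K p.2) = true} :=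
    fun p => ⟨(τ p.1.1, τ p.1.2), by simpa only [hKτ] using p.2⟩
  let g : {p : X × X // q (K p.1) (K p.2) = true} → {p : X × X // q (K p.1) (K p.2) = true} :=
    fun p => ⟨p.1.swap, by rw [hq]; exact p.2⟩
  have key := four_mul_card_classes (f := f) (g := g)
    (fun p => Subtype.ext (Prod.ext (hτ _) (hτ _))) (fun p => Subtype.ext (Prod.swap_swap _))
    (fun p => rfl) c hc (fun a b => by rw [h]; simp only [Subtype.ext_iff]; rfl)
  have k1 := card_pairs K hK q
  -- Turning both entries fixes the pairs of fixed points of `τ`.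
  have k2 : Nat.card {a // f a = a} = ∑ i ∈ Finset.range 4, ∑ j ∈ Finset.range 4,
      if q i j then Nat.card {x // τ x = x ∧ K x = i} * Nat.card {x // τ x = x ∧ K x = j} else 0 := by
    have h1 := card_pairs (fun x : {x // τ x = x} => K x.1) (fun x => hK _) q
    have h2 : ∀ i, Nat.card {x : {x // τ x = x} // K x.1 = i} = Nat.card {x // τ x = x ∧ K x = i} :=
      fun i => Nat.card_congr (Equiv.subtypeSubtypeEquivSubtypeInter (fun x => τ x = x) fun x => K x = i)
    simp only [h2] at h1
    rw [← h1]
    refine Nat.card_congr ⟨fun a => ⟨(⟨a.1.1.1, ?_⟩, ⟨a.1.1.2, ?_⟩), a.1.2⟩,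
      fun a => ⟨⟨(a.1.1.1, a.1.2.1), a.2⟩, Subtype.ext (Prod.ext a.1.1.2 a.1.2.2)⟩,
      fun a => rfl, fun a => rfl⟩
    · exact (Prod.ext_iff.1 (Subtype.ext_iff.1 a.2)).1
    · exact (Prod.ext_iff.1 (Subtype.ext_iff.1 a.2)).2
  -- The exchange fixes the diagonal.
  have k3 : Nat.card {a // g a = a} = ∑ i ∈ Finset.range 4,
      if q i i then Nat.card {x // K x = i} else 0 := by
    rw [← card_diagonal K hK fun i => q i i]
    refine Nat.card_congr ⟨fun a => ⟨a.1.1.1, ?_⟩, fun x => ⟨⟨(x.1, x.1), x.2⟩, rfl⟩,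
      fun a => ?_, fun a => rfl⟩
    · have h1 : a.1.1.2 = a.1.1.1 := (Prod.ext_iff.1 (Subtype.ext_iff.1 a.2)).1
      have h2 := a.1.2
      rwa [h1] at h2
    · exact Subtype.ext (Subtype.ext (Prod.ext rfl (Prod.ext_iff.1 (Subtype.ext_iff.1 a.2)).1.symm))
  -- The exchange combined with `τ` fixes the pairs `(x, τ x)`, which are as many as the diagonal
  -- ones because `τ` preserves `K`.
  have k4 : Nat.card {a // f (g a) = a} = ∑ i ∈ Finset.range 4,
      if q i i then Nat.card {x // K x = i} else 0 := by
    rw [← card_diagonal K hK fun i => q i i]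
    refine Nat.card_congr ⟨fun a => ⟨a.1.1.1, ?_⟩,
      fun x => ⟨⟨(x.1, τ x.1), by rw [hKτ]; exact x.2⟩, ?_⟩, fun a => ?_, fun a => rfl⟩
    · have h1 : τ a.1.1.1 = a.1.1.2 := (Prod.ext_iff.1 (Subtype.ext_iff.1 a.2)).2
      have h2 := a.1.2
      rwa [← h1, hKτ] at h2
    · exact Subtype.ext (Prod.ext (hτ _) rfl)
    · exact Subtype.ext (Subtype.ext (Prod.ext rfl (Prod.ext_iff.1 (Subtype.ext_iff.1 a.2)).2))
  rw [key, k1, k2, k3, k4]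
  ring

end orbits

end SegmentCount

namespace SegmentCount

/-! ### Numberings of segments -/

theorem isGoodCubic_of_iso {V W : Type} {G : SimpleGraph V} {H : SimpleGraph W} (hH : IsGoodCubic H)
    (e : G ≃g H) : IsGoodCubic G where
  cubic v := by
    rw [← hH.cubic (e v), ← Set.ncard_image_of_injective _ e.injective]
    congr 1
    ext w
    obtain ⟨w, rfl⟩ := e.surjective w
    simp [e.injective.mem_set_image, e.map_adj_iff]
  common u v huv h := by
    have := hH.common (e u) (e v) (e.injective.ne huv) (by rwa [e.map_adj_iff])
    rw [← Set.ncard_image_of_injective _ e.injective]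
    convert this using 2
    ext w
    obtain ⟨w, rfl⟩ := e.surjective w
    simp [e.injective.mem_set_image, SimpleGraph.mem_commonNeighbors, e.map_adj_iff]

/-- The numbering of a relabelled graph as an isomorphism. -/
def relabelIso (G : SimpleGraph (Fin 14)) (π : Equiv.Perm (Fin 14)) : relabel G π ≃g G where
  toEquiv := π
  map_rel_iff' := Iff.rfl

theorem inTriangle_congr {G H : SimpleGraph (Fin 14)} (e : G ≃g H) (v : Fin 14) :
    InTriangle G v ↔ InTriangle H (e v) := by
  constructor
  · rintro ⟨a, b, h1, h2, h3⟩
    exact ⟨e a, e b, e.map_adj_iff.2 h1, e.map_adj_iff.2 h2, e.map_adj_iff.2 h3⟩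
  · rintro ⟨a, b, h1, h2, h3⟩
    obtain ⟨a, rfl⟩ := e.surjective a
    obtain ⟨b, rfl⟩ := e.surjective b
    exact ⟨a, b, e.map_adj_iff.1 h1, e.map_adj_iff.1 h2, e.map_adj_iff.1 h3⟩

theorem exists_perm_three {a b c : Fin 14} (hab : a ≠ b) (hac : a ≠ c) (hbc : b ≠ c) :
    ∃ π : Equiv.Perm (Fin 14), π 0 = a ∧ π 1 = b ∧ π 2 = c := by
  obtain ⟨π, hπ⟩ := exists_perm_extending (q := 3)
    (τ := fun j => if j = 0 then a else if j = 1 then b else c)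
    (fun j _ => by split_ifs <;> exact Fin.is_lt _)
    (fun j hj i hi => by
      have h1 : (a : ℕ) ≠ b := Fin.val_injective.ne hab
      have h2 : (a : ℕ) ≠ c := Fin.val_injective.ne hac
      have h3 : (b : ℕ) ≠ c := Fin.val_injective.ne hbc
      interval_cases j <;> interval_cases i <;> simpa)
  exact ⟨π, Fin.ext (by simpa using hπ 0), Fin.ext (by simpa using hπ 1),
    Fin.ext (by simpa using hπ 2)⟩

/-- The graph is obtained by numbering the vertices of a segment, with `0`, `1`, `2` for `y`, `z`
and a given vertex of the first handle. -/
def Numbers (S : Segment) (a : Fin 14) (G : SimpleGraph (Fin 14)) : Prop :=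
  ∃ π : Equiv.Perm (Fin 14), π 0 = S.y ∧ π 1 = S.z ∧ π 2 = a ∧ relabel S.H π = G

theorem exists_numbers (S : Segment) (h : S.handle₁) :
    ∃ x : CanonGraph, Numbers S h.1.1 x.1 := by
  have hyh : S.H.Adj S.y h.1.1 := h.2
  obtain ⟨π, h0, h1, h2⟩ := exists_perm_three S.adj.ne hyh.ne h.1.2.2.symm
  obtain ⟨σ, s0, s1, s2, hσ⟩ := exists_canon (relabel S.H π)
  have t0 : (π * σ) 0 = S.y := by simp [s0, h0]
  have t1 : (π * σ) 1 = S.z := by simp [s1, h1]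
  have t2 : (π * σ) 2 = h.1.1 := by simp [s2, h2]
  refine ⟨⟨relabel S.H (π * σ), ⟨isGoodCubic_of_iso S.good (relabelIso _ _), ?_, ?_, fun w => ?_⟩, hσ⟩,
    π * σ, t0, t1, t2, rfl⟩
  · rw [relabel_adj, t0, t1]
    exact S.adj
  · rw [relabel_adj, t0, t2]
    exact hyh
  · rw [relabel_adj, relabel_adj, t0, t1]
    exact S.no_triangle _

/-- The canonical graph of a segment with a distinguished vertex of the first handle. -/
noncomputable def canonGraph (S : Segment) (h : S.handle₁) : CanonGraph := (exists_numbers S h).choose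

theorem numbers_canonGraph (S : Segment) (h : S.handle₁) : Numbers S h.1.1 (canonGraph S h).1 :=
  (exists_numbers S h).choose_spec

/-- Two canonical numberings of the same segment and handle vertex differ by a permutation fixing 0,
1, 2, so `Canon.eq` makes the graphs equal and the choice in `canonGraph` immaterial. -/
theorem numbers_iff {S : Segment} {h : S.handle₁} {x : CanonGraph} :
    Numbers S h.1.1 x.1 ↔ canonGraph S h = x := by
  refine ⟨?_, fun hx => hx ▸ numbers_canonGraph S h⟩
  rintro ⟨π, p0, p1, p2, hπ⟩
  obtain ⟨ρ, r0, r1, r2, hρ⟩ := numbers_canonGraph S h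
  have hx : relabel x.1 (π⁻¹ * ρ) = (canonGraph S h).1 := by
    rw [← hπ, relabel_relabel, mul_inv_cancel_left, hρ]
  refine Subtype.ext (hx.symm.trans (x.2.2.eq ?_ ?_ ?_ (hx ▸ (canonGraph S h).2.2))) <;>
    rw [Equiv.Perm.mul_apply, Equiv.Perm.inv_eq_iff_eq]
  · rw [r0, p0]
  · rw [r1, p1]
  · rw [r2, p2]

theorem exists_handle_eq (S : Segment) : ∃ a b : Fin 14, a ≠ b ∧ S.H.Adj S.y a ∧ S.H.Adj S.y b ∧
    a ≠ S.z ∧ b ≠ S.z ∧ ∀ v, S.H.Adj S.y v → v = a ∨ v = b ∨ v = S.z := by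
  obtain ⟨u, v, w, huv, huw, hvw, h⟩ := Set.ncard_eq_three.1 (S.good.cubic S.y)
  have hmem : ∀ x, S.H.Adj S.y x ↔ x = u ∨ x = v ∨ x = w := fun x => by
    rw [← SimpleGraph.mem_neighborSet, h]
    simp
  have hu := (hmem u).2 (by simp)
  have hv := (hmem v).2 (by simp)
  have hw := (hmem w).2 (by simp)
  rcases (hmem S.z).1 S.adj with rfl | rfl | rfl
  · exact ⟨v, w, hvw, hv, hw, huv.symm, huw.symm, fun x hx => by have := (hmem x).1 hx; tauto⟩
  · exact ⟨u, w, huw, hu, hw, huv, hvw.symm, fun x hx => by have := (hmem x).1 hx; tauto⟩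
  · exact ⟨u, v, huv, hu, hv, huw, hvw, fun x hx => by have := (hmem x).1 hx; tauto⟩

theorem eq_or_eq_of_handle {S : Segment} {h k : S.handle₁} (hk : k ≠ h) (l : S.handle₁) :
    l = h ∨ l = k := by
  obtain ⟨a, b, hab, ha, hb, haz, hbz, hv⟩ := exists_handle_eq S
  have hm : ∀ l : S.handle₁, l.1.1 = a ∨ l.1.1 = b := fun l => by
    rcases hv l.1.1 l.2 with h | h | h
    · exact Or.inl h
    · exact Or.inr h
    · exact (l.1.2.2 h).elim
  have he : ∀ l m : S.handle₁, l.1.1 = m.1.1 → l = m := fun l m h => Subtype.ext (Subtype.ext h)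
  rcases hm h with h1 | h1 <;> rcases hm k with h2 | h2
  · exact (hk (he _ _ (h2.trans h1.symm))).elim
  · exact (hm l).imp (fun h3 => he _ _ (h3.trans h1.symm)) fun h3 => he _ _ (h3.trans h2.symm)
  · exact (hm l).symm.imp (fun h3 => he _ _ (h3.trans h1.symm)) fun h3 => he _ _ (h3.trans h2.symm)
  · exact (hk (he _ _ (h2.trans h1.symm))).elim

theorem exists_other (S : Segment) (h : S.handle₁) : ∃ k : S.handle₁, k ≠ h := by
  obtain ⟨a, b, hab, ha, hb, haz, hbz, -⟩ := exists_handle_eq S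
  by_cases h1 : h.1.1 = a
  · exact ⟨⟨⟨b, hb.ne', hbz⟩, hb⟩, fun h2 => hab (by rw [← h1, ← h2])⟩
  · exact ⟨⟨⟨a, ha.ne', haz⟩, ha⟩, fun h2 => h1 (by rw [← h2])⟩

instance (S : Segment) : Nonempty S.handle₁ := by
  obtain ⟨a, b, hab, ha, hb, haz, hbz, -⟩ := exists_handle_eq S
  exact ⟨⟨⟨a, ha.ne', haz⟩, ha⟩⟩

/-! ### The involution on canonical graphs -/

/-- A canonical graph as a segment. -/
def toSegment (x : CanonGraph) : Segment := ⟨x.1, x.2.1.good, 0, 1, x.2.1.adj01, x.2.1.no_triangle⟩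

/-- The first vertex of the first handle. -/
def two (x : CanonGraph) : (toSegment x).handle₁ :=
  ⟨⟨2, by change (2 : Fin 14) ≠ 0 ∧ (2 : Fin 14) ≠ 1; decide⟩, x.2.1.adj02⟩

/-- The second vertex of the first handle. -/
def three (x : CanonGraph) : (toSegment x).handle₁ :=
  ⟨⟨3, by change (3 : Fin 14) ≠ 0 ∧ (3 : Fin 14) ≠ 1; decide⟩, x.2.1.adj03 x.2.2⟩

theorem three_ne_two (x : CanonGraph) : three x ≠ two x := fun h =>
  absurd (congrArg (fun l => l.1.1) h) (show (3 : Fin 14) ≠ 2 by decide)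

theorem canonGraph_two (x : CanonGraph) : canonGraph (toSegment x) (two x) = x :=
  numbers_iff.1 ⟨1, rfl, rfl, rfl, rfl⟩

/-- The canonical graph with the other vertex of the first handle distinguished. -/
noncomputable def turn (x : CanonGraph) : CanonGraph := canonGraph (toSegment x) (three x)

/-- A canonical numbering that begins with `h` gives the other handle vertex the number 3, and
`turn` renumbers from there. -/
theorem canonGraph_other {S : Segment} {h k : S.handle₁} (hk : k ≠ h) :
    canonGraph S k = turn (canonGraph S h) := by
  obtain ⟨π, p0, p1, p2, hπ⟩ := numbers_canonGraph S h
  obtain ⟨ρ, r0, r1, r2, hρ⟩ := numbers_canonGraph (toSegment (canonGraph S h)) (three _)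
  change ρ 0 = 0 at r0
  change ρ 1 = 1 at r1
  change ρ 2 = 3 at r2
  change relabel (canonGraph S h).1 ρ = (turn (canonGraph S h)).1 at hρ
  have h3 : π 3 = k.1.1 := by
    have h1 : S.H.Adj S.y (π 3) := by
      have : (canonGraph S h).1.Adj 0 3 := (three (canonGraph S h)).2
      rwa [← hπ, relabel_adj, p0] at this
    have h2 : π 3 ≠ S.z := by
      rw [← p1]
      exact π.injective.ne (by decide)
    rcases eq_or_eq_of_handle hk ⟨⟨π 3, h1.ne', h2⟩, h1⟩ with h4 | h4
    · exact absurd (π.injective ((congrArg (fun l => l.1.1) h4).trans p2.symm)) (by decide)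
    · exact congrArg (fun l => l.1.1) h4
  refine numbers_iff.1 ⟨π * ρ, by simp [r0, p0], by simp [r1, p1], by simp [r2, h3], ?_⟩
  rw [← relabel_relabel, hπ, hρ]

theorem turn_involutive : Function.Involutive turn := fun x => by
  have h1 := canonGraph_other (three_ne_two x)
  have h2 := canonGraph_other (three_ne_two x).symm
  rwa [h1, canonGraph_two, eq_comm] at h2

theorem turn_eq_self_iff (x : CanonGraph) : turn x = x ↔ MovesTwo x.1 :=
  numbers_iff.symm

theorem inTriangle_zero_canonGraph (S : Segment) (h : S.handle₁) :
    InTriangle (canonGraph S h).1 0 ↔ InTriangle S.H S.y := by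
  obtain ⟨π, p0, p1, p2, hπ⟩ := numbers_canonGraph S h
  rw [← hπ, inTriangle_congr (relabelIso _ π), ← p0]
  rfl

theorem inTriangle_one_canonGraph (S : Segment) (h : S.handle₁) :
    InTriangle (canonGraph S h).1 1 ↔ InTriangle S.H S.z := by
  obtain ⟨π, p0, p1, p2, hπ⟩ := numbers_canonGraph S h
  rw [← hπ, inTriangle_congr (relabelIso _ π), ← p1]
  rfl

open Classical in
/-- The part of the kind that determines the type. -/
noncomputable def typeNum (x : CanonGraph) : ℕ :=
  (if InTriangle x.1 0 then 0 else 2) + if InTriangle x.1 1 then 0 else 1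

theorem typeNum_lt (x : CanonGraph) : typeNum x < 4 := by
  unfold typeNum
  split_ifs <;> norm_num

theorem typeNum_turn (x : CanonGraph) : typeNum (turn x) = typeNum x := by
  classical
  exact congrArg₂ (· + ·) (if_congr (inTriangle_zero_canonGraph _ _) rfl rfl)
    (if_congr (inTriangle_one_canonGraph _ _) rfl rfl)

theorem kind_eq (x : CanonGraph) [Decidable (turn x = x)] :
    kind x.1 = 2 * typeNum x + if turn x = x then 1 else 0 := by
  have h := turn_eq_self_iff x
  unfold kind typeNum
  split_ifs <;> first | omega | tauto

instance : Finite CanonGraph := by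
  classical
  infer_instance

theorem card_typeNum_turn {i l : ℕ} (hl : l = 2 * i + 1) :
    Nat.card {x : CanonGraph // turn x = x ∧ typeNum x = i} = countKind l outputs := by
  classical
  rw [← card_kind]
  refine Nat.card_congr (Equiv.subtypeEquivRight fun x => ?_)
  rw [kind_eq]
  split_ifs with h
  · simp only [h, true_and]
    omega
  · simp only [h, false_and, false_iff]
    omega

theorem card_typeNum {i k l : ℕ} (hk : k = 2 * i) (hl : l = 2 * i + 1) :
    Nat.card {x : CanonGraph // typeNum x = i} = countKind k outputs + countKind l outputs := by
  classical
  have := Fintype.ofFinite CanonGraph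
  rw [← card_kind, ← card_kind]
  simp only [Nat.card_eq_fintype_card, Fintype.card_subtype]
  rw [← Finset.card_union_of_disjoint]
  · congr 1
    ext x
    simp only [Finset.mem_filter, Finset.mem_univ, true_and, Finset.mem_union]
    rw [kind_eq]
    split_ifs <;> omega
  · rw [Finset.disjoint_filter]
    intro x _ h1 h2
    omega

/-- With equal canonical graphs, one numbering undone and followed by the other is an isomorphism of
the marked graphs; conversely, an isomorphism transports numberings. -/
theorem canonGraph_eq_iff {S T : Segment} {h : S.handle₁} {k : T.handle₁} :
    canonGraph S h = canonGraph T k ↔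
      ∃ π : S.H ≃g T.H, π S.y = T.y ∧ π S.z = T.z ∧ π h.1.1 = k.1.1 := by
  obtain ⟨π, p0, p1, p2, hπ⟩ := numbers_canonGraph S h
  constructor
  · intro hST
    obtain ⟨ρ, r0, r1, r2, hρ⟩ := numbers_canonGraph T k
    have hrel : relabel S.H π = relabel T.H ρ := by rw [hπ, hρ, hST]
    refine ⟨⟨π.symm.trans ρ, fun {a b} => ?_⟩, ?_, ?_, ?_⟩
    · have : (relabel S.H π).Adj (π.symm a) (π.symm b) ↔ (relabel T.H ρ).Adj (π.symm a) (π.symm b) := by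
        rw [hrel]
      rw [relabel_adj, relabel_adj, π.apply_symm_apply, π.apply_symm_apply] at this
      exact this.symm
    · change ρ (π.symm S.y) = T.y
      rw [← p0, π.symm_apply_apply, r0]
    · change ρ (π.symm S.z) = T.z
      rw [← p1, π.symm_apply_apply, r1]
    · change ρ (π.symm h.1.1) = k.1.1
      rw [← p2, π.symm_apply_apply, r2]
  · rintro ⟨e, e0, e1, e2⟩
    refine (numbers_iff.1 ⟨π.trans e.toEquiv, ?_, ?_, ?_, ?_⟩).symm
    · change e (π 0) = T.y
      rw [p0, e0]
    · change e (π 1) = T.z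
      rw [p1, e1]
    · change e (π 2) = k.1.1
      rw [p2, e2]
    · rw [← hπ]
      ext a b
      exact e.map_adj_iff

end SegmentCount

namespace SegmentCount

/-! ### The type of a segment -/

theorem common_unique {H : SimpleGraph (Fin 14)} (hH : IsGoodCubic H) {u v p q : Fin 14}
    (huv : u ≠ v) (h : ¬ H.Adj u v) (hup : H.Adj u p) (hvp : H.Adj v p) (huq : H.Adj u q)
    (hvq : H.Adj v q) : p = q :=
  (Set.ncard_le_one (Set.toFinite _)).1 (hH.common u v huv h) p ⟨hup, hvp⟩ q ⟨huq, hvq⟩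

/-- Inclusion-exclusion. `N(y)` and `N(z)` are disjoint, which gives 6 vertices. `N(a)` and `N(b)`
only share `y`, which gives 5. The two unions meet in `{y, a, b}` or in `{y}` according as `ab` is
an edge or not. So 8 or 10 of the 14 vertices are covered. -/
theorem ncard_core {H : SimpleGraph (Fin 14)} (hH : IsGoodCubic H) {y z a b : Fin 14}
    (hyz : H.Adj y z) (ht : ∀ w, ¬ (H.Adj y w ∧ H.Adj z w)) (hab : a ≠ b) (ha : H.Adj y a)
    (hb : H.Adj y b) (haz : a ≠ z) (hv : ∀ v, H.Adj y v → v = a ∨ v = b ∨ v = z)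
    [Decidable (H.Adj a b)] :
    {v | ¬ H.Adj y v ∧ ¬ H.Adj z v ∧ ¬ H.Adj a v ∧ ¬ H.Adj b v}.ncard =
      if H.Adj a b then 6 else 4 := by
  classical
  have hcard : ∀ v, (H.neighborFinset v).card = 3 := fun v => by
    rw [← hH.cubic v, Set.ncard_eq_toFinset_card']
    rfl
  have hset : {v | ¬ H.Adj y v ∧ ¬ H.Adj z v ∧ ¬ H.Adj a v ∧ ¬ H.Adj b v} =
      ↑((H.neighborFinset y ∪ H.neighborFinset z) ∪
        (H.neighborFinset a ∪ H.neighborFinset b))ᶜ := by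
    ext v
    simp only [Set.mem_ofPred_eq, Finset.coe_compl, Set.mem_compl_iff, Finset.mem_coe,
      Finset.mem_union, SimpleGraph.mem_neighborFinset]
    tauto
  have h1 : (H.neighborFinset y ∪ H.neighborFinset z).card = 6 := by
    rw [Finset.card_union_of_disjoint, hcard, hcard]
    rw [Finset.disjoint_left]
    intro v h1 h2
    rw [SimpleGraph.mem_neighborFinset] at h1 h2
    exact ht v ⟨h1, h2⟩
  have haz' : ¬ H.Adj a z := fun h => ht a ⟨ha, h.symm⟩
  have hbz' : ¬ H.Adj b z := fun h => ht b ⟨hb, h.symm⟩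
  have h2 : (H.neighborFinset a ∪ H.neighborFinset b).card = 5 := by
    have h3 : H.neighborFinset a ∩ H.neighborFinset b = {y} := by
      ext v
      simp only [Finset.mem_inter, SimpleGraph.mem_neighborFinset, Finset.mem_singleton]
      constructor
      · rintro ⟨h4, h5⟩
        by_contra hvy
        by_cases h : H.Adj a b
        -- A second common neighbour `v` of adjacent `a`, `b` is not adjacent to `y`, and then `y`
        -- and `v` share both `a` and `b`.
        · refine hab (common_unique hH (Ne.symm hvy) (fun h6 => ?_) ha h4.symm hb h5.symm)
          rcases hv v h6 with rfl | rfl | rfl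
          · exact H.loopless.irrefl _ h4
          · exact H.loopless.irrefl _ h5
          · exact haz' h4
        · exact hvy (common_unique hH hab h h4 h5 ha.symm hb.symm)
      · rintro rfl
        exact ⟨ha.symm, hb.symm⟩
    have h4 := Finset.card_union_add_card_inter (H.neighborFinset a) (H.neighborFinset b)
    rw [h3, hcard, hcard, Finset.card_singleton] at h4
    omega
  have hz : ∀ c v, H.Adj y c → ¬ H.Adj c z → c ≠ z → H.Adj z v → H.Adj c v → v = y :=
    fun c v h3 h4 h5 h6 h7 => common_unique hH h5 h4 h7 h6 h3.symm hyz.symm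
  have h3 : ((H.neighborFinset y ∪ H.neighborFinset z) ∩
      (H.neighborFinset a ∪ H.neighborFinset b)).card = if H.Adj a b then 3 else 1 := by
    have hbz : b ≠ z := fun h => by
      subst h
      have h4 := Finset.card_le_card (s := H.neighborFinset y) (t := {a, b}) (fun v h5 => by
        rw [SimpleGraph.mem_neighborFinset] at h5
        rcases hv v h5 with rfl | rfl | rfl <;> simp)
      rw [hcard] at h4
      exact absurd (h4.trans Finset.card_le_two) (by norm_num)
    split_ifs with h
    · have h4 : (H.neighborFinset y ∪ H.neighborFinset z) ∩
          (H.neighborFinset a ∪ H.neighborFinset b) = {y, a, b} := by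
        ext v
        simp only [Finset.mem_inter, Finset.mem_union, SimpleGraph.mem_neighborFinset,
          Finset.mem_singleton, Finset.mem_insert]
        constructor
        · rintro ⟨h5 | h5, h6⟩
          · rcases hv v h5 with rfl | rfl | rfl
            · simp
            · simp
            · tauto
          · rcases h6 with h6 | h6
            · exact Or.inl (hz a v ha haz' haz h5 h6)
            · exact Or.inl (hz b v hb hbz' hbz h5 h6)
        · rintro (rfl | rfl | rfl)
          · exact ⟨Or.inr hyz.symm, Or.inl ha.symm⟩
          · exact ⟨Or.inl ha, Or.inr h.symm⟩
          · exact ⟨Or.inl hb, Or.inl h⟩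
      rw [h4, Finset.card_eq_three]
      exact ⟨y, a, b, ha.ne, hb.ne, hab, rfl⟩
    · have h4 : (H.neighborFinset y ∪ H.neighborFinset z) ∩
          (H.neighborFinset a ∪ H.neighborFinset b) = {y} := by
        ext v
        simp only [Finset.mem_inter, Finset.mem_union, SimpleGraph.mem_neighborFinset,
          Finset.mem_singleton]
        constructor
        · rintro ⟨h5 | h5, h6⟩
          · rcases hv v h5 with rfl | rfl | rfl
            · rcases h6 with h6 | h6
              · exact (H.loopless.irrefl _ h6).elim
              · exact (h h6.symm).elim
            · rcases h6 with h6 | h6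
              · exact (h h6).elim
              · exact (H.loopless.irrefl _ h6).elim
            · tauto
          · rcases h6 with h6 | h6
            · exact hz a v ha haz' haz h5 h6
            · exact hz b v hb hbz' hbz h5 h6
        · rintro rfl
          exact ⟨Or.inr hyz.symm, Or.inl ha.symm⟩
      rw [h4, Finset.card_singleton]
  have h4 := Finset.card_union_add_card_inter (H.neighborFinset y ∪ H.neighborFinset z)
    (H.neighborFinset a ∪ H.neighborFinset b)
  rw [h1, h2, h3] at h4
  rw [hset, Set.ncard_coe_finset, Finset.card_compl, Fintype.card_fin]
  split_ifs at h4 ⊢ <;> omega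

/-- The segment with the two handles exchanged. -/
def reverse (S : Segment) : Segment :=
  ⟨S.H, S.good, S.z, S.y, S.adj.symm, fun w h => S.no_triangle w h.symm⟩

/-- A triangle at `y` avoids `z`, because `yz` lies in no triangle; so it uses the two handle
vertices. -/
theorem inTriangle_iff_adj {S : Segment} {a b : Fin 14} (ha : S.H.Adj S.y a) (hb : S.H.Adj S.y b)
    (hv : ∀ v, S.H.Adj S.y v → v = a ∨ v = b ∨ v = S.z) : InTriangle S.H S.y ↔ S.H.Adj a b := by
  constructor
  · rintro ⟨u, v, hu, hw, huv⟩
    have hu' : u ≠ S.z := fun h => S.no_triangle v ⟨hw, h ▸ huv⟩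
    have hv' : v ≠ S.z := fun h => S.no_triangle u ⟨hu, h ▸ huv.symm⟩
    rcases hv u hu with rfl | rfl | rfl <;> rcases hv v hw with rfl | rfl | rfl
    any_goals contradiction
    · exact (huv.ne rfl).elim
    · exact huv
    · exact huv.symm
    · exact (huv.ne rfl).elim
  · exact fun h => ⟨a, b, ha, hb, h⟩

open Classical in
theorem ncard_avoiding (S : Segment) :
    {v | ¬ S.H.Adj S.y v ∧ ¬ S.H.Adj S.z v ∧
      ∀ u, S.H.Adj S.y u → u ≠ S.z → ¬ S.H.Adj u v}.ncard =
      if InTriangle S.H S.y then 6 else 4 := by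
  obtain ⟨a, b, hab, ha, hb, haz, hbz, hv⟩ := exists_handle_eq S
  rw [if_congr (inTriangle_iff_adj ha hb hv) rfl rfl,
    ← ncard_core S.good S.adj S.no_triangle hab ha hb haz hv]
  congr 1
  ext v
  simp only [Set.mem_ofPred_eq]
  constructor
  · exact fun h => ⟨h.1, h.2.1, h.2.2 a ha haz, h.2.2 b hb hbz⟩
  · rintro ⟨h1, h2, h3, h4⟩
    refine ⟨h1, h2, fun u hu huz => ?_⟩
    rcases hv u hu with rfl | rfl | rfl
    · exact h3
    · exact h4
    · exact (huz rfl).elim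

open Classical in
theorem type_eq (S : Segment) :
    S.type = (if InTriangle S.H S.y then 6 else 4, if InTriangle S.H S.z then 6 else 4) := by
  refine Prod.ext ?_ ?_
  · change (S.core S.handle₁).ncard = _
    rw [← ncard_avoiding S, ← Set.ncard_image_of_injective _ Subtype.val_injective]
    congr 1
    ext v
    constructor
    · rintro ⟨v, ⟨h1, h2, h3⟩, rfl⟩
      exact ⟨h1, h2, fun u hu huz => h3 ⟨u, hu.ne', huz⟩ hu⟩
    · rintro ⟨h1, h2, h3⟩
      refine ⟨⟨v, ?_, ?_⟩, ⟨h1, h2, fun u hu => h3 u.1 hu u.2.2⟩, rfl⟩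
      · rintro rfl
        exact h2 S.adj.symm
      · rintro rfl
        exact h1 S.adj
  · change (S.core S.handle₂).ncard = _
    have h := ncard_avoiding (reverse S)
    change _ = if InTriangle S.H S.z then 6 else 4 at h
    rw [← h, ← Set.ncard_image_of_injective _ Subtype.val_injective]
    congr 1
    ext v
    constructor
    · rintro ⟨v, ⟨h1, h2, h3⟩, rfl⟩
      exact ⟨h2, h1, fun u hu huy => h3 ⟨u, huy, hu.ne'⟩ hu⟩
    · rintro ⟨h1, h2, h3⟩
      refine ⟨⟨v, ?_, ?_⟩, ⟨h2, h1, fun u hu => h3 u.1 hu u.2.1⟩, rfl⟩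
      · rintro rfl
        exact h1 S.adj.symm
      · rintro rfl
        exact h2 S.adj

/-- The type that belongs to the number of a type. -/
def typeOf (i : ℕ) : ℕ × ℕ := (if i < 2 then 6 else 4, if i % 2 = 0 then 6 else 4)

theorem typeOf_typeNum (S : Segment) (h : S.handle₁) :
    typeOf (typeNum (canonGraph S h)) = S.type := by
  classical
  have h1 := inTriangle_zero_canonGraph S h
  have h2 := inTriangle_one_canonGraph S h
  rw [type_eq, typeNum, typeOf, if_congr h1 rfl rfl, if_congr h2 rfl rfl]
  by_cases h3 : InTriangle S.H S.y <;> by_cases h4 : InTriangle S.H S.z <;> simp [h3, h4]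

theorem typeOf_inj {i j : ℕ} (hi : i < 4) (hj : j < 4) (h : typeOf i = typeOf j) : i = j := by
  interval_cases i <;> interval_cases j <;> first | rfl | exact absurd h (by decide)

theorem inTriangle_iff_typeNum (x : CanonGraph) : InTriangle x.1 0 ↔ typeNum x < 2 := by
  classical
  rw [typeNum]
  split_ifs with h1 h2 <;> simp [h1]

theorem inTriangle_iff_exists (S : Segment) :
    InTriangle S.H S.y ↔ ∃ h k, (S.graph.induce S.handle₁).Adj h k := by
  constructor
  · rintro ⟨u, v, hu, hw, huv⟩
    have hu' : u ≠ S.z := fun h => S.no_triangle v ⟨hw, h ▸ huv⟩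
    have hv' : v ≠ S.z := fun h => S.no_triangle u ⟨hu, h ▸ huv.symm⟩
    exact ⟨⟨⟨u, hu.ne', hu'⟩, hu⟩, ⟨⟨v, hw.ne', hv'⟩, hw⟩, huv⟩
  · rintro ⟨h, k, hk⟩
    exact ⟨h.1.1, k.1.1, h.2, k.2, hk⟩

theorem inTriangle_iff_of_glue (P : SegmentPair) :
    InTriangle P.A.H P.A.y ↔ InTriangle P.B.H P.B.y := by
  rw [inTriangle_iff_exists, inTriangle_iff_exists]
  constructor
  · rintro ⟨h, k, hk⟩
    exact ⟨P.glue h, P.glue k, P.glue.map_adj_iff.2 hk⟩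
  · rintro ⟨h, k, hk⟩
    exact ⟨P.glue.symm h, P.glue.symm k, P.glue.symm.map_adj_iff.2 hk⟩

end SegmentCount

namespace SegmentCount

/-! ### Glued graphs -/

section glued

variable (P : SegmentPair)

open Classical in
/-- A section of the quotient map onto the vertices of the glued graph. -/
noncomputable def representative : P.Vertex → P.A.Vertex ⊕ P.B.Vertex :=
  Quot.lift (Sum.elim Sum.inl fun b => if hb : b ∈ P.B.handle₁ then
    Sum.inl (P.glue.symm ⟨b, hb⟩).1 else Sum.inr b) (by
      rintro _ _ ⟨h⟩
      simp)

theorem representative_inA (a : P.A.Vertex) : representative P (P.inA a) = Sum.inl a := rfl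

theorem representative_inB (h : P.B.handle₁) :
    representative P (P.inB h.1) = Sum.inl (P.glue.symm h).1 :=
  dif_pos h.2

theorem representative_inB_of_notMem {b : P.B.Vertex} (hb : b ∉ P.B.handle₁) :
    representative P (P.inB b) = Sum.inr b :=
  dif_neg hb

theorem inA_injective : Function.Injective P.inA := fun _ _ h =>
  Sum.inl_injective (congrArg (representative P) h)

theorem inB_injective : Function.Injective P.inB := by
  intro a b h
  have h1 := congrArg (representative P) h
  by_cases ha : a ∈ P.B.handle₁ <;> by_cases hb : b ∈ P.B.handle₁
  · rw [representative_inB P ⟨a, ha⟩, representative_inB P ⟨b, hb⟩] at h1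
    exact Subtype.ext_iff.1 (P.glue.symm.injective (Subtype.ext (Sum.inl_injective h1)))
  · rw [representative_inB P ⟨a, ha⟩, representative_inB_of_notMem P hb] at h1
    simp at h1
  · rw [representative_inB P ⟨b, hb⟩, representative_inB_of_notMem P ha] at h1
    simp at h1
  · rw [representative_inB_of_notMem P ha, representative_inB_of_notMem P hb] at h1
    exact Sum.inr_injective h1

theorem inA_eq_inB (h : P.A.handle₁) : P.inA h.1 = P.inB (P.glue h).1 :=
  Quot.sound (SegmentPair.Rel.glue h)

theorem exists_of_inA_eq_inB {a : P.A.Vertex} {b : P.B.Vertex} (hab : P.inA a = P.inB b) :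
    ∃ h : P.A.handle₁, a = h.1 ∧ b = (P.glue h).1 := by
  have h1 := congrArg (representative P) hab
  by_cases hb : b ∈ P.B.handle₁
  · rw [representative_inB P ⟨b, hb⟩, representative_inA] at h1
    exact ⟨P.glue.symm ⟨b, hb⟩, Sum.inl_injective h1, by simp⟩
  · rw [representative_inB_of_notMem P hb, representative_inA] at h1
    simp at h1

theorem graph_adj_iff (u v : P.Vertex) : P.graph.Adj u v ↔
    (∃ a b, P.A.graph.Adj a b ∧ P.inA a = u ∧ P.inA b = v) ∨
      ∃ a b, P.B.graph.Adj a b ∧ P.inB a = u ∧ P.inB b = v := by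
  rw [SegmentPair.graph, SimpleGraph.sup_adj]
  exact or_congr (SimpleGraph.map_adj ⟨P.inA, inA_injective P⟩ _ _ _)
    (SimpleGraph.map_adj ⟨P.inB, inB_injective P⟩ _ _ _)

/-- Gluing creates no new edge inside a segment: an edge of the other segment between two glued
vertices lies in its handle, and the gluing carries it to an edge of this one. -/
theorem graph_adj_inA {a b : P.A.Vertex} : P.graph.Adj (P.inA a) (P.inA b) ↔ P.A.graph.Adj a b := by
  rw [graph_adj_iff]
  constructor
  · rintro (⟨c, d, h, h1, h2⟩ | ⟨c, d, h, h1, h2⟩)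
    · rwa [← inA_injective P h1, ← inA_injective P h2]
    · obtain ⟨k, rfl, rfl⟩ := exists_of_inA_eq_inB P h1.symm
      obtain ⟨l, rfl, rfl⟩ := exists_of_inA_eq_inB P h2.symm
      exact P.glue.map_adj_iff.1 (show (P.B.graph.induce _).Adj (P.glue k) (P.glue l) from h)
  · exact fun h => Or.inl ⟨a, b, h, rfl, rfl⟩

theorem graph_adj_inB {a b : P.B.Vertex} : P.graph.Adj (P.inB a) (P.inB b) ↔ P.B.graph.Adj a b := by
  rw [graph_adj_iff]
  constructor
  · rintro (⟨c, d, h, h1, h2⟩ | ⟨c, d, h, h1, h2⟩)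
    · obtain ⟨k, rfl, rfl⟩ := exists_of_inA_eq_inB P h1
      obtain ⟨l, rfl, rfl⟩ := exists_of_inA_eq_inB P h2
      exact P.glue.map_adj_iff.2 (show (P.A.graph.induce _).Adj k l from h)
    · rwa [← inB_injective P h1, ← inB_injective P h2]
  · exact fun h => Or.inr ⟨a, b, h, rfl, rfl⟩

/-- The pair with the two segments exchanged. -/
def swapPair : SegmentPair := ⟨P.B, P.A, P.hB, P.hA, P.glue.symm⟩

/-- The identity of a glued graph, read as a map to the glued graph of the exchanged pair. -/
def swapMap : P.Vertex → (swapPair P).Vertex :=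
  Quot.lift (Sum.elim (swapPair P).inB (swapPair P).inA) (by
    rintro _ _ ⟨h⟩
    have := inA_eq_inB (swapPair P) (P.glue h)
    rw [show (swapPair P).glue (P.glue h) = h from P.glue.symm_apply_apply h] at this
    exact this.symm)

/-- The glued graph of the exchanged pair. -/
def swapIso : P.graph ≃g (swapPair P).graph where
  toFun := swapMap P
  invFun := swapMap (swapPair P)
  left_inv := by rintro ⟨a | b⟩ <;> rfl
  right_inv := by rintro ⟨a | b⟩ <;> rfl
  map_rel_iff' := by
    intro u v
    change (swapPair P).graph.Adj (swapMap P u) (swapMap P v) ↔ _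
    have hinj : Function.Injective (swapMap P) :=
      Function.LeftInverse.injective (g := swapMap (swapPair P)) (by rintro ⟨a | b⟩ <;> rfl)
    rw [graph_adj_iff, graph_adj_iff, or_comm]
    refine or_congr ?_ ?_
    · exact exists_congr fun a => exists_congr fun b => and_congr Iff.rfl (and_congr
        (hinj.eq_iff (a := P.inA a)) (hinj.eq_iff (a := P.inA b)))
    · exact exists_congr fun a => exists_congr fun b => and_congr Iff.rfl (and_congr
        (hinj.eq_iff (a := P.inB a)) (hinj.eq_iff (a := P.inB b)))

theorem mapTriple_swapIso_partA :
    SegmentPair.mapTriple (swapIso P) P.partA = (swapPair P).partB := by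
  refine Prod.ext ?_ (Prod.ext ?_ ?_)
  · exact (Set.range_comp (swapMap P) P.inA).symm
  · exact (Set.image_comp (swapMap P) P.inA _).symm
  · exact (Set.image_comp (swapMap P) P.inA _).symm

theorem mapTriple_swapIso_partB :
    SegmentPair.mapTriple (swapIso P) P.partB = (swapPair P).partA := by
  refine Prod.ext ?_ (Prod.ext ?_ ?_)
  · exact (Set.range_comp (swapMap P) P.inB).symm
  · exact (Set.image_comp (swapMap P) P.inB _).symm
  · exact (Set.image_comp (swapMap P) P.inB _).symm

end glued

/-! ### Matching pairs -/

/-- Isomorphism of segment pairs in the given order of the segments. -/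
def OrderedIsomorphic (P Q : SegmentPair) : Prop :=
  ∃ f : P.graph ≃g Q.graph, SegmentPair.mapTriple f P.partA = Q.partA ∧
    SegmentPair.mapTriple f P.partB = Q.partB

theorem isomorphic_iff (P Q : SegmentPair) : SegmentPair.Isomorphic P Q ↔
    OrderedIsomorphic P Q ∨ OrderedIsomorphic P (swapPair Q) := by
  have key : ∀ (f : P.graph ≃g Q.graph) s,
      SegmentPair.mapTriple (f.trans (swapIso Q)) s =
        SegmentPair.mapTriple (swapIso Q) (SegmentPair.mapTriple f s) :=
    fun f s => SegmentPair.mapTriple_comp (swapIso Q) f s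
  constructor
  · rintro ⟨f, ⟨h1, h2⟩ | ⟨h1, h2⟩⟩
    · exact Or.inl ⟨f, h1, h2⟩
    · refine Or.inr ⟨f.trans (swapIso Q), ?_, ?_⟩
      · rw [key, h1, mapTriple_swapIso_partB]
      · rw [key, h2, mapTriple_swapIso_partA]
  · rintro (⟨f, h1, h2⟩ | ⟨f, h1, h2⟩)
    · exact ⟨f, Or.inl ⟨h1, h2⟩⟩
    · refine ⟨f.trans (swapIso Q).symm, Or.inr ⟨?_, ?_⟩⟩
      · refine (SegmentPair.mapTriple_comp (swapIso Q).symm f _).trans ?_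
        rw [h1]
        exact SegmentPair.mapTriple_symm _ (mapTriple_swapIso_partB Q)
      · refine (SegmentPair.mapTriple_comp (swapIso Q).symm f _).trans ?_
        rw [h2]
        exact SegmentPair.mapTriple_symm _ (mapTriple_swapIso_partA Q)

/-- Isomorphisms between the first and between the second segments that are compatible with the
gluings. -/
def Matches (P Q : SegmentPair) : Prop :=
  ∃ (π : P.A.H ≃g Q.A.H) (ρ : P.B.H ≃g Q.B.H), (π P.A.y = Q.A.y ∧ π P.A.z = Q.A.z) ∧
    (ρ P.B.y = Q.B.y ∧ ρ P.B.z = Q.B.z) ∧ ∀ (h : P.A.handle₁) (k : Q.A.handle₁),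
      π h.1.1 = k.1.1 → ρ (P.glue h).1.1 = (Q.glue k).1.1

/-- The pair of canonical graphs of a segment pair with a distinguished vertex of the first
handle. -/
noncomputable def canonPair (P : SegmentPair) (h : P.A.handle₁) : CanonGraph × CanonGraph :=
  (canonGraph P.A h, canonGraph P.B (P.glue h))

theorem canonPair_other {P : SegmentPair} {h k : P.A.handle₁} (hk : k ≠ h) :
    canonPair P k = (turn (canonPair P h).1, turn (canonPair P h).2) :=
  Prod.ext (canonGraph_other hk) (canonGraph_other (P.glue.injective.ne hk))

/-- The image of a vertex of the first handle under an isomorphism of segments. -/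
def mapHandle {S T : Segment} (π : S.H ≃g T.H) (hπ : π S.y = T.y ∧ π S.z = T.z) (h : S.handle₁) :
    T.handle₁ :=
  ⟨⟨π h.1.1, by
    rw [← hπ.1]
    exact π.injective.ne h.1.2.1, by
    rw [← hπ.2]
    exact π.injective.ne h.1.2.2⟩, by
    change T.H.Adj T.y (π h.1.1)
    rw [← hπ.1]
    exact π.map_adj_iff.2 h.2⟩

/-- Agreement of the gluings at one handle vertex suffices: bijections between two-element sets that
agree at one element agree at the other. -/
theorem matches_iff {P Q : SegmentPair} :
    Matches P Q ↔ ∃ h k, canonPair P h = canonPair Q k := by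
  constructor
  · rintro ⟨π, ρ, hπ, hρ, hg⟩
    obtain ⟨h⟩ : Nonempty P.A.handle₁ := inferInstance
    exact ⟨h, mapHandle π hπ h, Prod.ext (canonGraph_eq_iff.2 ⟨π, hπ.1, hπ.2, rfl⟩)
      (canonGraph_eq_iff.2 ⟨ρ, hρ.1, hρ.2, hg _ _ rfl⟩)⟩
  · rintro ⟨h, k, hhk⟩
    obtain ⟨π, π0, π1, π2⟩ := canonGraph_eq_iff.1 (congrArg Prod.fst hhk)
    obtain ⟨ρ, ρ0, ρ1, ρ2⟩ := canonGraph_eq_iff.1 (congrArg Prod.snd hhk)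
    refine ⟨π, ρ, ⟨π0, π1⟩, ⟨ρ0, ρ1⟩, fun h' k' hk' => ?_⟩
    have hval : ∀ {S : Segment} {l m : S.handle₁}, l.1.1 = m.1.1 → l = m :=
      fun h => Subtype.ext (Subtype.ext h)
    by_cases hh : h' = h
    · subst hh
      rw [hval (hk'.symm.trans π2), ρ2]
    · have hkk : k' ≠ k := by
        rintro rfl
        exact hh (hval (π.injective (hk'.trans π2.symm)))
      rcases eq_or_eq_of_handle (Q.glue.injective.ne hkk)
        (mapHandle ρ ⟨ρ0, ρ1⟩ (P.glue h')) with h1 | h1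
      · have h2 : ρ (P.glue h').1.1 = ρ (P.glue h).1.1 :=
          (congrArg (fun l => l.1.1) h1).trans ρ2.symm
        exact (hh (P.glue.injective (hval (ρ.injective h2)))).elim
      · exact congrArg (fun l => l.1.1) h1

end SegmentCount

namespace SegmentCount

/-! ### Isomorphic pairs match -/

theorem vertex_trichotomy (S : Segment) (v : Fin 14) :
    v = S.y ∨ v = S.z ∨ ∃ a : S.Vertex, v = a.1 := by
  by_cases h1 : v = S.y
  · exact Or.inl h1
  · by_cases h2 : v = S.z
    · exact Or.inr (Or.inl h2)
    · exact Or.inr (Or.inr ⟨⟨v, h1, h2⟩, rfl⟩)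

/-- The handles record the neighbours of the deleted vertices `y` and `z`, so an isomorphism of
segments respecting both handles extends to the 14-vertex graphs by sending `y` to `y` and `z` to
`z`. -/
theorem exists_iso_of_map {S T : Segment} {V W : Type} {i : S.Vertex → V} {j : T.Vertex → W}
    (hi : Function.Injective i) (hj : Function.Injective j) {f : V → W} (hf : Function.Injective f)
    (h0 : f '' Set.range i = Set.range j) (h1 : f '' (i '' S.handle₁) = j '' T.handle₁)
    (h2 : f '' (i '' S.handle₂) = j '' T.handle₂)
    (hadj : ∀ a b a' b', f (i a) = j a' → f (i b) = j b' →
      (S.graph.Adj a b ↔ T.graph.Adj a' b')) :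
    ∃ π : S.H ≃g T.H, (π S.y = T.y ∧ π S.z = T.z) ∧
      ∀ (a : S.Vertex) (a' : T.Vertex), π a.1 = a'.1 ↔ f (i a) = j a' := by
  classical
  have hex : ∀ a, ∃ a', f (i a) = j a' := fun a => by
    have : f (i a) ∈ Set.range j := h0 ▸ ⟨i a, ⟨a, rfl⟩, rfl⟩
    obtain ⟨a', ha'⟩ := this
    exact ⟨a', ha'.symm⟩
  choose g hg using hex
  have hmem : ∀ (s : Set S.Vertex) (t : Set T.Vertex), f '' (i '' s) = j '' t →
      ∀ a, a ∈ s ↔ g a ∈ t := by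
    intro s t hst a
    rw [← hj.mem_set_image, ← hst, ← hg, hf.mem_set_image, hi.mem_set_image]
  have hginj : Function.Injective g := fun a b hab => hi (hf (by rw [hg, hg, hab]))
  let F : Fin 14 → Fin 14 := fun v =>
    if hy : v = S.y then T.y else if hz : v = S.z then T.z else (g ⟨v, hy, hz⟩).1
  have Fy : F S.y = T.y := dif_pos rfl
  have Fz : F S.z = T.z := by
    change (if hy : S.z = S.y then _ else _) = _
    rw [dif_neg S.adj.ne', dif_pos rfl]
  have Fa : ∀ a : S.Vertex, F a.1 = (g a).1 := fun a => by
    change (if hy : a.1 = S.y then _ else _) = _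
    rw [dif_neg a.2.1, dif_neg a.2.2]
  have hFinj : Function.Injective F := by
    intro v w hvw
    rcases vertex_trichotomy S v with rfl | rfl | ⟨a, rfl⟩ <;>
      rcases vertex_trichotomy S w with rfl | rfl | ⟨b, rfl⟩ <;>
      simp only [Fy, Fz, Fa] at hvw
    · rfl
    · exact (T.adj.ne hvw).elim
    · exact ((g b).2.1 hvw.symm).elim
    · exact (T.adj.ne' hvw).elim
    · rfl
    · exact ((g b).2.2 hvw.symm).elim
    · exact ((g a).2.1 hvw).elim
    · exact ((g a).2.2 hvw).elim
    · exact congrArg _ (hginj (Subtype.ext hvw))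
  have k1 : ∀ a : S.Vertex, T.H.Adj T.y (g a).1 ↔ S.H.Adj S.y a.1 := fun a => (hmem _ _ h1 a).symm
  have k2 : ∀ a : S.Vertex, T.H.Adj T.z (g a).1 ↔ S.H.Adj S.z a.1 := fun a => (hmem _ _ h2 a).symm
  have k3 : ∀ a b : S.Vertex, T.H.Adj (g a).1 (g b).1 ↔ S.H.Adj a.1 b.1 := fun a b =>
    (hadj a b _ _ (hg a) (hg b)).symm
  refine ⟨⟨Equiv.ofBijective F (Finite.injective_iff_bijective.1 hFinj), fun {v w} => ?_⟩,
    ⟨Fy, Fz⟩, fun a a' => ?_⟩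
  · change T.H.Adj (F v) (F w) ↔ S.H.Adj v w
    rcases vertex_trichotomy S v with rfl | rfl | ⟨a, rfl⟩ <;>
      rcases vertex_trichotomy S w with rfl | rfl | ⟨b, rfl⟩ <;>
      simp only [Fy, Fz, Fa, SimpleGraph.irrefl, S.adj, T.adj, S.adj.symm, T.adj.symm]
    · exact k1 b
    · exact k2 b
    · rw [T.H.adj_comm, S.H.adj_comm]
      exact k1 a
    · rw [T.H.adj_comm, S.H.adj_comm]
      exact k2 a
    · exact k3 a b
  · change F a.1 = a'.1 ↔ _
    rw [Fa, hg, hj.eq_iff, ← Subtype.ext_iff]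

/-- The map between the vertex sets of two segments. -/
def vertexEquiv {S T : Segment} (π : S.H ≃g T.H) (hπ : π S.y = T.y ∧ π S.z = T.z) :
    S.Vertex ≃ T.Vertex :=
  π.toEquiv.subtypeEquiv fun v => by
    change v ≠ S.y ∧ v ≠ S.z ↔ π v ≠ T.y ∧ π v ≠ T.z
    rw [← hπ.1, ← hπ.2, π.injective.ne_iff, π.injective.ne_iff]

theorem vertexEquiv_adj {S T : Segment} {π : S.H ≃g T.H} {hπ : π S.y = T.y ∧ π S.z = T.z}
    {a b : S.Vertex} :
    T.graph.Adj (vertexEquiv π hπ a) (vertexEquiv π hπ b) ↔ S.graph.Adj a b :=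
  π.map_adj_iff (v := a.1) (w := b.1)

theorem vertexEquiv_image {S T : Segment} {π : S.H ≃g T.H} (hπ : π S.y = T.y ∧ π S.z = T.z) :
    vertexEquiv π hπ '' S.handle₁ = T.handle₁ ∧ vertexEquiv π hπ '' S.handle₂ = T.handle₂ := by
  constructor <;> ext v <;> obtain ⟨v, rfl⟩ := (vertexEquiv π hπ).surjective v <;>
    rw [(vertexEquiv π hπ).injective.mem_set_image]
  · change S.H.Adj S.y v.1 ↔ T.H.Adj T.y (π v.1)
    rw [← hπ.1, π.map_adj_iff]
  · change S.H.Adj S.z v.1 ↔ T.H.Adj T.z (π v.1)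
    rw [← hπ.2, π.map_adj_iff]

theorem rel_iff {P : SegmentPair} {u v : P.A.Vertex ⊕ P.B.Vertex} :
    P.Rel u v ↔ ∃ h : P.A.handle₁, u = Sum.inl h.1 ∧ v = Sum.inr (P.glue h).1 := by
  constructor
  · rintro ⟨h⟩
    exact ⟨h, rfl, rfl⟩
  · rintro ⟨h, rfl, rfl⟩
    exact SegmentPair.Rel.glue h

/-- An isomorphism of glued graphs restricts to both segments, and its two restrictions agree on the
glued vertices. Conversely, isomorphisms compatible with the gluings descend to the quotient. -/
theorem orderedIsomorphic_iff {P Q : SegmentPair} : OrderedIsomorphic P Q ↔ Matches P Q := by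
  constructor
  · rintro ⟨f, hA, hB⟩
    have a0 := congrArg Prod.fst hA
    have a1 := congrArg (fun t => t.2.1) hA
    have a2 := congrArg (fun t => t.2.2) hA
    have b0 := congrArg Prod.fst hB
    have b1 := congrArg (fun t => t.2.1) hB
    have b2 := congrArg (fun t => t.2.2) hB
    obtain ⟨π, hπ, hπf⟩ := exists_iso_of_map (inA_injective P) (inA_injective Q) f.injective
      a0 a1 a2 fun a b a' b' h1 h2 => by
        rw [← graph_adj_inA, ← graph_adj_inA, ← h1, ← h2, f.map_adj_iff]
    obtain ⟨ρ, hρ, hρf⟩ := exists_iso_of_map (inB_injective P) (inB_injective Q) f.injective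
      b0 b1 b2 fun a b a' b' h1 h2 => by
        rw [← graph_adj_inB, ← graph_adj_inB, ← h1, ← h2, f.map_adj_iff]
    refine ⟨π, ρ, hπ, hρ, fun h k hk => ?_⟩
    rw [hρf, ← inA_eq_inB, ← inA_eq_inB, ← hπf, hk]
  · rintro ⟨π, ρ, hπ, hρ, hg⟩
    have hglue : ∀ h k, vertexEquiv π hπ h.1 = k.1 ↔
        vertexEquiv ρ hρ (P.glue h).1 = (Q.glue k).1 := by
      intro h k
      have h1 : vertexEquiv ρ hρ (P.glue h).1 = (Q.glue (mapHandle π hπ h)).1 :=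
        Subtype.ext (hg h (mapHandle π hπ h) rfl)
      rw [h1, ← Subtype.ext_iff, Q.glue.injective.eq_iff, Subtype.ext_iff (a1 := mapHandle π hπ h)]
      rfl
    let e : P.Vertex ≃ Q.Vertex := Quot.congr ((vertexEquiv π hπ).sumCongr (vertexEquiv ρ hρ)) (by
      intro u v
      rw [rel_iff, rel_iff]
      constructor
      · rintro ⟨h, rfl, rfl⟩
        exact ⟨mapHandle π hπ h, rfl, congrArg Sum.inr ((hglue h _).1 rfl)⟩
      · rintro ⟨k, hu, hv⟩
        rcases u with u | u
        · rcases v with v | v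
          · cases hv
          · have hu' : vertexEquiv π hπ u = k.1 := Sum.inl_injective hu
            have hv' : vertexEquiv ρ hρ v = (Q.glue k).1 := Sum.inr_injective hv
            have hmem : u ∈ P.A.handle₁ := by
              rw [← (vertexEquiv π hπ).injective.mem_set_image, (vertexEquiv_image hπ).1, hu']
              exact k.2
            have h1 := (hglue ⟨u, hmem⟩ k).1 hu'
            exact ⟨⟨u, hmem⟩, rfl, congrArg Sum.inr
              ((vertexEquiv ρ hρ).injective (hv'.trans h1.symm))⟩
        · cases hu)
    have eA : ∀ a, e (P.inA a) = Q.inA (vertexEquiv π hπ a) := fun a => rfl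
    have eB : ∀ b, e (P.inB b) = Q.inB (vertexEquiv ρ hρ b) := fun b => rfl
    refine ⟨⟨e, fun {u v} => ?_⟩, ?_, ?_⟩
    · rw [graph_adj_iff, graph_adj_iff]
      refine or_congr ?_ ?_
      · rw [(vertexEquiv π hπ).surjective.exists]
        refine exists_congr fun a => ?_
        rw [(vertexEquiv π hπ).surjective.exists]
        refine exists_congr fun b => ?_
        rw [← eA, ← eA, e.injective.eq_iff, e.injective.eq_iff, vertexEquiv_adj]
      · rw [(vertexEquiv ρ hρ).surjective.exists]
        refine exists_congr fun a => ?_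
        rw [(vertexEquiv ρ hρ).surjective.exists]
        refine exists_congr fun b => ?_
        rw [← eB, ← eB, e.injective.eq_iff, e.injective.eq_iff, vertexEquiv_adj]
    · have hs : ∀ s, e '' (P.inA '' s) = Q.inA '' (vertexEquiv π hπ '' s) := fun s => by
        rw [Set.image_image, Set.image_image]
        rfl
      refine Prod.ext ?_ (Prod.ext ?_ ?_)
      · change e '' Set.range P.inA = Set.range Q.inA
        rw [← Set.image_univ, hs, Set.image_univ_of_surjective (vertexEquiv π hπ).surjective, Set.image_univ]
      · exact (hs _).trans (congrArg _ (vertexEquiv_image hπ).1)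
      · exact (hs _).trans (congrArg _ (vertexEquiv_image hπ).2)
    · have hs : ∀ s, e '' (P.inB '' s) = Q.inB '' (vertexEquiv ρ hρ '' s) := fun s => by
        rw [Set.image_image, Set.image_image]
        rfl
      refine Prod.ext ?_ (Prod.ext ?_ ?_)
      · change e '' Set.range P.inB = Set.range Q.inB
        rw [← Set.image_univ, hs, Set.image_univ_of_surjective (vertexEquiv ρ hρ).surjective, Set.image_univ]
      · exact (hs _).trans (congrArg _ (vertexEquiv_image hρ).1)
      · exact (hs _).trans (congrArg _ (vertexEquiv_image hρ).2)

/-- The four cases are the orbit of `canonPair P h`: the distinguished vertex may correspond to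
either glued vertex, and the segments may be matched in either order. -/
theorem isomorphic_iff_canonPair {P Q : SegmentPair} (h : P.A.handle₁) (k : Q.A.handle₁) :
    SegmentPair.Isomorphic P Q ↔
      canonPair Q k = canonPair P h ∨
      canonPair Q k = (turn (canonPair P h).1, turn (canonPair P h).2) ∨
      canonPair Q k = (canonPair P h).swap ∨
      canonPair Q k = (turn (canonPair P h).2, turn (canonPair P h).1) := by
  have key : ∀ (Q : SegmentPair) (k : Q.A.handle₁), Matches P Q ↔ canonPair Q k = canonPair P h ∨
      canonPair Q k = (turn (canonPair P h).1, turn (canonPair P h).2) := by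
    intro Q k
    obtain ⟨h', hh'⟩ := exists_other P.A h
    obtain ⟨k', hk'⟩ := exists_other Q.A k
    have e1 := canonPair_other hh'
    have e2 := canonPair_other hk'
    rw [matches_iff]
    constructor
    · rintro ⟨a, b, hab⟩
      rcases eq_or_eq_of_handle hh' a with rfl | rfl <;>
        rcases eq_or_eq_of_handle hk' b with rfl | rfl
      · exact Or.inl hab.symm
      · right
        rw [hab, e2]
        exact Prod.ext (turn_involutive _).symm (turn_involutive _).symm
      · right
        rw [← e1, hab]
      · left
        rw [e1, e2] at hab
        exact (Prod.ext (turn_involutive.injective (congrArg Prod.fst hab))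
          (turn_involutive.injective (congrArg Prod.snd hab))).symm
    · rintro (h1 | h1)
      · exact ⟨h, k, h1.symm⟩
      · exact ⟨h', k, by rw [e1, h1]⟩
  have hs : canonPair (swapPair Q) (Q.glue k) = (canonPair Q k).swap :=
    Prod.ext rfl (congrArg (canonGraph Q.A) (Q.glue.symm_apply_apply k))
  have hswap : ∀ p q : CanonGraph × CanonGraph, p.swap = q ↔ p = q.swap := fun p q => by
    rw [← Prod.swap_inj, Prod.swap_swap]
  rw [isomorphic_iff, orderedIsomorphic_iff, orderedIsomorphic_iff, key Q k,
    key (swapPair Q) (Q.glue k), hs, or_assoc, hswap, hswap]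
  exact Iff.rfl

end SegmentCount

namespace SegmentCount

/-! ### The count -/

theorem mem_handle_toSegment {x : CanonGraph} (v : Fin 14) :
    (v ≠ 1 ∧ x.1.Adj 0 v) ↔ v = 2 ∨ v = 3 := by
  constructor
  · rintro ⟨h1, h2⟩
    rcases eq_or_eq_of_handle (three_ne_two x) ⟨⟨v, h2.ne', h1⟩, h2⟩ with h | h
    · exact Or.inl (congrArg (fun l => l.1.1) h)
    · exact Or.inr (congrArg (fun l => l.1.1) h)
  · rintro (rfl | rfl)
    · exact ⟨by decide, x.2.1.adj02⟩
    · exact ⟨by decide, x.2.1.adj03 x.2.2⟩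

theorem inTriangle_zero_iff (x : CanonGraph) : InTriangle x.1 0 ↔ x.1.Adj 2 3 := by
  refine inTriangle_iff_adj (S := toSegment x) x.2.1.adj02 (x.2.1.adj03 x.2.2) fun v hv => ?_
  by_cases h : v = 1
  · exact Or.inr (Or.inr h)
  · exact ((mem_handle_toSegment v).1 ⟨h, hv⟩).imp_right Or.inl

theorem adj_congr_of_inTriangle {x y : CanonGraph} (h : InTriangle x.1 0 ↔ InTriangle y.1 0)
    {v w : Fin 14} (hv : v = 2 ∨ v = 3) (hw : w = 2 ∨ w = 3) : x.1.Adj v w ↔ y.1.Adj v w := by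
  rw [inTriangle_zero_iff, inTriangle_zero_iff] at h
  rcases hv with rfl | rfl <;> rcases hw with rfl | rfl
  · simp
  · exact h
  · rw [x.1.adj_comm, y.1.adj_comm, h]
  · simp

/-- The vertices of the first handle in another canonical graph. -/
def transfer (x y : CanonGraph) (v : (toSegment x).handle₁) : (toSegment y).handle₁ :=
  ⟨⟨v.1.1, v.1.2.1, v.1.2.2⟩,
    ((mem_handle_toSegment (x := y) _).2 ((mem_handle_toSegment (x := x) _).1 ⟨v.1.2.2, v.2⟩)).2⟩

/-- The gluing of two canonical graphs that identifies equal numbers. -/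
def transferIso {x y : CanonGraph} (h : InTriangle x.1 0 ↔ InTriangle y.1 0) :
    (toSegment x).graph.induce (toSegment x).handle₁ ≃g
      (toSegment y).graph.induce (toSegment y).handle₁ where
  toFun := transfer x y
  invFun := transfer y x
  left_inv _ := rfl
  right_inv _ := rfl
  map_rel_iff' {v w} := (adj_congr_of_inTriangle h
    ((mem_handle_toSegment (x := x) _).1 ⟨v.1.2.2, v.2⟩)
    ((mem_handle_toSegment (x := x) _).1 ⟨w.1.2.2, w.2⟩)).symm

theorem type_ne_iff (S : Segment) (h : S.handle₁) :
    S.type ≠ (4, 6) ↔ typeNum (canonGraph S h) ≠ 2 := by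
  rw [← typeOf_typeNum S h, Ne, show ((4, 6) : ℕ × ℕ) = typeOf 2 from rfl]
  exact not_congr ⟨typeOf_inj (typeNum_lt _) (by norm_num), congrArg typeOf⟩

/-- Both first handles consist of the numbers 2 and 3, and they are both edges or both non-edges.
Gluing 2 to 2 and 3 to 3 is thus an isomorphism. -/
theorem exists_canonPair_eq {x y : CanonGraph} (hx : typeNum x ≠ 2) (hy : typeNum y ≠ 2)
    (h : typeNum x < 2 ↔ typeNum y < 2) : ∃ P h, canonPair P h = (x, y) := by
  rw [← inTriangle_iff_typeNum, ← inTriangle_iff_typeNum] at h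
  refine ⟨⟨toSegment x, toSegment y, ?_, ?_, transferIso h⟩, two x,
    Prod.ext (canonGraph_two x) (canonGraph_two y)⟩
  · rwa [type_ne_iff _ (two x), canonGraph_two]
  · rwa [type_ne_iff _ (two y), canonGraph_two]

theorem typeNum_canonPair (P : SegmentPair) (h : P.A.handle₁) :
    typeNum (canonPair P h).1 ≠ 2 ∧ typeNum (canonPair P h).2 ≠ 2 ∧
      (typeNum (canonPair P h).1 < 2 ↔ typeNum (canonPair P h).2 < 2) := by
  refine ⟨(type_ne_iff _ _).1 P.hA, (type_ne_iff _ _).1 P.hB, ?_⟩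
  rw [← inTriangle_iff_typeNum, ← inTriangle_iff_typeNum]
  exact (inTriangle_zero_canonGraph _ _).trans ((inTriangle_iff_of_glue P).trans
    (inTriangle_zero_canonGraph _ _).symm)

/-- The numbers of canonical graphs, and of those fixed by the involution, with given type number. -/
structure IsCount (n s : ℕ → ℕ) : Prop where
  card_typeNum : ∀ i, Nat.card {x : CanonGraph // typeNum x = i} = n i
  card_turn : ∀ i, Nat.card {x : CanonGraph // turn x = x ∧ typeNum x = i} = s i
  n0 : n 0 = 32
  n1 : n 1 = 137
  n3 : n 3 = 559
  s0 : s 0 = 6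
  s1 : s 1 = 19
  s3 : s 3 = 47

/-- A type number 2 stands for the excluded type (4,6), so no value is needed there. -/
theorem exists_isCount : ∃ n s, IsCount n s := by
  obtain ⟨h0, h1, h2, h3, h6, h7⟩ := countKind_outputs
  refine ⟨_, _, fun i => rfl, fun i => rfl, ?_, ?_, ?_, ?_, ?_, ?_⟩
  · rw [card_typeNum (k := 0) (l := 1) rfl rfl, h0, h1]
  · rw [card_typeNum (k := 2) (l := 3) rfl rfl, h2, h3]
  · rw [card_typeNum (k := 6) (l := 7) rfl rfl, h6, h7]
  · rw [card_typeNum_turn (l := 1) rfl, h1]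
  · rw [card_typeNum_turn (l := 3) rfl, h3]
  · rw [card_typeNum_turn (l := 7) rfl, h7]

/-- A set of classes that is described by a symmetric condition on the two type numbers corresponds
to the orbits on the pairs of canonical graphs satisfying it. All such pairs occur because the
condition implies that of `exists_canonPair_eq`. -/
theorem four_mul_card_subset {q : ℕ → ℕ → Bool} (hq : ∀ i j, q i j = q j i)
    {n s : ℕ → ℕ} (hns : IsCount n s) (hq' : ∀ i j, q i j = true → i ≠ 2 ∧ j ≠ 2 ∧ (i < 2 ↔ j < 2)) {U : Set SegmentPairClass}
    (hU : ∀ (P : SegmentPair) (h : P.A.handle₁), Quotient.mk SegmentPair.setoid P ∈ U ↔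
      q (typeNum (canonPair P h).1) (typeNum (canonPair P h).2) = true) :
    4 * U.ncard =
      (∑ i ∈ Finset.range 4, ∑ j ∈ Finset.range 4, if q i j then n i * n j else 0) +
      (∑ i ∈ Finset.range 4, ∑ j ∈ Finset.range 4, if q i j then s i * s j else 0) +
      2 * ∑ i ∈ Finset.range 4, if q i i then n i else 0 := by
  have hex : ∀ p : {p : CanonGraph × CanonGraph // q (typeNum p.1) (typeNum p.2) = true},
      ∃ P h, canonPair P h = p.1 := fun p =>
    exists_canonPair_eq (hq' _ _ p.2).1 (hq' _ _ p.2).2.1 (hq' _ _ p.2).2.2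
  choose F H hF using hex
  have key := four_mul_card_pair_classes turn_involutive typeNum typeNum_lt typeNum_turn q hq
    (C := U) (fun p => ⟨Quotient.mk SegmentPair.setoid (F p), (hU _ (H p)).2 (by rw [hF]; exact p.2)⟩)
    (by
      rintro ⟨c, hc⟩
      induction c using Quotient.inductionOn with
      | h P =>
        obtain ⟨h⟩ : Nonempty P.A.handle₁ := inferInstance
        refine ⟨⟨canonPair P h, (hU P h).1 hc⟩, Subtype.ext (Quotient.sound ?_)⟩
        exact (isomorphic_iff_canonPair (H _) h).2 (Or.inl (hF ⟨canonPair P h, (hU P h).1 hc⟩).symm))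
    (by
      intro a b
      have h1 := isomorphic_iff_canonPair (H a) (H b)
      rw [hF a, hF b] at h1
      exact Subtype.ext_iff.trans ((Quotient.eq (r := SegmentPair.setoid)).trans h1))
  simp only [hns.card_typeNum, hns.card_turn] at key
  exact key

theorem isOfTypes_iff (P : SegmentPair) (h : P.A.handle₁) {i j : ℕ} (hi : i < 4) (hj : j < 4) :
    P.IsOfTypes (typeOf i) (typeOf j) ↔
      (typeNum (canonPair P h).1 = i ∧ typeNum (canonPair P h).2 = j) ∨
      (typeNum (canonPair P h).1 = j ∧ typeNum (canonPair P h).2 = i) := by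
  have key : ∀ (S : Segment) (h : S.handle₁) {i : ℕ}, i < 4 →
      (S.type = typeOf i ↔ typeNum (canonGraph S h) = i) := fun S h i hi => by
    rw [← typeOf_typeNum S h]
    exact ⟨typeOf_inj (typeNum_lt _) hi, congrArg typeOf⟩
  exact or_congr (and_congr (key _ _ hi) (key _ _ hj)) (and_congr (key _ _ hj) (key _ _ hi))

/-- The condition on type numbers for being made of segments of two given types. -/
def typesAre (i j k l : ℕ) : Bool := decide ((k = i ∧ l = j) ∨ (k = j ∧ l = i))

/-- The condition may be read off from any representative: `turn` preserves type numbers, and the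
exchange of segments is absorbed by the symmetry of the condition. -/
theorem mk_mem_ofTypes_iff {i j : ℕ} (hi : i < 4) (hj : j < 4) (P : SegmentPair)
    (h : P.A.handle₁) :
    Quotient.mk SegmentPair.setoid P ∈ SegmentPairClass.ofTypes (typeOf i) (typeOf j) ↔
      typesAre i j (typeNum (canonPair P h).1) (typeNum (canonPair P h).2) = true := by
  rw [typesAre, decide_eq_true_iff]
  constructor
  · rintro ⟨Q, hQ, hQP⟩
    obtain ⟨k⟩ : Nonempty Q.A.handle₁ := inferInstance
    rw [isOfTypes_iff Q k hi hj] at hQ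
    rcases (isomorphic_iff_canonPair k h).1 (Quotient.exact hQP) with h1 | h1 | h1 | h1 <;>
      rw [h1]
    · exact hQ
    · simpa only [typeNum_turn] using hQ
    · exact hQ.symm.imp And.symm And.symm
    · simpa only [typeNum_turn] using hQ.symm.imp And.symm And.symm
  · exact fun h1 => ⟨P, (isOfTypes_iff P h hi hj).2 h1, rfl⟩

theorem four_mul_ncard_ofTypes {n s : ℕ → ℕ} (hns : IsCount n s) {i j : ℕ} (hi : i < 4) (hj : j < 4) (hi2 : i ≠ 2) (hj2 : j ≠ 2)
    (hij : i < 2 ↔ j < 2) :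
    4 * (SegmentPairClass.ofTypes (typeOf i) (typeOf j)).ncard =
      (∑ k ∈ Finset.range 4, ∑ l ∈ Finset.range 4, if typesAre i j k l then n k * n l else 0) +
      (∑ k ∈ Finset.range 4, ∑ l ∈ Finset.range 4, if typesAre i j k l then s k * s l else 0) +
      2 * ∑ k ∈ Finset.range 4, if typesAre i j k k then n k else 0 :=
  four_mul_card_subset (fun k l => by simp only [typesAre, decide_eq_decide]; tauto) hns
    (fun k l h => by
      rw [typesAre, decide_eq_true_iff] at h
      rcases h with ⟨rfl, rfl⟩ | ⟨rfl, rfl⟩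
      · exact ⟨hi2, hj2, hij⟩
      · exact ⟨hj2, hi2, hij.symm⟩) (mk_mem_ofTypes_iff hi hj)

theorem four_mul_card_segmentPairClass {n s : ℕ → ℕ} (hns : IsCount n s) :
    4 * Nat.card SegmentPairClass = 4 * 86333 := by
  have h := four_mul_card_subset
    (q := fun k l => decide (k ≠ 2 ∧ l ≠ 2 ∧ (k < 2 ↔ l < 2))) (U := Set.univ)
    (fun k l => by simp only [decide_eq_decide]; tauto) hns
    (fun k l h => of_decide_eq_true h)
    (fun P h => ⟨fun _ => decide_eq_true (typeNum_canonPair P h), fun _ => Set.mem_univ _⟩)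
  rw [Set.ncard_univ] at h
  rw [h]
  simp [Finset.sum_range_succ, hns.n0, hns.n1, hns.n3, hns.s0, hns.s1, hns.s3]

end SegmentCount

/-! ### The main theorem -/

open SegmentCount in
theorem mainTheorem6 :
    Nat.card SegmentPairClass = 86333 ∧
    (SegmentPairClass.ofTypes (6, 6) (6, 6)).ncard = 281 ∧
    (SegmentPairClass.ofTypes (6, 6) (6, 4)).ncard = 2249 ∧
    (SegmentPairClass.ofTypes (6, 4) (6, 4)).ncard = 4851 ∧
    (SegmentPairClass.ofTypes (4, 4) (4, 4)).ncard = 78952 := by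
  obtain ⟨n, s, hns⟩ := exists_isCount
  refine ⟨Nat.eq_of_mul_eq_mul_left (by norm_num)
    (four_mul_card_segmentPairClass hns), ?_, ?_, ?_, ?_⟩
  -- The type numbers 0, 1, 3 stand for (6,6), (6,4), (4,4). Here the count is 4 · 281 = 32² + 6² +
  -- 2 · 32.
  · have h := four_mul_ncard_ofTypes hns (i := 0) (j := 0) (by norm_num) (by norm_num) (by norm_num)
      (by norm_num) (by norm_num)
    simp [Finset.sum_range_succ, typesAre, typeOf, hns.n0, hns.s0] at h
    omega
  -- With two different types no pair is fixed by an exchange: 4 · 2249 = 2 · 32 · 137 + 2 · 6 · 19.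
  · have h := four_mul_ncard_ofTypes hns (i := 0) (j := 1) (by norm_num) (by norm_num) (by norm_num)
      (by norm_num) (by norm_num)
    simp [Finset.sum_range_succ, typesAre, typeOf, hns.n0, hns.n1, hns.s0, hns.s1] at h
    omega
  · have h := four_mul_ncard_ofTypes hns (i := 1) (j := 1) (by norm_num) (by norm_num) (by norm_num)
      (by norm_num) (by norm_num)
    simp [Finset.sum_range_succ, typesAre, typeOf, hns.n1, hns.s1] at h
    omega
  · have h := four_mul_ncard_ofTypes hns (i := 3) (j := 3) (by norm_num) (by norm_num) (by norm_num)
      (by norm_num) (by norm_num)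
    simp [Finset.sum_range_succ, typesAre, typeOf, hns.n3, hns.s3] at h
    omega
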